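/- Let $\mathcal O$ be a discrete valuation ring with finite residue field $\kappa$, $q=|\kappa|$ (for example the local ring, or the completed local ring, of a smooth projective curve over a finite field at a closed point $x$; then $q=q_x$ and finite $\mathcal O$-modules are the same as torsion sheaves supported at $x$). Let $k$ be a field of characteristic $0$. Let $A$ be the Hall algebra over $k$ of the category of finite $\mathcal O$-modules: it consists of the finitely supported $k$-valued functions on isomorphism classes, with product $(f*g)(C)=\sum_{A'\subseteq C}f(A')\,g(C/A')$ and comultiplication $$\Delta(1_C)=\sum_{A'\subseteq C}\frac{|\mathrm{Aut}(A')|\,|\mathrm{Aut}(C/A')|}{|\mathrm{Aut}(C)|}\,1_{A'}\otimes 1_{C/A'},$$ where $1_C$ is the characteristic function of the class of $C$. Put $b_r=q^{r(r-1)/2}\,1_{\kappa^{r}}$. For a commutative $k$-algebra $R$ let $W(R)=\mathrm{Hom}_{k\text{-alg}}(A,R)$ and, for $\chi\in W(R)$, $B_\chi(t)=\sum_{r\ge 0}\chi(b_r)t^r$. The algebra $A$ is commutative, and $\chi\mapsto B_\chi$ is a bijection $W(R)\to 1+tR[[t]]$ for every $R$. The comultiplication $\Delta$ is an algebra homomorphism;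 the operation $\boxplus$ that it defines on $W=\mathrm{Spec}(A)$ satisfies $B_{\chi\boxplus\chi'}=B_\chi B_{\chi'}$. There is a unique morphism $\boxtimes\colon W\times W\to W$ such that $\prod_i(1-\alpha_it)\boxtimes\prod_j(1-\beta_jt)=\prod_{i,j}(1-\alpha_i\beta_jt)$ for all finite families $(\alpha_i)$, $(\beta_j)$ in commutative $k$-algebras, where points are identified with their series (the Witt multiplication, with unit $1-t$). Let $$\Psi(t)=\sum_F t^{\ell(F)}\,|\mathrm{Aut}(F)|\;1_F\otimes 1_F\in (A\otimes A)[[t]],$$ the sum being over isomorphism classes of finite $\mathcal O$-modules, $\ell(F)$ the length. Then: (a) There is a unique morphism $U\colon W\times W\to W$ with $B_{U(\chi,\chi')}(t)=(\chi\otimes\chi')(\Psi(t))$, i.e. with comorphism sending each $b_n$ to the coefficient of $t^n$ in $\Psi(t)$. It is a bihomomorphism for $\boxplus$. (b) $U$ is $W$-bilinear: for all $R$ and all $\chi,\chi',\chi''\in W(R)$, $$U(\chi\boxtimes\chi',\chi'')=U(\chi',\chi\boxtimes\chi'')=\chi\boxtimes U(\chi',\chi'').$$ Moreover there is a point $\varkappa\in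 W(k)$, with $B_\varkappa$ having integer coefficients, such that $U(\chi,\chi')=\chi\boxtimes\chi'\boxtimes\varkappa$ for all $R$ and all $\chi,\chi'\in W(R)$. (c) The point $\varkappa$ is given by $B_\varkappa(t)=\dfrac{1-t}{1-qt}$. -/

import Mathlib

open scoped TensorProduct

universe u v w

noncomputable section

namespace HallWitt

/-! ### Finite modules and their isomorphism classes -/

/-- A finite module over `O`: an `O`-module whose underlying set is finite. -/
structure FinMod (O : Type u) [CommRing O] : Type (u + 1) where
  carrier : Type u
  [grp : AddCommGroup carrier]
  [mod : Module O carrier]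
  [fin : Finite carrier]

attribute [instance] FinMod.grp FinMod.mod FinMod.fin

/-- Isomorphism of finite modules. -/
instance finModSetoid (O : Type u) [CommRing O] : Setoid (FinMod O) where
  r M N := Nonempty (M.carrier ≃ₗ[O] N.carrier)
  iseqv :=
    ⟨fun _ => ⟨LinearEquiv.refl O _⟩, fun ⟨e⟩ => ⟨e.symm⟩, fun ⟨e⟩ ⟨f⟩ => ⟨e.trans f⟩⟩

/-- The set of isomorphism classes of finite `O`-modules. -/
def IsoClass (O : Type u) [CommRing O] : Type (u + 1) := Quotient (finModSetoid O)

section IsoClass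

variable {O : Type u} [CommRing O]

/-- The isomorphism class of a finite module. -/
def cls (O : Type u) [CommRing O] (M : Type u) [AddCommGroup M] [Module O M] [Finite M] :
    IsoClass O :=
  Quotient.mk (finModSetoid O) ⟨M⟩

/-- A module representing an isomorphism class. -/
def IsoClass.rep (c : IsoClass O) : Type u := (Quotient.out c).carrier

instance (c : IsoClass O) : AddCommGroup c.rep := (Quotient.out c).grp
instance (c : IsoClass O) : Module O c.rep := (Quotient.out c).mod
instance (c : IsoClass O) : Finite c.rep := (Quotient.out c).fin

theorem cls_rep (c : IsoClass O) : cls O c.rep = c := Quotient.out_eq c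

theorem cls_eq {M N : Type u} [AddCommGroup M] [Module O M] [Finite M]
    [AddCommGroup N] [Module O N] [Finite N] (e : M ≃ₗ[O] N) : cls O M = cls O N :=
  Quotient.sound (s := finModSetoid O) ⟨e⟩

theorem cls_eq_iff {M N : Type u} [AddCommGroup M] [Module O M] [Finite M]
    [AddCommGroup N] [Module O N] [Finite N] : cls O M = cls O N ↔ Nonempty (M ≃ₗ[O] N) :=
  ⟨fun h => Quotient.exact (s := finModSetoid O) h, fun ⟨e⟩ => cls_eq e⟩

theorem rep_cls (M : Type u) [AddCommGroup M] [Module O M] [Finite M] :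
    Nonempty ((cls O M).rep ≃ₗ[O] M) :=
  cls_eq_iff.1 (cls_rep (cls O M))

instance finite_quotient (M : Type u) [AddCommGroup M] [Module O M] [Finite M]
    (A : Submodule O M) : Finite (M ⧸ A) :=
  Finite.of_surjective A.mkQ (Submodule.mkQ_surjective A)

instance finite_submodule (M : Type u) [AddCommGroup M] [Module O M] [Finite M] :
    Finite (Submodule O M) :=
  Finite.of_injective (fun A : Submodule O M => (A : Set M)) SetLike.coe_injective

instance fintype_submodule (M : Type u) [AddCommGroup M] [Module O M] [Finite M] :
    Fintype (Submodule O M) := Fintype.ofFinite _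

/-- The number of automorphisms of a module in the given class. -/
def autCard (c : IsoClass O) : ℕ := Nat.card (c.rep ≃ₗ[O] c.rep)

end IsoClass

/-! ### Finiteness of the number of modules of given cardinality -/

section Finiteness

variable {O : Type u} [CommRing O] [IsDomain O] [IsDiscreteValuationRing O]

open IsLocalRing

theorem pow_smul_top_eq_bot (M : Type u) [AddCommGroup M] [Module O M] [Finite M] :
    (maximalIdeal O) ^ (Nat.card M) • (⊤ : Submodule O M) = ⊥ := by
  have key : ∀ i : ℕ, (maximalIdeal O) ^ i • (⊤ : Submodule O M) = ⊥ ∨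
      Nat.card ↥((maximalIdeal O) ^ i • (⊤ : Submodule O M)) + i ≤ Nat.card M := by
    intro i
    induction i with
    | zero =>
      right
      simpa only [Nat.add_zero] using Nat.card_le_card_of_injective _
        (Subtype.val_injective (p := fun x => x ∈ (maximalIdeal O) ^ 0 • (⊤ : Submodule O M)))
    | succ i ih =>
      rcases ih with ih | ih
      · left
        rw [pow_succ', mul_smul, ih, Submodule.smul_bot]
      · by_cases h : (maximalIdeal O) ^ (i + 1) • (⊤ : Submodule O M) = ⊥
        · exact Or.inl h
        · right
          set N := (maximalIdeal O) ^ i • (⊤ : Submodule O M) with hN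
          have hs : (maximalIdeal O) ^ (i + 1) • (⊤ : Submodule O M) = maximalIdeal O • N := by
            rw [pow_succ', mul_smul]
          rw [hs] at h ⊢
          have hlt : maximalIdeal O • N < N := by
            refine lt_of_le_of_ne Submodule.smul_le_right fun he => h ?_
            have : N = ⊥ := Submodule.eq_bot_of_le_smul_of_le_jacobson_bot (maximalIdeal O) N
              (Module.Finite.iff_fg.1 inferInstance) he.ge
              (IsLocalRing.maximalIdeal_le_jacobson ⊥)
            rw [this, Submodule.smul_bot]
          have : Nat.card ↥(maximalIdeal O • N) < Nat.card ↥N :=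
            Set.Finite.card_lt_card (Set.toFinite _) hlt
          omega
  rcases key (Nat.card M) with h | h
  · exact h
  · have : 0 < Nat.card ↥((maximalIdeal O) ^ (Nat.card M) • (⊤ : Submodule O M)) :=
      Nat.card_pos
    omega

variable [Finite (ResidueField O)]

theorem finite_card_eq (N : ℕ) : {c : IsoClass O | Nat.card c.rep = N}.Finite := by
  classical
  let P : Submodule O (Fin N → O) := Submodule.pi Set.univ fun _ => (maximalIdeal O) ^ N
  have hfin : Finite (O ⧸ (maximalIdeal O) ^ N) := by
    have : Finite (O ⧸ maximalIdeal O) := ‹Finite (ResidueField O)›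
    exact Ideal.finite_quotient_pow (IsNoetherian.noetherian _) N
  have hP : Finite ((Fin N → O) ⧸ P) :=
    Finite.of_equiv _ (Submodule.quotientPi fun _ : Fin N => (maximalIdeal O) ^ N).symm.toEquiv
  have hS : (Set.univ : Set (Set.Ici P)).Finite := by
    have : Finite (Submodule O ((Fin N → O) ⧸ P)) :=
      Finite.of_injective 
        (fun A : Submodule O ((Fin N → O) ⧸ P) => (A : Set ((Fin N → O) ⧸ P))) SetLike.coe_injective
    have : Finite (Set.Ici P) := Finite.of_equiv _ (Submodule.comapMkQRelIso P).toEquiv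
    exact Set.finite_univ
  let F : Set.Ici P → IsoClass O := fun K =>
    if h : Finite ((Fin N → O) ⧸ K.1) then @cls O _ ((Fin N → O) ⧸ K.1) _ _ h
    else cls O PUnit.{u + 1}
  refine (hS.image F).subset ?_
  intro c hc
  have e : Fin N ≃ c.rep := (Finite.equivFinOfCardEq hc).symm
  let φ : (Fin N → O) →ₗ[O] c.rep := Fintype.linearCombination O e
  have hφ : Function.Surjective φ := by
    intro m
    refine ⟨Pi.single (e.symm m) 1, ?_⟩
    simp [φ]
  have hK : P ≤ LinearMap.ker φ := by
    intro f hf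
    rw [LinearMap.mem_ker]
    simp only [φ, Fintype.linearCombination_apply]
    refine Finset.sum_eq_zero fun i _ => ?_
    have h1 : f i ∈ (maximalIdeal O) ^ N := (Submodule.mem_pi.1 hf) i (Set.mem_univ i)
    have h2 : f i • e i ∈ (maximalIdeal O) ^ (Nat.card c.rep) • (⊤ : Submodule O c.rep) := by
      rw [show Nat.card c.rep = N from hc]
      exact Submodule.smul_mem_smul h1 Submodule.mem_top
    rwa [pow_smul_top_eq_bot, Submodule.mem_bot] at h2
  have eq := LinearMap.quotKerEquivOfSurjective φ hφ
  have hf : Finite ((Fin N → O) ⧸ LinearMap.ker φ) := Finite.of_equiv _ eq.symm.toEquiv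
  refine ⟨⟨LinearMap.ker φ, hK⟩, Set.mem_univ _, ?_⟩
  simp only [F]
  rw [dif_pos hf, cls_eq eq, cls_rep]

end Finiteness

/-! ### The Hall algebra -/

/-- The Hall algebra of the category of finite `O`-modules: finitely supported functions on
isomorphism classes. -/
def Hall (k : Type v) [Field k] (O : Type u) [CommRing O] : Type (max (u + 1) v) :=
  IsoClass O →₀ k

section Hall

variable (k : Type v) [Field k] (O : Type u) [CommRing O]

instance : AddCommGroup (Hall k O) := inferInstanceAs (AddCommGroup (IsoClass O →₀ k))
instance : Module k (Hall k O) := inferInstanceAs (Module k (IsoClass O →₀ k))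
instance : FunLike (Hall k O) (IsoClass O) k := inferInstanceAs (FunLike (IsoClass O →₀ k) _ _)

/-- The characteristic function of an isomorphism class. -/
def ind (c : IsoClass O) : Hall k O := Finsupp.single c (1 : k)

variable {k O}

@[ext] theorem Hall.ext {f g : Hall k O} (h : ∀ c, f c = g c) : f = g := Finsupp.ext h

@[simp] theorem Hall.add_apply (f g : Hall k O) (c : IsoClass O) : (f + g) c = f c + g c := rfl
@[simp] theorem Hall.zero_apply (c : IsoClass O) : (0 : Hall k O) c = 0 := rfl
@[simp] theorem Hall.smul_apply (a : k) (f : Hall k O) (c : IsoClass O) :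
    (a • f) c = a * f c := rfl

/-- The Hall convolution of two functions, evaluated at a finite module `C`:
the sum over all submodules `A` of `C` of `f(A) g(C/A)`. -/
def conv (f g : IsoClass O → k) (C : Type u) [AddCommGroup C] [Module O C] [Finite C] : k :=
  ∑ A : Submodule O C, f (cls O A) * g (cls O (C ⧸ A))

theorem conv_congr (f g : IsoClass O → k) {C D : Type u} [AddCommGroup C] [Module O C] [Finite C]
    [AddCommGroup D] [Module O D] [Finite D] (e : C ≃ₗ[O] D) : conv f g C = conv f g D := by
  unfold conv
  refine Fintype.sum_equiv (Submodule.orderIsoMapComap e).toEquiv _ _ fun A => ?_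
  congr 2
  · exact cls_eq (e.submoduleMap A)
  · exact cls_eq (Submodule.Quotient.equiv A _ e rfl)

theorem conv_rep_cls (f g : IsoClass O → k) (M : Type u) [AddCommGroup M] [Module O M]
    [Finite M] : conv f g (cls O M).rep = conv f g M :=
  conv_congr f g (rep_cls M).some

theorem conv_assoc (f g h : IsoClass O → k) (C : Type u) [AddCommGroup C] [Module O C]
    [Finite C] :
    conv (fun c => conv f g c.rep) h C = conv f (fun c => conv g h c.rep) C := by
  classical
  have hL : conv (fun c => conv f g c.rep) h C =
      ∑ B : Submodule O C, ∑ A : Submodule O B,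
        f (cls O A) * g (cls O (B ⧸ A)) * h (cls O (C ⧸ B)) := by
    unfold conv
    refine Finset.sum_congr rfl fun B _ => ?_
    have := conv_rep_cls f g B
    unfold conv at this
    beta_reduce
    rw [this, Finset.sum_mul]
  have hR : conv f (fun c => conv g h c.rep) C =
      ∑ A : Submodule O C, ∑ D : Submodule O (C ⧸ A),
        f (cls O A) * g (cls O D) * h (cls O ((C ⧸ A) ⧸ D)) := by
    unfold conv
    refine Finset.sum_congr rfl fun A _ => ?_
    have := conv_rep_cls g h (C ⧸ A)
    unfold conv at this
    beta_reduce
    rw [this, Finset.mul_sum]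
    simp only [mul_assoc]
  rw [hL, hR, Finset.sum_sigma', Finset.sum_sigma']
  refine Finset.sum_bij'
    (i := fun p _ => ⟨p.2.map p.1.subtype, p.1.map (p.2.map p.1.subtype).mkQ⟩)
    (j := fun p _ => ⟨p.2.comap p.1.mkQ, p.1.comap (p.2.comap p.1.mkQ).subtype⟩)
    (fun _ _ => by simp) (fun _ _ => by simp) ?_ ?_ ?_
  · rintro ⟨B, A⟩ -
    have hB : (B.map (A.map B.subtype).mkQ).comap (A.map B.subtype).mkQ = B := by
      rw [Submodule.comap_map_mkQ]
      exact sup_eq_right.2 (Submodule.map_subtype_le B A)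
    refine Sigma.ext hB ?_
    have : ∀ B' : Submodule O C, B' = B →
        HEq (Submodule.comap B'.subtype (A.map B.subtype)) A := by
      rintro _ rfl
      rw [Submodule.comap_map_eq_of_injective (Submodule.subtype_injective _)]
    exact this _ hB
  · rintro ⟨A, D⟩ -
    have hA : (A.comap (D.comap A.mkQ).subtype).map (D.comap A.mkQ).subtype = A := by
      rw [Submodule.map_comap_subtype]
      refine inf_eq_right.2 ?_
      intro x hx
      rw [Submodule.mem_comap, (Submodule.Quotient.mk_eq_zero A (x := x)).2 hx |> fun h =>
        (show A.mkQ x = 0 from h)]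
      exact D.zero_mem
    refine Sigma.ext hA ?_
    have : ∀ A' : Submodule O C, A' = A → HEq ((D.comap A.mkQ).map A'.mkQ) D := by
      rintro _ rfl
      rw [Submodule.map_comap_eq_of_surjective (Submodule.mkQ_surjective _)]
    exact this _ hA
  · rintro ⟨B, A⟩ -
    have hle : A.map B.subtype ≤ B := Submodule.map_subtype_le B A
    have e1 : A ≃ₗ[O] A.map B.subtype :=
      Submodule.equivMapOfInjective _ (Submodule.subtype_injective _) A
    have e3 : ((C ⧸ A.map B.subtype) ⧸ B.map (A.map B.subtype).mkQ) ≃ₗ[O] C ⧸ B :=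
      Submodule.quotientQuotientEquivQuotient _ _ hle
    have e2 : (B ⧸ A) ≃ₗ[O] B.map (A.map B.subtype).mkQ := by
      let φ : B →ₗ[O] B.map (A.map B.subtype).mkQ :=
        (A.map B.subtype).mkQ.submoduleMap B
      have hs : Function.Surjective φ := LinearMap.submoduleMap_surjective _ _
      have hk : LinearMap.ker φ = A := by
        ext x
        rw [LinearMap.mem_ker, Subtype.ext_iff]
        change (A.map B.subtype).mkQ (x : C) = 0 ↔ _
        rw [Submodule.mkQ_apply, Submodule.Quotient.mk_eq_zero]
        simp
      exact (Submodule.quotEquivOfEq _ _ hk.symm).trans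
        (LinearMap.quotKerEquivOfSurjective φ hs)
    simp only
    rw [cls_eq e1, cls_eq e2, cls_eq e3]

/-- The unit is the characteristic function of the zero module. -/
instance : One (Hall k O) := ⟨ind k O (cls O PUnit.{u + 1})⟩

theorem Hall.one_apply (c : IsoClass O) :
    (1 : Hall k O) c = open Classical in if Subsingleton c.rep then 1 else 0 := by
  classical
  change (Finsupp.single (cls O PUnit.{u + 1}) (1 : k)) c = _
  rw [Finsupp.single_apply]
  refine if_congr ?_ rfl rfl
  constructor
  · rintro rfl
    exact (rep_cls (O := O) PUnit.{u + 1}).some.toEquiv.subsingleton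
  · intro h
    rw [← cls_rep c]
    exact cls_eq (LinearEquiv.ofSubsingleton (R := O) PUnit.{u + 1} c.rep)

theorem Hall.one_cls (M : Type u) [AddCommGroup M] [Module O M] [Finite M] :
    (1 : Hall k O) (cls O M) = open Classical in if Subsingleton M then 1 else 0 := by
  classical
  rw [Hall.one_apply]
  exact if_congr (rep_cls (O := O) M).some.toEquiv.subsingleton_congr rfl rfl

variable [IsDomain O] [IsDiscreteValuationRing O] [Finite (IsLocalRing.ResidueField O)]

theorem conv_support_finite (f g : Hall k O) :
    (Function.support fun c : IsoClass O => conv f g c.rep).Finite := by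
  classical
  have hf : (f : IsoClass O → k).support.Finite := Finsupp.hasFiniteSupport (α := IsoClass O) f
  have hg : (g : IsoClass O → k).support.Finite := Finsupp.hasFiniteSupport (α := IsoClass O) g
  have hT := (hf.prod hg).image fun p => Nat.card p.1.rep * Nat.card p.2.rep
  refine (hT.biUnion fun N _ => finite_card_eq (O := O) N).subset ?_
  intro c hc
  obtain ⟨A, -, hA⟩ := Finset.exists_ne_zero_of_sum_ne_zero hc
  rw [Set.mem_iUnion₂]
  refine ⟨Nat.card c.rep, ⟨(cls O A, cls O (c.rep ⧸ A)),
    ⟨left_ne_zero_of_mul hA, right_ne_zero_of_mul hA⟩, ?_⟩, rfl⟩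
  simp only
  rw [Nat.card_congr (rep_cls (O := O) A).some.toEquiv,
    Nat.card_congr (rep_cls (O := O) (c.rep ⧸ A)).some.toEquiv,
    Submodule.card_eq_card_quotient_mul_card A]

/-- The Hall product `(f * g)(C) = ∑_{A ⊆ C} f(A) g(C/A)`. -/
instance : Mul (Hall k O) where
  mul f g := Finsupp.ofSupportFinite (fun c => conv f g c.rep) (conv_support_finite f g)

theorem Hall.mul_apply (f g : Hall k O) (c : IsoClass O) : (f * g) c = conv f g c.rep := rfl

instance : Ring (Hall k O) :=
  { (inferInstance : AddCommGroup (Hall k O)) with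
    mul := (· * ·)
    one := 1
    left_distrib := fun f g h => by
      ext c
      simp [Hall.mul_apply, conv, mul_add, Finset.sum_add_distrib]
    right_distrib := fun f g h => by
      ext c
      simp [Hall.mul_apply, conv, add_mul, Finset.sum_add_distrib]
    zero_mul := fun f => by
      ext c
      simp [Hall.mul_apply, conv]
    mul_zero := fun f => by
      ext c
      simp [Hall.mul_apply, conv]
    mul_assoc := fun f g h => by
      ext c
      exact conv_assoc f g h c.rep
    one_mul := fun f => by
      classical
      ext c
      rw [Hall.mul_apply]
      unfold conv
      rw [Finset.sum_eq_single (⊥ : Submodule O c.rep)]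
      · have hs : Subsingleton (⊥ : Submodule O c.rep) := inferInstance
        rw [Hall.one_cls, if_pos hs, one_mul,
          cls_eq (Submodule.quotEquivOfEqBot (⊥ : Submodule O c.rep) rfl), cls_rep]
      · intro A _ hA
        rw [Hall.one_cls, if_neg, zero_mul]
        rwa [Submodule.subsingleton_iff_eq_bot]
      · simp
    mul_one := fun f => by
      classical
      ext c
      rw [Hall.mul_apply]
      unfold conv
      rw [Finset.sum_eq_single (⊤ : Submodule O c.rep)]
      · have hs : Subsingleton (c.rep ⧸ (⊤ : Submodule O c.rep)) := inferInstance
        rw [Hall.one_cls, if_pos hs, mul_one,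
          cls_eq (Submodule.topEquiv (R := O) (M := c.rep)), cls_rep]
      · intro A _ hA
        rw [Hall.one_cls, if_neg, mul_zero]
        intro hq
        exact hA (Submodule.unique_quotient_iff_eq_top.1 ⟨Unique.mk' _⟩)
      · simp }

instance : Algebra k (Hall k O) :=
  Algebra.ofModule
    (fun a f g => by
      ext c
      simp [Hall.mul_apply, conv, Finset.mul_sum, mul_assoc])
    (fun a f g => by
      ext c
      simp [Hall.mul_apply, conv, Finset.mul_sum, mul_left_comm])

end Hall

/-! ### The local Witt scheme -/

section Witt

variable (k : Type v) [Field k] (O : Type u) [CommRing O] [IsDomain O]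
  [IsDiscreteValuationRing O] [Finite (IsLocalRing.ResidueField O)]

/-- The cardinality of the residue field. -/
def resCard (O : Type u) [CommRing O] [IsLocalRing O] : ℕ :=
  Nat.card (IsLocalRing.ResidueField O)

/-- `b_r = q^{r(r-1)/2}` times the characteristic function of the `r`-dimensional vector space
over the residue field. -/
def bElt (r : ℕ) : Hall k O :=
  (resCard O : k) ^ (r * (r - 1) / 2) • ind k O (cls O (Fin r → IsLocalRing.ResidueField O))

theorem bElt_zero : bElt k O 0 = 1 := by
  have h : cls O (Fin 0 → IsLocalRing.ResidueField O) = cls O PUnit.{u + 1} :=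
    cls_eq (LinearEquiv.ofSubsingleton (R := O) _ _)
  simp only [bElt, h]
  simp
  rfl

/-- The Hall comultiplication
`Δ(1_C) = ∑_{A ⊆ C} (|Aut A| |Aut (C/A)| / |Aut C|) 1_A ⊗ 1_{C/A}`. -/
def comul : Hall k O →ₗ[k] Hall k O ⊗[k] Hall k O :=
  Finsupp.linearCombination k fun c : IsoClass O =>
    ∑ A : Submodule O c.rep,
      ((autCard (cls O A) : k) * (autCard (cls O (c.rep ⧸ A)) : k) / (autCard c : k)) •
        (ind k O (cls O A) ⊗ₜ[k] ind k O (cls O (c.rep ⧸ A)))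

/-- The series `Ψ(t) = ∑_F t^{ℓ(F)} |Aut F| 1_F ⊗ 1_F`. For each `n` there are only finitely many
isomorphism classes of length `n`. -/
def Psi : PowerSeries (Hall k O ⊗[k] Hall k O) :=
  PowerSeries.mk fun n =>
    ∑ᶠ (c : IsoClass O) (_ : Module.length O c.rep = n),
      (autCard c : k) • (ind k O c ⊗ₜ[k] ind k O c)

variable (R : Type w) [CommRing R] [Algebra k R]

/-- The set of `R`-points of the local Witt scheme `W = Spec A`, where `A` is the Hall algebra. -/
abbrev Pts : Type _ := Hall k O →ₐ[k] R

/-- The set `1 + t R[[t]]`. -/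
def OneAdd (R : Type w) [CommRing R] : Type w :=
  {f : PowerSeries R // PowerSeries.constantCoeff f = 1}

variable {k O R}

/-- The power series `B_χ(t) = 1 + ∑_{r ≥ 1} χ(b_r) t^r` of a point `χ`. -/
def bSeries (χ : Pts k O R) : OneAdd R :=
  ⟨PowerSeries.mk fun r => χ (bElt k O r), by
    rw [← PowerSeries.coeff_zero_eq_constantCoeff_apply, PowerSeries.coeff_mk, bElt_zero, map_one]⟩

/-- A morphism `W × W → W` over `k` is an algebra homomorphism `Φ : A → A ⊗ A`. This is the
induced operation `W(R) × W(R) → W(R)` on points. -/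
def op (Φ : Hall k O →ₐ[k] Hall k O ⊗[k] Hall k O) (χ χ' : Pts k O R) : Pts k O R :=
  (Algebra.TensorProduct.lift χ χ' fun _ _ => Commute.all _ _).comp Φ

/-- The point with values in `R` induced by a point with values in `k`. -/
def baseChange (R : Type w) [CommRing R] [Algebra k R] (χ : Pts k O k) : Pts k O R :=
  (Algebra.ofId k R).comp χ

/-- `Φ` is the Witt multiplication `⊠` of `W`, with the normalization
`(∏_i (1 - α_i t)) ⊠ (∏_j (1 - β_j t)) = ∏_{i,j} (1 - α_i β_j t)`. -/
def IsWittMul (Φ : Hall k O →ₐ[k] Hall k O ⊗[k] Hall k O) : Prop :=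
  ∀ (R : Type v) [CommRing R] [Algebra k R] (m n : ℕ) (α : Fin m → R) (β : Fin n → R)
    (χ χ' : Pts k O R),
    (bSeries χ).1 = ∏ i, (1 - PowerSeries.C (α i) * PowerSeries.X) →
    (bSeries χ').1 = ∏ j, (1 - PowerSeries.C (β j) * PowerSeries.X) →
    (bSeries (op Φ χ χ')).1 = ∏ i, ∏ j, (1 - PowerSeries.C (α i * β j) * PowerSeries.X)

/-- The power series `(1 - t) / (1 - q t)` with integer coefficients. -/
def kappaSeries (q : ℕ) : PowerSeries ℤ :=
  (1 - PowerSeries.X) * PowerSeries.invOfUnit (1 - PowerSeries.C (q : ℤ) * PowerSeries.X) 1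

end Witt

end HallWitt

end

open HallWitt

set_option linter.unusedSectionVars false
set_option linter.style.haveILetI false

noncomputable section

namespace HallWitt

open IsLocalRing

/-! ### Finite modules over a discrete valuation ring -/

section Modules

variable {O : Type u} [CommRing O] [IsDomain O] [IsDiscreteValuationRing O]

/-! The theorem becomes transparent in ghost coordinates. In characteristic `0` a point `χ` of `W`
is determined by the coefficients of `-B'/B`, where `B = B_χ`. The `n`-th coefficient of a product
of factors `1 - α t` is the power sum of the `α ^ (n + 1)`, so `⊞` adds ghost components and `⊠`
multiplies them. The claim is that `U` multiplies the `n`-th components of its arguments and then by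
`1 - q ^ (n + 1)`, which is the `n`-th component of `(1 - t) / (1 - q t)`. Bilinearity over `W` and
the formula with `κ` are then identities in commutative rings.

This needs the structure of the Hall algebra. The elements `b_r` commute, by duality of subspaces in
a vector space over the residue field. They generate: if `soc M` has dimension `r`, then `1_{κ^r} *
1_{M / soc M}` is `1_M` plus terms with strictly larger socle. They are algebraically independent by
a dimension count. Hence the Hall algebra is a polynomial ring (`hallEquiv`), which gives
commutativity, the bijection with `1 + t R[[t]]` and the existence of `U`.

The comultiplication is multiplicative by a case of Green's theorem. The `(X, Y)` coefficient of `Δ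
f` is the average of `f` over explicit extensions of `Y` by `X` (`tcoeff_comul_eq_average`).
Multiplication by `h_N`, the sum of all classes of cardinality `N`, counts surjections, and
surjections from all these extensions onto a fixed module can be counted (`sum_surjCard_extMod`).
The `h_N` generate, because `∑ (-1)^i b_i h_{q^(n-i)} = 0` for `n > 0`.

`U` is additive in each argument because the weights `|Aut F|` in `Ψ` make `Δ` dual to the product
(`op_psiHom_add_left`). The point `1 - α t` is supported on cyclic modules, so `U (1 - α t) (1 - β
t)` has series `∑ |Aut (O / π^n)| (α β)^n t^n = (1 - α β t) / (1 - q α β t)`. This proves the ghost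
formula for linear points, and by additivity for products of linear factors. Such points over an
algebraically closed field are dense (`eq_zero_of_isSplit`), so the formula holds in the tensor
square itself (`psiHom_ghElt`). The same density makes `⊠` unique. -/

variable (O) in
/-- A chosen uniformizer. -/
def unif : O := (IsDiscreteValuationRing.exists_irreducible O).choose

variable (O) in
theorem irreducible_unif : Irreducible (unif O) :=
  (IsDiscreteValuationRing.exists_irreducible O).choose_spec

variable (O) in
theorem maximalIdeal_eq_span_unif : maximalIdeal O = Ideal.span {unif O} :=
  (IsDiscreteValuationRing.irreducible_iff_uniformizer _).1 (irreducible_unif O)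

variable (O) in
theorem unif_ne_zero : unif O ≠ 0 := (irreducible_unif O).ne_zero

variable (O) in
/-- The cyclic module of length `n`. -/
abbrev Cyc (n : ℕ) : Type u := O ⧸ Ideal.span {unif O ^ n}

theorem cyc_mk_eq_zero {n : ℕ} {a : O} :
    (Ideal.Quotient.mk (Ideal.span {unif O ^ n}) a : Cyc O n) = 0 ↔ unif O ^ n ∣ a := by
  rw [Ideal.Quotient.eq_zero_iff_mem, Ideal.mem_span_singleton]

theorem span_unif_pow (n : ℕ) : Ideal.span {unif O ^ n} = maximalIdeal O ^ n := by
  rw [maximalIdeal_eq_span_unif, Ideal.span_singleton_pow]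

variable [Finite (ResidueField O)]

instance finite_cyc (n : ℕ) : Finite (Cyc O n) := by
  have : Finite (O ⧸ maximalIdeal O) := ‹Finite (ResidueField O)›
  rw [Cyc, span_unif_pow]
  exact Ideal.finite_quotient_pow (IsNoetherian.noetherian _) n

theorem card_cyc (n : ℕ) : Nat.card (Cyc O n) = resCard O ^ n := by
  have h := cardQuot_pow_of_prime (P := maximalIdeal O)
    (IsDiscreteValuationRing.not_a_field O) (i := n)
  rw [Submodule.cardQuot_apply, Submodule.cardQuot_apply] at h
  rw [Cyc, span_unif_pow]
  exact h

variable (O) in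
theorem one_lt_resCard : 1 < resCard O := Finite.one_lt_card

variable (O) in
theorem resCard_pos : 0 < resCard O := Nat.card_pos

theorem card_simple (M : Type*) [AddCommGroup M] [Module O M] [IsSimpleModule O M] :
    Nat.card M = resCard O := by
  obtain ⟨I, hI, ⟨e⟩⟩ := isSimpleModule_iff_quot_maximal.1 ‹IsSimpleModule O M›
  rw [eq_maximalIdeal hI] at e
  exact Nat.card_congr e.toEquiv

theorem exists_length_card (M : Type*) [AddCommGroup M] [Module O M] (h : IsFiniteLength O M) :
    ∃ n : ℕ, Module.length O M = n ∧ Nat.card M = resCard O ^ n := by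
  induction h with
  | of_subsingleton => exact ⟨0, by simp [Module.length_eq_zero], by simp⟩
  | @of_simple_quotient M _ _ N hs _ ih =>
    obtain ⟨n, h1, h2⟩ := ih
    refine ⟨n + 1, ?_, ?_⟩
    · have : IsSimpleModule O (M ⧸ N) := hs
      rw [Module.length_eq_add_of_exact N.subtype N.mkQ N.injective_subtype N.mkQ_surjective
        (LinearMap.exact_subtype_mkQ N), h1, Module.length_eq_one O (M ⧸ N)]
      simp
    · rw [Submodule.card_eq_card_quotient_mul_card N, h2, card_simple (O := O) (M ⧸ N), pow_succ, mul_comm]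

/-- Every composition factor is the residue field and `q > 1`, so length and cardinality determine
each other. The grading is expressed by cardinality from here on; length returns only in reading off
the coefficients of `Psi`. -/
theorem length_eq_iff_card {M : Type*} [AddCommGroup M] [Module O M] [Finite M] {n : ℕ} :
    Module.length O M = n ↔ Nat.card M = resCard O ^ n := by
  have : IsArtinian O M := isArtinian_of_finite
  obtain ⟨m, h1, h2⟩ := exists_length_card (O := O) M
    (isFiniteLength_iff_isNoetherian_isArtinian.2 ⟨inferInstance, inferInstance⟩)
  rw [h1, h2, Nat.pow_right_inj (one_lt_resCard O)]
  exact Nat.cast_inj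

theorem exists_card_eq_pow (M : Type*) [AddCommGroup M] [Module O M] [Finite M] :
    ∃ n : ℕ, Nat.card M = resCard O ^ n := by
  have : IsArtinian O M := isArtinian_of_finite
  obtain ⟨m, -, h⟩ := exists_length_card (O := O) M
    (isFiniteLength_iff_isNoetherian_isArtinian.2 ⟨inferInstance, inferInstance⟩)
  exact ⟨m, h⟩

/-! #### Modules killed by the uniformizer -/

theorem card_residue_pow (r : ℕ) : Nat.card (Fin r → ResidueField O) = resCard O ^ r := by
  simp [Nat.card_fun, resCard]

theorem unif_smul_residue (r : ℕ) (x : Fin r → ResidueField O) : unif O • x = 0 := by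
  ext i
  rw [Pi.smul_apply, Algebra.smul_def, ResidueField.algebraMap_eq,
    (residue_eq_zero_iff (unif O)).2 (irreducible_unif O).not_isUnit, zero_mul, Pi.zero_apply]

/-- A module killed by the uniformizer is a vector space over the residue field. -/
@[reducible] def residueModule (M : Type*) [AddCommGroup M] [Module O M]
    (h : ∀ x : M, unif O • x = 0) : Module (ResidueField O) M :=
  Module.IsTorsionBySet.module (I := maximalIdeal O) (by
    intro x a
    obtain ⟨a, ha⟩ := a
    rw [maximalIdeal_eq_span_unif, SetLike.mem_coe, Ideal.mem_span_singleton'] at ha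
    obtain ⟨b, rfl⟩ := ha
    change (b * unif O) • x = 0
    rw [mul_smul, h, smul_zero])

theorem residueModule_isScalarTower (M : Type*) [AddCommGroup M] [Module O M]
    (h : ∀ x : M, unif O • x = 0) :
    letI := residueModule M h
    IsScalarTower O (ResidueField O) M := by
  letI := residueModule M h
  exact Module.IsTorsionBySet.isScalarTower _

theorem exists_equiv_residue (M : Type*) [AddCommGroup M] [Module O M] [Finite M]
    (h : ∀ x : M, unif O • x = 0) :
    ∃ r, Nonempty (M ≃ₗ[O] (Fin r → ResidueField O)) := by
  letI := residueModule M h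
  have := residueModule_isScalarTower M h
  have e := (Module.finBasis (ResidueField O) M).equivFun
  exact ⟨_, ⟨e.restrictScalars O⟩⟩

/-- This recognises submodules and quotients isomorphic to `κ ^ r` by a torsion condition and a
cardinality, the form in which Hall numbers are computed. -/
theorem equiv_residue_iff {M : Type*} [AddCommGroup M] [Module O M] [Finite M] {r : ℕ} :
    Nonempty (M ≃ₗ[O] (Fin r → ResidueField O)) ↔
      (∀ x : M, unif O • x = 0) ∧ Nat.card M = resCard O ^ r := by
  constructor
  · rintro ⟨e⟩
    refine ⟨fun x => e.injective ?_, ?_⟩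
    · rw [map_smul, unif_smul_residue, map_zero]
    · rw [Nat.card_congr e.toEquiv, card_residue_pow]
  · rintro ⟨h, hc⟩
    obtain ⟨s, ⟨e⟩⟩ := exists_equiv_residue M h
    rw [Nat.card_congr e.toEquiv, card_residue_pow] at hc
    rw [Nat.pow_right_injective (one_lt_resCard O) hc] at e
    exact ⟨e⟩

/-- Duality of subspaces for a module killed by the uniformizer. -/
theorem exists_equiv_submodule_card_mul (M : Type*) [AddCommGroup M] [Module O M] [Finite M]
    (h : ∀ x : M, unif O • x = 0) :
    ∃ σ : Submodule O M ≃ Submodule O M,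
      ∀ A : Submodule O M, Nat.card A * Nat.card (σ A) = Nat.card M := by
  classical
  letI := residueModule M h
  have := residueModule_isScalarTower M h
  have hsurj : Function.Surjective (algebraMap O (ResidueField O)) := residue_surjective
  -- Since `O` surjects onto its residue field, `O`-submodules and subspaces are the same subsets.
  let e1 : Submodule O M ≃ Submodule (ResidueField O) M :=
    { toFun := fun A =>
        { A.toAddSubmonoid with
          smul_mem' := fun c x hx => by
            obtain ⟨a, rfl⟩ := hsurj c
            rw [algebraMap_smul]
            exact A.smul_mem a hx }
      invFun := fun A => A.restrictScalars O
      left_inv := fun _ => rfl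
      right_inv := fun _ => rfl }
  have he1 : ∀ A, Nat.card (e1 A) = Nat.card A := fun _ => rfl
  -- A subspace goes to its annihilator in the dual, which `e3` carries back to `M` through a basis.
  -- The choice of basis is harmless, since only cardinalities are recorded.
  let e2 : Submodule (ResidueField O) M ≃ Submodule (ResidueField O) (Module.Dual _ M) :=
    (Subspace.orderIsoFiniteDimensional (K := ResidueField O) (V := M)).toEquiv.trans
      OrderDual.ofDual
  let e3 : Submodule (ResidueField O) (Module.Dual (ResidueField O) M) ≃
    Submodule (ResidueField O) M :=
    (Submodule.orderIsoMapComap (Module.finBasis (ResidueField O) M).toDualEquiv.symm).toEquiv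
  refine ⟨e1.trans (e2.trans (e3.trans e1.symm)), fun A => ?_⟩
  have h1 : Nat.card ((e1.trans (e2.trans (e3.trans e1.symm))) A) =
      Nat.card (e1 A).dualAnnihilator := by
    simp only [Equiv.trans_apply]
    rw [← he1, Equiv.apply_symm_apply]
    exact (Nat.card_congr ((Module.finBasis (ResidueField O) M).toDualEquiv.symm.submoduleMap
        (e1 A).dualAnnihilator).toEquiv).symm
  rw [h1, ← he1 A, Module.natCard_eq_pow_finrank (K := ResidueField O) (V := e1 A),
    Module.natCard_eq_pow_finrank (K := ResidueField O) (V := (e1 A).dualAnnihilator),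
    Module.natCard_eq_pow_finrank (K := ResidueField O) (V := M), ← pow_add,
    Subspace.finrank_add_finrank_dualAnnihilator_eq]
end Modules

end HallWitt

namespace HallWitt

open IsLocalRing

/-! ### Classification of finite modules -/

section Classification

variable {O : Type u} [CommRing O] [IsDomain O] [IsDiscreteValuationRing O]
  [Finite (ResidueField O)]

theorem unif_pow_card_smul (M : Type u) [AddCommGroup M] [Module O M] [Finite M] (x : M) :
    unif O ^ Nat.card M • x = 0 := by
  have h : unif O ^ Nat.card M • x ∈ (maximalIdeal O) ^ (Nat.card M) • (⊤ : Submodule O M) := by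
    refine Submodule.smul_mem_smul (Ideal.pow_mem_pow ?_ _) Submodule.mem_top
    rw [maximalIdeal_eq_span_unif]
    exact Ideal.mem_span_singleton_self _
  rwa [pow_smul_top_eq_bot, Submodule.mem_bot] at h

theorem exists_equiv_pi_cyc (M : Type u) [AddCommGroup M] [Module O M] [Finite M] :
    ∃ (d : ℕ) (e : Fin d → ℕ), Nonempty (M ≃ₗ[O] ∀ i, Cyc O (e i)) := by
  classical
  obtain ⟨d, e, ⟨f⟩⟩ := Module.torsion_by_prime_power_decomposition (irreducible_unif O)
    (M := M) (fun {x} => ⟨⟨unif O ^ Nat.card M, _, rfl⟩, unif_pow_card_smul M x⟩)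
  exact ⟨d, e, ⟨f.trans (DirectSum.linearEquivFunOnFintype O (Fin d) _)⟩⟩

/-- The decomposition theorem allows exponents `0`, which contribute zero modules and spoil
uniqueness. They are discarded so that the multiset of exponents becomes an invariant. -/
theorem exists_equiv_pi_cyc_succ (M : Type u) [AddCommGroup M] [Module O M] [Finite M] :
    ∃ (ι : Type) (_ : Fintype ι) (e : ι → ℕ), Nonempty (M ≃ₗ[O] ∀ i, Cyc O (e i + 1)) := by
  classical
  obtain ⟨d, e, ⟨f⟩⟩ := exists_equiv_pi_cyc (O := O) M
  have h : ∀ i : {i // e i ≠ 0}, e i = e i - 1 + 1 := fun i =>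
    (Nat.succ_pred_eq_of_ne_zero i.2).symm
  have h0 : ∀ i, ¬ e i ≠ 0 → ∀ x : Cyc O (e i), x = 0 := by
    intro i hi x
    obtain ⟨a, rfl⟩ := Ideal.Quotient.mk_surjective x
    rw [cyc_mk_eq_zero, not_not.1 hi, pow_zero]
    exact one_dvd a
  let φ : (∀ i, Cyc O (e i)) ≃ₗ[O] ∀ i : {i // e i ≠ 0}, Cyc O (e i) :=
    { toFun := fun x i => x i
      map_add' := fun _ _ => rfl
      map_smul' := fun _ _ => rfl
      invFun := fun y i => if hi : e i ≠ 0 then y ⟨i, hi⟩ else 0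
      left_inv := fun x => by
        funext i
        by_cases hi : e i ≠ 0
        · exact dif_pos hi
        · exact (dif_neg hi).trans (h0 i hi _).symm
      right_inv := fun y => by
        funext i
        exact dif_pos i.2 }
  exact ⟨{i // e i ≠ 0}, inferInstance, fun i => e i - 1, ⟨(f.trans φ).trans
    (LinearEquiv.piCongrRight fun i => Submodule.quotEquivOfEq _ _ (by rw [← h i]))⟩⟩

theorem card_torsionBy_cyc (e j : ℕ) :
    Nat.card (Submodule.torsionBy O (Cyc O e) (unif O ^ j)) = resCard O ^ min e j := by
  rcases le_total e j with h | h
  · rw [min_eq_left h, ← card_cyc]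
    have : Submodule.torsionBy O (Cyc O e) (unif O ^ j) = ⊤ := by
      refine eq_top_iff.2 fun x _ => ?_
      obtain ⟨a, rfl⟩ := Ideal.Quotient.mk_surjective x
      rw [Submodule.mem_torsionBy_iff]
      change (Ideal.Quotient.mk _ (unif O ^ j * a) : Cyc O e) = 0
      rw [cyc_mk_eq_zero]
      exact (pow_dvd_pow _ h).mul_right a
    rw [this]
    exact Nat.card_congr Submodule.topEquiv.toEquiv
  · rw [min_eq_right h, ← card_cyc]
    obtain ⟨s, rfl⟩ := Nat.exists_eq_add_of_le h
    -- Multiplication by `π ^ s` identifies `O / π ^ j` with the `π ^ j`-torsion of `O / π ^ (j +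
    -- s)`.
    let φ : O →ₗ[O] Cyc O (j + s) :=
      (Submodule.mkQ (Ideal.span {unif O ^ (j + s)})).comp (LinearMap.mulLeft O (unif O ^ s))
    have hφ : ∀ a, φ a = (Ideal.Quotient.mk _ (unif O ^ s * a) : Cyc O (j + s)) := fun _ => rfl
    have hk : LinearMap.ker φ = Ideal.span {unif O ^ j} := by
      ext a
      rw [LinearMap.mem_ker, hφ, cyc_mk_eq_zero, Ideal.mem_span_singleton, add_comm j, pow_add,
        mul_dvd_mul_iff_left (pow_ne_zero _ (unif_ne_zero O))]
    have hr : LinearMap.range φ = Submodule.torsionBy O (Cyc O (j + s)) (unif O ^ j) := by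
      ext x
      obtain ⟨a, rfl⟩ := Ideal.Quotient.mk_surjective x
      rw [Submodule.mem_torsionBy_iff]
      change _ ↔ (Ideal.Quotient.mk _ (unif O ^ j * a) : Cyc O (j + s)) = 0
      have hd : unif O ^ (j + s) ∣ unif O ^ j * a ↔ unif O ^ s ∣ a := by
        rw [pow_add, mul_dvd_mul_iff_left (pow_ne_zero _ (unif_ne_zero O))]
      rw [cyc_mk_eq_zero, hd]
      constructor
      · rintro ⟨b, hb⟩
        rw [hφ, Ideal.Quotient.eq, Ideal.mem_span_singleton] at hb
        have h1 : unif O ^ s ∣ unif O ^ s * b - a :=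
          (pow_dvd_pow _ (Nat.le_add_left s j)).trans hb
        exact (dvd_sub_right (Dvd.intro _ rfl)).1 h1
      · rintro ⟨b, rfl⟩
        exact ⟨b, rfl⟩
    rw [← hr, ← Nat.card_congr φ.quotKerEquivRange.toEquiv]
    exact Nat.card_congr (Submodule.quotEquivOfEq _ _ hk).toEquiv

theorem card_torsionBy_congr {M N : Type*} [AddCommGroup M] [Module O M] [AddCommGroup N]
    [Module O N] (e : M ≃ₗ[O] N) (a : O) :
    Nat.card (Submodule.torsionBy O M a) = Nat.card (Submodule.torsionBy O N a) :=
  Nat.card_congr (e.toEquiv.subtypeEquiv fun x => by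
    change x ∈ Submodule.torsionBy O M a ↔ e x ∈ Submodule.torsionBy O N a
    rw [Submodule.mem_torsionBy_iff, Submodule.mem_torsionBy_iff, ← map_smul,
      LinearEquiv.map_eq_zero_iff])

theorem card_torsionBy_pi {ι : Type*} [Fintype ι] (e : ι → ℕ) (j : ℕ) :
    Nat.card (Submodule.torsionBy O (∀ i, Cyc O (e i)) (unif O ^ j)) =
      resCard O ^ ∑ i, min (e i) j := by
  have f : Submodule.torsionBy O (∀ i, Cyc O (e i)) (unif O ^ j) ≃
      ∀ i, Submodule.torsionBy O (Cyc O (e i)) (unif O ^ j) :=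
    { toFun := fun x i => ⟨x.1 i, congrFun ((Submodule.mem_torsionBy_iff _ _).1 x.2) i⟩
      invFun := fun x => ⟨fun i => (x i).1, (Submodule.mem_torsionBy_iff _ _).2 (funext fun i =>
        (Submodule.mem_torsionBy_iff _ _).1 (x i).2)⟩
      left_inv := fun _ => rfl
      right_inv := fun _ => rfl }
  rw [Nat.card_congr f, Nat.card_pi, ← Finset.prod_pow_eq_pow_sum]
  exact Finset.prod_congr rfl fun i _ => card_torsionBy_cyc _ _

/-- For fixed `e` the function `j ↦ min (e + 1) j` is piecewise linear with a single kink. Its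
second difference isolates the summands with `e i = j`, so the torsion counts recover the
multiplicity of each cyclic summand. -/
theorem sum_min_add_sum_min {ι : Type*} [Fintype ι] (e : ι → ℕ) (j : ℕ) :
    ∑ i, min (e i + 1) (j + 2) + ∑ i, min (e i + 1) j + Fintype.card {i // e i = j} =
      2 * ∑ i, min (e i + 1) (j + 1) := by
  classical
  rw [Fintype.card_subtype, Finset.card_filter, ← Finset.sum_add_distrib,
    ← Finset.sum_add_distrib, Finset.mul_sum]
  refine Finset.sum_congr rfl fun i _ => ?_
  split_ifs <;> omega

theorem card_fiber_eq_of_sum_min {ι κ : Type*} [Fintype ι] [Fintype κ] (e : ι → ℕ) (f : κ → ℕ)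
    (h : ∀ j, ∑ i, min (e i + 1) j = ∑ i, min (f i + 1) j) (j : ℕ) :
    Fintype.card {i // e i = j} = Fintype.card {i // f i = j} := by
  have h1 := sum_min_add_sum_min e j
  have h2 := sum_min_add_sum_min f j
  rw [h, h, h] at h1
  omega

theorem exists_equiv_comp_eq {ι κ : Type*} [Fintype ι] [Fintype κ] (e : ι → ℕ) (f : κ → ℕ)
    (h : ∀ j, Fintype.card {i // e i = j} = Fintype.card {i // f i = j}) :
    ∃ σ : ι ≃ κ, ∀ i, f (σ i) = e i := by
  refine ⟨((Equiv.sigmaFiberEquiv e).symm.trans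
    (Equiv.sigmaCongrRight fun j => Fintype.equivOfCardEq (h j))).trans
    (Equiv.sigmaFiberEquiv f), fun i => ?_⟩
  exact (Fintype.equivOfCardEq (h (e i)) ⟨i, rfl⟩).2

theorem sum_min_eq_of_card {ι κ : Type*} [Fintype ι] [Fintype κ] {e : ι → ℕ} {f : κ → ℕ}
    {M N : Type u} [AddCommGroup M] [Module O M] [AddCommGroup N] [Module O N]
    (a : M ≃ₗ[O] ∀ i, Cyc O (e i + 1)) (b : N ≃ₗ[O] ∀ i, Cyc O (f i + 1))
    (h : ∀ j, Nat.card (Submodule.torsionBy O M (unif O ^ j)) =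
      Nat.card (Submodule.torsionBy O N (unif O ^ j))) (j : ℕ) :
    Fintype.card {i // e i = j} = Fintype.card {i // f i = j} := by
  refine card_fiber_eq_of_sum_min e f (fun j => ?_) j
  have := h j
  rw [card_torsionBy_congr a, card_torsionBy_congr b, card_torsionBy_pi, card_torsionBy_pi] at this
  exact Nat.pow_right_injective (one_lt_resCard O) this

theorem nonempty_equiv_of_card_torsionBy {M N : Type u} [AddCommGroup M] [Module O M] [Finite M]
    [AddCommGroup N] [Module O N] [Finite N]
    (h : ∀ j, Nat.card (Submodule.torsionBy O M (unif O ^ j)) =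
      Nat.card (Submodule.torsionBy O N (unif O ^ j))) : Nonempty (M ≃ₗ[O] N) := by
  obtain ⟨ι, _, e, ⟨a⟩⟩ := exists_equiv_pi_cyc_succ (O := O) M
  obtain ⟨κ, _, f, ⟨b⟩⟩ := exists_equiv_pi_cyc_succ (O := O) N
  obtain ⟨σ, hσ⟩ := exists_equiv_comp_eq e f (sum_min_eq_of_card a b h)
  have he : e = fun i => f (σ i) := funext fun i => (hσ i).symm
  subst he
  exact ⟨a.trans ((LinearEquiv.piCongrLeft O (fun i => Cyc O (f i + 1)) σ).trans b.symm)⟩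

/-! ### The socle and the quotient by it -/

variable (O) in
/-- The socle. -/
abbrev soc (M : Type*) [AddCommGroup M] [Module O M] : Submodule O M :=
  Submodule.torsionBy O M (unif O)

theorem card_comap_mkQ {M : Type*} [AddCommGroup M] [Module O M] [Finite M] (A : Submodule O M)
    (D : Submodule O (M ⧸ A)) : Nat.card (D.comap A.mkQ) = Nat.card D * Nat.card A := by
  have hA : A ≤ D.comap A.mkQ := fun x hx => by
    rw [Submodule.mem_comap, Submodule.mkQ_apply, (Submodule.Quotient.mk_eq_zero A).2 hx]
    exact D.zero_mem
  have e : ((M ⧸ A) ⧸ D) ≃ₗ[O] M ⧸ D.comap A.mkQ :=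
    (Submodule.quotEquivOfEq _ _ (Submodule.map_comap_eq_of_surjective
      (Submodule.mkQ_surjective A) D).symm).trans (Submodule.quotientQuotientEquivQuotient A _ hA)
  have h1 := Submodule.card_eq_card_quotient_mul_card A
  have h2 := Submodule.card_eq_card_quotient_mul_card D
  have h3 := Submodule.card_eq_card_quotient_mul_card (D.comap A.mkQ)
  rw [h1, h2, Nat.card_congr e.toEquiv, ← mul_assoc] at h3
  have : Finite (M ⧸ D.comap A.mkQ) := Finite.of_surjective _ (Submodule.mkQ_surjective _)
  rw [mul_comm (Nat.card D)]
  exact (Nat.eq_of_mul_eq_mul_right Nat.card_pos h3).symm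

/-- An element is killed by `π ^ (j + 1)` exactly when its class modulo the socle is killed by `π ^
j`. -/
theorem card_torsionBy_succ (M : Type u) [AddCommGroup M] [Module O M] [Finite M] (j : ℕ) :
    Nat.card (Submodule.torsionBy O M (unif O ^ (j + 1))) =
      Nat.card (Submodule.torsionBy O (M ⧸ soc O M) (unif O ^ j)) * Nat.card (soc O M) := by
  have hc : Submodule.torsionBy O M (unif O ^ (j + 1)) =
      (Submodule.torsionBy O (M ⧸ soc O M) (unif O ^ j)).comap (soc O M).mkQ := by
    ext x
    rw [Submodule.mem_torsionBy_iff, Submodule.mem_comap, Submodule.mem_torsionBy_iff, ← map_smul,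
      Submodule.mkQ_apply, Submodule.Quotient.mk_eq_zero, Submodule.mem_torsionBy_iff, ← mul_smul,
      ← pow_succ']
  rw [hc, card_comap_mkQ]

/-- All torsion counts are determined by the socle and the quotient by it, as a partition is
determined by its first column and the rest. This makes the leading term in the generation argument
unique. -/
theorem nonempty_equiv_of_soc {M N : Type u} [AddCommGroup M] [Module O M] [Finite M]
    [AddCommGroup N] [Module O N] [Finite N] (h : Nat.card (soc O M) = Nat.card (soc O N))
    (e : (M ⧸ soc O M) ≃ₗ[O] (N ⧸ soc O N)) : Nonempty (M ≃ₗ[O] N) := by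
  refine nonempty_equiv_of_card_torsionBy fun j => ?_
  cases j with
  | zero => simp [Submodule.torsionBy_one]
  | succ j => rw [card_torsionBy_succ, card_torsionBy_succ, h, card_torsionBy_congr e]

end Classification

end HallWitt

namespace HallWitt

open IsLocalRing

/-! ### Hall numbers and commutation of the generators -/

section HallNumbers

variable {k : Type v} [Field k] {O : Type u} [CommRing O]

/-- The number of submodules of `C` of class `P` with quotient of class `Q`. -/
def hallNum (P Q : IsoClass O) (C : Type u) [AddCommGroup C] [Module O C] [Finite C] : ℕ :=
  Nat.card {A : Submodule O C // cls O A = P ∧ cls O (C ⧸ A) = Q}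

theorem ind_apply (c d : IsoClass O) : ind k O c d = open Classical in if c = d then 1 else 0 := by
  classical
  exact Finsupp.single_apply

theorem card_rep_cls (M : Type u) [AddCommGroup M] [Module O M] [Finite M] :
    Nat.card (cls O M).rep = Nat.card M :=
  Nat.card_congr (rep_cls M).some.toEquiv

theorem conv_ind (P Q : IsoClass O) (C : Type u) [AddCommGroup C] [Module O C] [Finite C] :
    conv (ind k O P) (ind k O Q) C = hallNum P Q C := by
  classical
  unfold conv hallNum
  rw [Nat.card_eq_fintype_card, Fintype.card_subtype, Finset.card_filter, Nat.cast_sum]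
  refine Finset.sum_congr rfl fun A _ => ?_
  rw [ind_apply, ind_apply]
  by_cases h1 : P = cls O A <;> by_cases h2 : Q = cls O (C ⧸ A) <;> simp [h1, h2, eq_comm]

theorem card_of_hallNum_ne_zero {P Q : IsoClass O} {C : Type u} [AddCommGroup C] [Module O C]
    [Finite C] (h : hallNum P Q C ≠ 0) : Nat.card C = Nat.card P.rep * Nat.card Q.rep := by
  obtain ⟨⟨A, rfl, rfl⟩⟩ := (Nat.card_ne_zero.1 h).1
  rw [card_rep_cls, card_rep_cls, Submodule.card_eq_card_quotient_mul_card A]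

variable [IsDomain O] [IsDiscreteValuationRing O] [Finite (ResidueField O)]

theorem ind_mul_ind_apply (P Q C : IsoClass O) :
    (ind k O P * ind k O Q) C = hallNum P Q C.rep :=
  conv_ind P Q C.rep

variable (O) in
/-- The class of the `r`-dimensional vector space over the residue field. -/
def resCls (r : ℕ) : IsoClass O := cls O (Fin r → ResidueField O)

theorem cls_eq_resCls_iff {M : Type u} [AddCommGroup M] [Module O M] [Finite M] {r : ℕ} :
    cls O M = resCls O r ↔ (∀ x : M, unif O • x = 0) ∧ Nat.card M = resCard O ^ r :=
  cls_eq_iff.trans equiv_residue_iff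

/-- The submodule of multiples of the uniformizer. -/
def unifRange (O : Type u) [CommRing O] [IsDomain O] [IsDiscreteValuationRing O]
    (M : Type*) [AddCommGroup M] [Module O M] : Submodule O M :=
  LinearMap.range (LinearMap.lsmul O M (unif O))

theorem card_soc_mul_card_unifRange (M : Type*) [AddCommGroup M] [Module O M] [Finite M] :
    Nat.card (soc O M) * Nat.card (unifRange O M) = Nat.card M := by
  rw [Submodule.card_eq_card_quotient_mul_card (soc O M)]
  congr 1
  exact (Nat.card_congr (LinearMap.lsmul O M (unif O)).quotKerEquivRange.toEquiv).symm

/-- Submodules of `S / L` correspond to submodules between `L` and `S`. -/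
theorem exists_equiv_interval {M : Type*} [AddCommGroup M] [Module O M] [Finite M]
    {L S : Submodule O M} (h : L ≤ S) :
    ∃ f : Submodule O (S ⧸ L.submoduleOf S) ≃ {A : Submodule O M // L ≤ A ∧ A ≤ S},
      ∀ B : Submodule O (S ⧸ L.submoduleOf S),
        Nat.card (f B).1 = Nat.card B * Nat.card L := by
  have hL : ∀ B : Submodule O (S ⧸ L.submoduleOf S),
      L ≤ (B.comap (L.submoduleOf S).mkQ).map S.subtype := by
    intro B x hx
    refine ⟨⟨x, h hx⟩, ?_, rfl⟩
    rw [SetLike.mem_coe, Submodule.mem_comap, Submodule.mkQ_apply,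
      (Submodule.Quotient.mk_eq_zero (L.submoduleOf S)).2 hx]
    exact B.zero_mem
  refine ⟨⟨fun B => ⟨(B.comap (L.submoduleOf S).mkQ).map S.subtype, hL B,
      Submodule.map_subtype_le S _⟩, fun A => (A.1.submoduleOf S).map (L.submoduleOf S).mkQ,
      fun B => ?_, fun A => Subtype.ext ?_⟩, fun B => ?_⟩
  · have h1 : ((B.comap (L.submoduleOf S).mkQ).map S.subtype).submoduleOf S =
        B.comap (L.submoduleOf S).mkQ :=
      Submodule.comap_map_eq_of_injective (Submodule.subtype_injective _) _
    simp only
    rw [h1, Submodule.map_comap_eq_of_surjective (Submodule.mkQ_surjective _)]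
  · simp only
    rw [Submodule.comap_map_mkQ, sup_eq_right.2 (Submodule.comap_mono A.2.1)]
    simp only [Submodule.submoduleOf]
    rw [Submodule.map_comap_subtype]
    exact inf_eq_right.2 A.2.2
  · simp only [Equiv.coe_fn_mk]
    rw [← Nat.card_congr (Submodule.equivMapOfInjective _ (Submodule.subtype_injective _)
      (B.comap (L.submoduleOf S).mkQ)).toEquiv, card_comap_mkQ,
      Nat.card_congr (Submodule.submoduleOfEquivOfLe h).toEquiv]

theorem card_quotient_eq_iff {M : Type*} [AddCommGroup M] [Module O M] [Finite M]
    (A : Submodule O M) {a b : ℕ} (h : Nat.card M = a * b) (ha : Nat.card A = a) :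
    Nat.card (M ⧸ A) = b := by
  rw [Submodule.card_eq_card_quotient_mul_card A, ha] at h
  exact Nat.eq_of_mul_eq_mul_left (ha ▸ Nat.card_pos) h

/-- A submodule `A` is killed by `π` exactly when it lies in the socle, and `C / A` is killed by `π`
exactly when `A` contains `π C`. The Hall number therefore counts members of an interval by size. -/
theorem hallNum_resCls (r s : ℕ) (C : Type u) [AddCommGroup C] [Module O C] [Finite C]
    (h : Nat.card C = resCard O ^ r * resCard O ^ s) :
    hallNum (resCls O r) (resCls O s) C =
      Nat.card {A : {A : Submodule O C // unifRange O C ≤ A ∧ A ≤ soc O C} //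
        Nat.card A.1 = resCard O ^ r} := by
  unfold hallNum
  refine (Nat.card_congr ((Equiv.subtypeSubtypeEquivSubtypeInter _
    (fun A : Submodule O C => Nat.card A = resCard O ^ r)).trans
      (Equiv.subtypeEquivRight fun A => ?_))).symm
  rw [cls_eq_resCls_iff, cls_eq_resCls_iff]
  have h1 : (∀ x : A, unif O • x = 0) ↔ A ≤ soc O C := by
    constructor
    · intro hA x hx
      exact (Submodule.mem_torsionBy_iff _ _).2 (congrArg Subtype.val (hA ⟨x, hx⟩))
    · intro hA x
      exact Subtype.ext ((Submodule.mem_torsionBy_iff _ _).1 (hA x.2))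
  have h2 : (∀ x : C ⧸ A, unif O • x = 0) ↔ unifRange O C ≤ A := by
    constructor
    · rintro hA _ ⟨x, rfl⟩
      rw [← Submodule.Quotient.mk_eq_zero]
      exact hA (Submodule.Quotient.mk x)
    · intro hA x
      obtain ⟨x, rfl⟩ := Submodule.mkQ_surjective A x
      rw [← map_smul, Submodule.mkQ_apply, Submodule.Quotient.mk_eq_zero]
      exact hA ⟨x, rfl⟩
  rw [h1, h2]
  constructor
  · rintro ⟨⟨a, b⟩, c⟩
    exact ⟨⟨b, c⟩, a, card_quotient_eq_iff A h c⟩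
  · rintro ⟨⟨b, c⟩, a, -⟩
    exact ⟨⟨a, b⟩, c⟩

/-- The interval from `π C` to `soc C` is the lattice of subspaces of `soc C / π C`. Duality there
exchanges complementary dimensions, and `|soc C| |π C| = |C|` turns size `q ^ r` into size `q ^ s`.
If `π C` is not contained in the socle, or `C` has the wrong cardinality, both counts are zero. -/
theorem hallNum_resCls_comm (r s : ℕ) (C : Type u) [AddCommGroup C] [Module O C] [Finite C] :
    hallNum (resCls O r) (resCls O s) C = hallNum (resCls O s) (resCls O r) C := by
  by_cases h : Nat.card C = resCard O ^ r * resCard O ^ s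
  · rw [hallNum_resCls r s C h, hallNum_resCls s r C (by rw [h, mul_comm])]
    by_cases hle : unifRange O C ≤ soc O C
    · obtain ⟨f, hf⟩ := exists_equiv_interval hle
      obtain ⟨σ, hσ⟩ := exists_equiv_submodule_card_mul
        (soc O C ⧸ (unifRange O C).submoduleOf (soc O C)) (O := O) (by
          intro x
          obtain ⟨x, rfl⟩ := Submodule.mkQ_surjective _ x
          rw [← map_smul, show unif O • x = 0 from
            Subtype.ext ((Submodule.mem_torsionBy_iff _ _).1 x.2), map_zero])
      refine Nat.card_congr (((f.symm.trans σ).trans f).subtypeEquiv fun A => ?_)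
      obtain ⟨B, rfl⟩ := f.surjective A
      simp only [Equiv.trans_apply, Equiv.symm_apply_apply]
      rw [hf, hf]
      have h1 := hσ B
      have h2 := Submodule.card_eq_card_quotient_mul_card
        ((unifRange O C).submoduleOf (soc O C))
      rw [Nat.card_congr (Submodule.submoduleOfEquivOfLe hle).toEquiv] at h2
      have h3 := card_soc_mul_card_unifRange (O := O) C
      rw [h2, ← h1, h] at h3
      have h4 : (Nat.card B * Nat.card (unifRange O C)) *
          (Nat.card (σ B) * Nat.card (unifRange O C)) = resCard O ^ r * resCard O ^ s := by
        rw [← h3]; ring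
      constructor
      · intro h5
        rw [h5] at h4
        exact Nat.eq_of_mul_eq_mul_left (pow_pos (resCard_pos O) r) h4
      · intro h5
        rw [h5] at h4
        exact Nat.eq_of_mul_eq_mul_right (pow_pos (resCard_pos O) s) h4
    · have : IsEmpty {A : Submodule O C // unifRange O C ≤ A ∧ A ≤ soc O C} :=
        ⟨fun A => hle (A.2.1.trans A.2.2)⟩
      simp
  · have h1 : ∀ r, Nat.card (resCls O r).rep = resCard O ^ r := fun r => by
      rw [resCls, card_rep_cls, card_residue_pow]
    have h2 : hallNum (resCls O r) (resCls O s) C = 0 := by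
      by_contra hne
      exact h (by rw [card_of_hallNum_ne_zero hne, h1, h1])
    have h3 : hallNum (resCls O s) (resCls O r) C = 0 := by
      by_contra hne
      exact h (by rw [card_of_hallNum_ne_zero hne, h1, h1, mul_comm])
    rw [h2, h3]

theorem bElt_eq (r : ℕ) :
    bElt k O r = (resCard O : k) ^ (r * (r - 1) / 2) • ind k O (resCls O r) := rfl

theorem bElt_mul_comm (r s : ℕ) : bElt k O r * bElt k O s = bElt k O s * bElt k O r := by
  rw [bElt_eq, bElt_eq, smul_mul_smul_comm, smul_mul_smul_comm, mul_comm]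
  congr 1
  ext C
  rw [ind_mul_ind_apply, ind_mul_ind_apply, hallNum_resCls_comm]

end HallNumbers

end HallWitt

namespace HallWitt

open IsLocalRing

/-! ### The Hall algebra is a polynomial ring -/

section Generation

variable {k : Type v} [Field k] {O : Type u} [CommRing O] [IsDomain O]
  [IsDiscreteValuationRing O] [Finite (ResidueField O)]

/-! ### Peeling off the socle -/

theorem soc_ne_bot (M : Type u) [AddCommGroup M] [Module O M] [Finite M] [Nontrivial M] :
    soc O M ≠ ⊥ := by
  intro h
  have hinj : Function.Injective fun x : M => unif O • x := by
    intro x y hxy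
    have : x - y ∈ soc O M := by
      rw [Submodule.mem_torsionBy_iff, smul_sub, sub_eq_zero]
      exact hxy
    rw [h, Submodule.mem_bot, sub_eq_zero] at this
    exact this
  have hpow : ∀ n, Function.Injective fun x : M => unif O ^ n • x := by
    intro n
    induction n with
    | zero => intro x y h; simpa using h
    | succ n ih =>
      intro x y hxy
      refine hinj (ih ?_)
      simpa only [smul_smul, pow_succ] using hxy
  obtain ⟨x, hx⟩ := exists_ne (0 : M)
  refine hx (hpow (Nat.card M) ?_)
  simp only [unif_pow_card_smul, smul_zero]

theorem equiv_resCls_soc {M : Type u} [AddCommGroup M] [Module O M] [Finite M] {r : ℕ}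
    (h : Nat.card (soc O M) = resCard O ^ r) : cls O (soc O M) = resCls O r :=
  cls_eq_resCls_iff.2 ⟨fun x => Subtype.ext ((Submodule.mem_torsionBy_iff _ _).1 x.2), h⟩

theorem le_soc_of_cls {M : Type u} [AddCommGroup M] [Module O M] [Finite M] {r : ℕ}
    {A : Submodule O M} (h : cls O A = resCls O r) :
    A ≤ soc O M ∧ Nat.card A = resCard O ^ r := by
  obtain ⟨h1, h2⟩ := cls_eq_resCls_iff.1 h
  exact ⟨fun x hx => (Submodule.mem_torsionBy_iff _ _).2 (congrArg Subtype.val (h1 ⟨x, hx⟩)), h2⟩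

theorem eq_soc_of_cls {M : Type u} [AddCommGroup M] [Module O M] [Finite M] {r : ℕ}
    (hM : Nat.card (soc O M) ≤ resCard O ^ r) {A : Submodule O M} (h : cls O A = resCls O r) :
    A = soc O M := by
  obtain ⟨h1, h2⟩ := le_soc_of_cls h
  refine SetLike.coe_injective (Set.Finite.eq_of_subset_of_card_le (Set.toFinite _) h1 ?_)
  exact (hM.trans h2.ge :)

/-- Any submodule isomorphic to `κ ^ r` lies in the socle, hence fills it when the socle has
dimension `r`. This gives leading coefficient `1`. -/
theorem hallNum_soc {M : Type u} [AddCommGroup M] [Module O M] [Finite M] {r : ℕ}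
    (h : Nat.card (soc O M) = resCard O ^ r) :
    hallNum (resCls O r) (cls O (M ⧸ soc O M)) M = 1 := by
  unfold hallNum
  rw [Nat.card_eq_one_iff_unique]
  refine ⟨⟨fun A B => Subtype.ext ?_⟩, ⟨⟨soc O M, equiv_resCls_soc h, rfl⟩⟩⟩
  rw [eq_soc_of_cls h.le A.2.1, eq_soc_of_cls h.le B.2.1]

/-- A submodule of `N` isomorphic to `κ ^ r` lies in `soc N`, so `soc N` is at least as large as
`soc M`. Equality forces it to be all of `soc N`, and then `nonempty_equiv_of_soc` applies: the
product is triangular for the size of the socle. -/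
theorem eq_or_lt_of_hallNum_soc {M N : Type u} [AddCommGroup M] [Module O M] [Finite M]
    [AddCommGroup N] [Module O N] [Finite N] {r : ℕ}
    (h : Nat.card (soc O M) = resCard O ^ r)
    (hN : hallNum (resCls O r) (cls O (M ⧸ soc O M)) N ≠ 0) :
    cls O N = cls O M ∨ Nat.card (soc O M) < Nat.card (soc O N) := by
  rcases lt_or_ge (Nat.card (soc O M)) (Nat.card (soc O N)) with hlt | hge
  · exact Or.inr hlt
  · left
    obtain ⟨⟨A, h1, h2⟩⟩ := (Nat.card_ne_zero.1 hN).1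
    have hA := eq_soc_of_cls (hge.trans h.le) h1
    subst hA
    rw [cls_eq_iff] at h2
    rw [cls_eq_iff]
    exact h2.elim fun e => nonempty_equiv_of_soc
      (by rw [h, (cls_eq_resCls_iff.1 h1).2]) e

/-! ### Generation by the elements `bElt` -/

theorem hall_eq_sum (x : Hall k O) : x = Finsupp.sum (M := k) x fun c a => a • ind k O c := by
  have h : ∀ (c : IsoClass O) (a : k), a • ind k O c = Finsupp.single c a := fun c a => by
    change a • Finsupp.single c (1 : k) = _
    rw [Finsupp.smul_single, smul_eq_mul, mul_one]
  simp only [h]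
  exact (Finsupp.sum_single (M := k) x).symm

theorem hall_mem_of_ind_mem {F : Submodule k (Hall k O)} {x : Hall k O}
    (h : ∀ c, x c ≠ 0 → ind k O c ∈ F) : x ∈ F := by
  rw [hall_eq_sum x]
  exact Submodule.sum_mem _ fun c hc => F.smul_mem _ (h c (Finsupp.mem_support_iff.1 hc))

variable [CharZero k]

variable (k O) in
theorem resCard_cast_ne_zero : (resCard O : k) ≠ 0 := Nat.cast_ne_zero.2 (resCard_pos O).ne'

/-- Every class lies in a filtration stable under multiplication by the generators. -/
theorem ind_mem_of_filtration (F : ℕ → Submodule k (Hall k O)) (h1 : 1 ∈ F 0)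
    (h2 : ∀ r n x, x ∈ F n → bElt k O (r + 1) * x ∈ F (n + (r + 1))) :
    ∀ (n : ℕ) (c : IsoClass O), Nat.card c.rep = resCard O ^ n → ind k O c ∈ F n := by
  intro n
  induction n using Nat.strong_induction_on with
  | _ n ih =>
    -- The outer induction is on the length `n`. The inner one is on a bound `d` for the gap between
    -- `q ^ n` and the size of the socle, so modules with larger socle are settled earlier.
    suffices H : ∀ (d : ℕ) (c : IsoClass O), Nat.card c.rep = resCard O ^ n →
        resCard O ^ n ≤ d + Nat.card (soc O c.rep) → ind k O c ∈ F n from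
      fun c hc => H (resCard O ^ n) c hc (Nat.le_add_right _ _)
    intro d
    induction d using Nat.strong_induction_on with
    | _ d ihd =>
      intro c hc hd
      rcases Nat.eq_zero_or_pos n with rfl | hn
      · have : Subsingleton c.rep := by
          rw [pow_zero] at hc
          exact (Nat.card_eq_one_iff_unique.1 hc).1
        have h : c = cls O PUnit.{u + 1} := by
          rw [← cls_rep c]
          exact cls_eq (LinearEquiv.ofSubsingleton _ _)
        rw [h]
        exact h1
      · have hnt : Nontrivial c.rep := by
          rw [← Finite.one_lt_card_iff_nontrivial, hc]
          exact Nat.one_lt_pow hn.ne' (one_lt_resCard O)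
        obtain ⟨r, hr⟩ := exists_card_eq_pow (O := O) (soc O c.rep)
        obtain ⟨m, hm⟩ := exists_card_eq_pow (O := O) (c.rep ⧸ soc O c.rep)
        have hr0 : r ≠ 0 := by
          rintro rfl
          rw [pow_zero] at hr
          have := (Nat.card_eq_one_iff_unique.1 hr).1
          exact soc_ne_bot c.rep (Submodule.subsingleton_iff_eq_bot.1 this)
        obtain ⟨r, rfl⟩ := Nat.exists_eq_succ_of_ne_zero hr0
        have hmn : n = m + (r + 1) := by
          have := Submodule.card_eq_card_quotient_mul_card (soc O c.rep)
          rw [hc, hr, hm, ← pow_add, Nat.pow_right_inj (one_lt_resCard O)] at this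
          rw [this, add_comm]
        set D := cls O (c.rep ⧸ soc O c.rep) with hD
        -- Strip off the socle: the quotient `D` has smaller length because the socle is nonzero, so
        -- the outer induction applies to it.
        have hx : ind k O (resCls O (r + 1)) * ind k O D ∈ F n := by
          have h3 := h2 r m (ind k O D) (ih m (by omega) D (by rw [hD, card_rep_cls, hm]))
          rw [← hmn, bElt_eq, smul_mul_assoc] at h3
          exact (Submodule.smul_mem_iff _ (pow_ne_zero _ (resCard_cast_ne_zero k O))).1 h3
        have hc1 : (ind k O (resCls O (r + 1)) * ind k O D) c = 1 := by
          rw [ind_mul_ind_apply, hD, hallNum_soc hr, Nat.cast_one]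
        -- After `c` is removed, every class in the product has a strictly larger socle and falls
        -- under the inner induction.
        have hy : ind k O (resCls O (r + 1)) * ind k O D - ind k O c ∈ F n := by
          refine hall_mem_of_ind_mem fun e he => ?_
          have hsub : (ind k O (resCls O (r + 1)) * ind k O D - ind k O c) e =
            (ind k O (resCls O (r + 1)) * ind k O D) e - ind k O c e := rfl
          have hec : e ≠ c := by
            rintro rfl
            rw [hsub, hc1, ind_apply, if_pos rfl, sub_self] at he
            exact he rfl
          rw [hsub, ind_apply, if_neg hec.symm, sub_zero, ind_mul_ind_apply, Nat.cast_ne_zero]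
            at he
          have hce : Nat.card e.rep = resCard O ^ n := by
            rw [card_of_hallNum_ne_zero he, resCls, card_rep_cls, card_residue_pow, hD,
              card_rep_cls, hm, ← pow_add, hmn, add_comm]
          have hlt : Nat.card (soc O c.rep) < Nat.card (soc O e.rep) := by
            refine (eq_or_lt_of_hallNum_soc hr he).resolve_left fun h => hec ?_
            rwa [cls_rep, cls_rep] at h
          have hle : Nat.card (soc O e.rep) ≤ resCard O ^ n :=
            hce ▸ Nat.card_le_card_of_injective _ Subtype.val_injective
          refine ihd (d - 1) (by omega) e hce (by omega)
        have := (F n).sub_mem hx hy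
        rwa [sub_sub_cancel] at this

variable (k O) in
theorem adjoin_bElt : Algebra.adjoin k (Set.range (bElt k O)) = ⊤ := by
  refine eq_top_iff.2 fun x _ => ?_
  refine hall_mem_of_ind_mem
    (F := Subalgebra.toSubmodule (Algebra.adjoin k (Set.range (bElt k O)))) fun c _ => ?_
  obtain ⟨n, hn⟩ := exists_card_eq_pow (O := O) c.rep
  exact ind_mem_of_filtration
    (fun _ => Subalgebra.toSubmodule (Algebra.adjoin k (Set.range (bElt k O))))
    (one_mem (Algebra.adjoin k (Set.range (bElt k O))))
    (fun r n x hx => mul_mem (S := Subalgebra k (Hall k O)) (Algebra.subset_adjoin ⟨_, rfl⟩) hx) n c hn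

/-- The generators centralise one another, so the whole algebra centralises each generator, and
hence each element. -/
theorem hall_mul_comm (x y : Hall k O) : x * y = y * x := by
  have h : ∀ z : Hall k O, z ∈ Algebra.adjoin k (Set.range (bElt k O)) := fun z => by
    rw [adjoin_bElt]; trivial
  have h1 : Algebra.adjoin k (Set.range (bElt k O)) ≤
      Subalgebra.centralizer k (Set.range (bElt k O)) := by
    refine Algebra.adjoin_le ?_
    rintro _ ⟨r, rfl⟩
    refine (Subalgebra.mem_centralizer_iff k).2 ?_
    rintro _ ⟨s, rfl⟩
    exact bElt_mul_comm s r
  have h2 : Algebra.adjoin k (Set.range (bElt k O)) ≤ Subalgebra.centralizer k {x} := by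
    refine Algebra.adjoin_le ?_
    rintro _ ⟨r, rfl⟩
    refine (Subalgebra.mem_centralizer_iff k).2 ?_
    rintro _ rfl
    exact ((Subalgebra.mem_centralizer_iff k).1 (h1 (h _)) _ ⟨r, rfl⟩).symm
  exact (Subalgebra.mem_centralizer_iff k).1 (h2 (h y)) x rfl

variable (k O) in
/-- The Hall algebra as a commutative ring. -/
@[reducible] def hallCommRing : CommRing (Hall k O) :=
  { (inferInstance : Ring (Hall k O)) with mul_comm := hall_mul_comm }

theorem hall_algHom_ext {S : Type*} [Semiring S] [Algebra k S] {f g : Hall k O →ₐ[k] S}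
    (h : ∀ r, f (bElt k O r) = g (bElt k O r)) : f = g :=
  AlgHom.ext_of_adjoin_eq_top (adjoin_bElt k O) (by rintro _ ⟨r, rfl⟩; exact h r)

/-! #### Algebraic independence of the generators -/

/-- The weight of an exponent vector, the `j`-th exponent counting `j + 1`. -/
def expWeight : (ℕ →₀ ℕ) →+ ℕ := Finsupp.weight fun j => j + 1

variable (O) in
/-- The module with `m j` cyclic summands of length `j + 1`. -/
abbrev StdMod (m : ℕ →₀ ℕ) : Type u := (p : Σ j : m.support, Fin (m j)) → Cyc O (p.1 + 1)

omit [CharZero k] in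
theorem card_stdMod (m : ℕ →₀ ℕ) : Nat.card (StdMod O m) = resCard O ^ expWeight m := by
  rw [Nat.card_pi]
  simp only [card_cyc]
  rw [Finset.prod_pow_eq_pow_sum, Fintype.sum_sigma]
  congr 1
  simp only [Finset.sum_const, Finset.card_univ, Fintype.card_fin]
  rw [expWeight, Finsupp.weight_apply, Finsupp.sum, ← Finset.sum_coe_sort m.support]

theorem card_stdMod_fiber (m : ℕ →₀ ℕ) (j : ℕ) :
    Fintype.card {p : Σ j : m.support, Fin (m j) // (p.1 : ℕ) = j} = m j := by
  by_cases hj : j ∈ m.support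
  · rw [← Fintype.card_fin (m j)]
    refine Fintype.card_congr ⟨fun p => Fin.cast (congrArg m p.2) p.1.2,
      fun i => ⟨⟨⟨j, hj⟩, i⟩, rfl⟩, ?_, fun _ => rfl⟩
    rintro ⟨⟨⟨i, hi⟩, a⟩, rfl⟩
    rfl
  · rw [Finsupp.notMem_support_iff.1 hj, Fintype.card_eq_zero_iff]
    exact ⟨fun p => hj (p.2 ▸ p.1.1.2)⟩

variable (O) in
theorem cls_stdMod_injective : Function.Injective fun m : ℕ →₀ ℕ => cls O (StdMod O m) := by
  intro m n h
  obtain ⟨e⟩ := cls_eq_iff.1 h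
  ext j
  rw [← card_stdMod_fiber m j, ← card_stdMod_fiber n j]
  exact sum_min_eq_of_card (O := O) (LinearEquiv.refl O (StdMod O m))
    (LinearEquiv.refl O (StdMod O n)) (fun _ => card_torsionBy_congr e _) j

theorem finite_expWeight_le (n : ℕ) : {m : ℕ →₀ ℕ | expWeight m ≤ n}.Finite := by
  refine ((Finset.range n).finsupp fun _ => Finset.range (n + 1)).finite_toSet.subset ?_
  intro m hm
  have hm : expWeight m ≤ n := hm
  rw [Finset.mem_coe, Finset.mem_finsupp_iff]
  constructor
  · intro j hj
    have := Finsupp.le_weight_of_ne_zero' (fun j : ℕ => j + 1) (Finsupp.mem_support_iff.1 hj)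
    exact Finset.mem_range.2 (this.trans hm)
  · intro j _
    have := Finsupp.le_weight (fun j : ℕ => j + 1) (Nat.succ_ne_zero j) m
    exact Finset.mem_range.2 (Nat.lt_succ_of_le (this.trans hm))

theorem linearIndependent_ind : LinearIndependent k (ind k O) :=
  Finsupp.linearIndependent_single_one k (IsoClass O)

variable (k O) in
-- Independence comes from counting. The monomials of weight at most `n` span a space containing the
-- independent functions `1_{StdMod m}` with `m` of weight at most `n`. The two families have the
-- same finite index set, and a spanning family no larger than the dimension is independent.
theorem linearIndependent_monomials :
    letI := hallCommRing k O
    LinearIndependent k fun m : ℕ →₀ ℕ => m.prod fun j e => bElt k O (j + 1) ^ e := by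
  letI := hallCommRing k O
  set v : (ℕ →₀ ℕ) → Hall k O := fun m => m.prod fun j e => bElt k O (j + 1) ^ e with hv
  rw [linearIndependent_iff_finset_linearIndependent]
  intro s
  set n := s.sup expWeight with hn
  have := (finite_expWeight_le n).fintype
  suffices H : LinearIndependent k fun m : {m : ℕ →₀ ℕ | expWeight m ≤ n} => v m by
    exact H.comp (fun m : s => ⟨m.1, Finset.le_sup (f := expWeight) m.2⟩)
      fun a b h => Subtype.ext (congrArg (fun x => x.1) h)
  rw [linearIndependent_iff_card_le_finrank_span]
  let F : ℕ → Submodule k (Hall k O) := fun N => Submodule.span k (v '' {m | expWeight m ≤ N})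
  have hF : ∀ N c, Nat.card (IsoClass.rep c) = resCard O ^ N → ind k O c ∈ F N := by
    -- Multiplication by `b_{r + 1}` raises the weight of a monomial by `r + 1`, so the weight
    -- filtration has the required stability.
    refine ind_mem_of_filtration F (Submodule.subset_span ⟨0, by simp, by simp [hv]⟩) ?_
    intro r N x hx
    refine Submodule.span_induction ?_ ?_ ?_ ?_ hx
    · rintro _ ⟨m, hm, rfl⟩
      refine Submodule.subset_span ⟨Finsupp.single r 1 + m, ?_, ?_⟩
      · have hm' : expWeight m ≤ N := hm
        have h1 : expWeight (Finsupp.single r 1) = r + 1 := by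
          rw [expWeight, Finsupp.weight_single, one_smul]
        change expWeight _ ≤ _
        rw [map_add, h1]
        omega
      · simp only [hv]
        rw [Finsupp.prod_add_index' (fun _ => pow_zero _) (fun _ _ _ => pow_add _ _ _),
          Finsupp.prod_single_index (h := fun j e => bElt k O (j + 1) ^ e) (pow_zero _), pow_one]
    · rw [mul_zero]; exact Submodule.zero_mem _
    · intro x y _ _ h1 h2
      rw [mul_add]
      exact Submodule.add_mem _ h1 h2
    · intro a x _ h1
      rw [mul_smul_comm]
      exact Submodule.smul_mem _ a h1
  have hli : LinearIndependent k
      fun m : {m : ℕ →₀ ℕ | expWeight m ≤ n} => ind k O (cls O (StdMod O m.1)) :=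
    linearIndependent_ind.comp (fun m : {m : ℕ →₀ ℕ | expWeight m ≤ n} => cls O (StdMod O m.1))
      fun a b h => Subtype.ext (cls_stdMod_injective O h)
  rw [← finrank_span_eq_card hli]
  have hfin : Module.Finite k (Submodule.span k
      (Set.range fun m : {m : ℕ →₀ ℕ | expWeight m ≤ n} => v m)) :=
    Module.Finite.span_of_finite k (Set.finite_range _)
  refine Submodule.finrank_mono (Submodule.span_le.2 ?_)
  rintro _ ⟨m, rfl⟩
  have h1 := hF (expWeight m.1) (cls O (StdMod O m.1)) (by rw [card_rep_cls, card_stdMod])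
  refine Submodule.span_mono ?_ h1
  rintro _ ⟨l, hl, rfl⟩
  have hln : expWeight l ≤ n := le_trans (b := expWeight m.1) hl m.2
  exact ⟨⟨l, hln⟩, rfl⟩

variable (k O) in
theorem aeval_bElt_bijective :
    letI := hallCommRing k O
    Function.Bijective (MvPolynomial.aeval (R := k) fun r : ℕ => bElt k O (r + 1)) := by
  letI := hallCommRing k O
  constructor
  · have h := linearIndependent_monomials k O
    rw [injective_iff_map_eq_zero]
    intro p hp
    rw [MvPolynomial.aeval_def, MvPolynomial.eval₂_eq] at hp
    ext d
    rw [MvPolynomial.coeff_zero]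
    by_contra hd
    refine hd (linearIndependent_iff'.1 h p.support (fun d => p.coeff d) ?_ d
      (MvPolynomial.mem_support_iff.2 hd))
    rw [← hp]
    exact Finset.sum_congr rfl fun d _ => Algebra.smul_def _ _
  · rw [← AlgHom.range_eq_top, eq_top_iff, ← adjoin_bElt k O]
    refine Algebra.adjoin_le ?_
    rintro _ ⟨r, rfl⟩
    cases r with
    | zero => rw [bElt_zero]; exact one_mem _
    | succ r => exact ⟨MvPolynomial.X r, MvPolynomial.aeval_X _ _⟩

variable (k O) in
/-- The Hall algebra is a polynomial ring on the generators. -/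
def hallEquiv : MvPolynomial ℕ k ≃ₐ[k] Hall k O :=
  letI := hallCommRing k O
  AlgEquiv.ofBijective _ (aeval_bElt_bijective k O)

theorem hallEquiv_X (r : ℕ) : hallEquiv k O (MvPolynomial.X r) = bElt k O (r + 1) :=
  letI := hallCommRing k O
  MvPolynomial.aeval_X (R := k) (fun r : ℕ => bElt k O (r + 1)) r

/-- Homomorphisms from the Hall algebra are given by arbitrary values on the generators. -/
theorem exists_hall_algHom {S : Type*} [CommRing S] [Algebra k S] (c : ℕ → S) :
    ∃ f : Hall k O →ₐ[k] S, ∀ r, f (bElt k O (r + 1)) = c r := by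
  refine ⟨(MvPolynomial.aeval c).comp (hallEquiv k O).symm.toAlgHom, fun r => ?_⟩
  rw [← hallEquiv_X]
  change MvPolynomial.aeval c ((hallEquiv k O).symm (hallEquiv k O (MvPolynomial.X r))) = c r
  rw [AlgEquiv.symm_apply_apply, MvPolynomial.aeval_X]

theorem bSeries_bijective (R : Type w) [CommRing R] [Algebra k R] :
    Function.Bijective (bSeries : Pts k O R → OneAdd R) := by
  constructor
  · intro χ χ' h
    refine hall_algHom_ext fun r => ?_
    have := congrArg (fun f : OneAdd R => PowerSeries.coeff r f.1) h
    simpa [bSeries] using this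
  · rintro ⟨f, hf⟩
    obtain ⟨χ, hχ⟩ := exists_hall_algHom (k := k) (O := O)
      fun r => PowerSeries.coeff (r + 1) f
    refine ⟨χ, Subtype.ext (PowerSeries.ext fun n => ?_)⟩
    rw [bSeries, PowerSeries.coeff_mk]
    cases n with
    | zero => rw [bElt_zero, map_one, PowerSeries.coeff_zero_eq_constantCoeff_apply, hf]
    | succ n => exact hχ n

end Generation

end HallWitt

namespace HallWitt

open IsLocalRing

/-! ### Counting extensions -/

section Counting

theorem card_eq_mul_of_fibers {α β : Type*} [Finite α] [Finite β] (g : α → β) (c : ℕ)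
    (h : ∀ b, Nat.card {a // g a = b} = c) : Nat.card α = c * Nat.card β := by
  have := Fintype.ofFinite β
  rw [Nat.card_congr (Equiv.sigmaFiberEquiv g).symm, Nat.card_sigma]
  simp only [h, Finset.sum_const, Finset.card_univ, smul_eq_mul, Nat.card_eq_fintype_card]
  rw [mul_comm]

variable {O : Type u} [CommRing O]

instance finite_linearMap (M N : Type*) [AddCommGroup M] [Module O M] [AddCommGroup N]
    [Module O N] [Finite M] [Finite N] : Finite (M →ₗ[O] N) :=
  Finite.of_injective (fun f : M →ₗ[O] N => (f : M → N)) DFunLike.coe_injective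

instance finite_linearEquiv (M N : Type*) [AddCommGroup M] [Module O M] [AddCommGroup N]
    [Module O N] [Finite M] [Finite N] : Finite (M ≃ₗ[O] N) :=
  Finite.of_injective (fun f : M ≃ₗ[O] N => (f : M → N)) DFunLike.coe_injective

theorem card_fiber_linearMap {M N : Type*} [AddCommGroup M] [Module O M] [AddCommGroup N]
    [Module O N] (f : M →ₗ[O] N) {y : N} (hy : y ∈ LinearMap.range f) :
    Nat.card {x // f x = y} = Nat.card (LinearMap.ker f) := by
  obtain ⟨x₀, rfl⟩ := hy
  exact Nat.card_congr ((Equiv.subRight x₀).subtypeEquiv fun x => by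
    rw [Equiv.subRight_apply, LinearMap.mem_ker, map_sub, sub_eq_zero])

theorem card_fiber_linearMap_pi {ι M N : Type*} [Fintype ι] [AddCommGroup M] [Module O M]
    [AddCommGroup N] [Module O N] (f : M →ₗ[O] N) {y : ι → N}
    (hy : ∀ i, y i ∈ LinearMap.range f) :
    Nat.card {x : ι → M // ∀ i, f (x i) = y i} =
      Nat.card (LinearMap.ker f) ^ Fintype.card ι := by
  rw [Nat.card_congr (Equiv.subtypePiEquivPi (p := fun i x => f x = y i)), Nat.card_pi,
    Finset.prod_congr rfl fun i _ => card_fiber_linearMap f (hy i), Finset.prod_const,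
    Finset.card_univ]

/-- Solutions of `f (x i) = a i • n i` with prescribed behaviour of `n` modulo the range of `f`. -/
theorem card_solutions {ι X M : Type*} [Fintype ι] [AddCommGroup X] [Module O X] [Finite X]
    [AddCommGroup M] [Module O M] [Finite M] (f : X →ₗ[O] M) (a : ι → O)
    (Q : (ι → M ⧸ LinearMap.range f) → Prop) :
    Nat.card {p : (ι → X) × (ι → M) // (∀ i, f (p.1 i) = a i • p.2 i) ∧
      Q fun i => (LinearMap.range f).mkQ (p.2 i)} =
    Nat.card X ^ Fintype.card ι *
      Nat.card {ν : ι → M ⧸ LinearMap.range f // (∀ i, a i • ν i = 0) ∧ Q ν} := by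
  have h0 : ∀ (i : ι) (m : M), a i • (LinearMap.range f).mkQ m = 0 ↔
      a i • m ∈ LinearMap.range f := fun i m => by
    rw [← map_smul, Submodule.mkQ_apply, Submodule.Quotient.mk_eq_zero]
  have : Finite (M ⧸ LinearMap.range f) := Finite.of_surjective _ (Submodule.mkQ_surjective _)
  -- For fixed `n` the solutions `x` exist exactly when every `a i • n i` lies in the range of `f`,
  -- and then they form a coset of `(ker f) ^ ι`.
  have h1 := card_eq_mul_of_fibers
    (α := {p : (ι → X) × (ι → M) // (∀ i, f (p.1 i) = a i • p.2 i) ∧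
      Q fun i => (LinearMap.range f).mkQ (p.2 i)})
    (β := {n : ι → M // (∀ i, a i • (LinearMap.range f).mkQ (n i) = 0) ∧
      Q fun i => (LinearMap.range f).mkQ (n i)})
    (fun p => ⟨p.1.2, fun i => (h0 i _).2 ⟨_, p.2.1 i⟩, p.2.2⟩)
    (Nat.card (LinearMap.ker f) ^ Fintype.card ι) (by
      rintro ⟨n, hn, hQ⟩
      rw [← card_fiber_linearMap_pi f (y := fun i => a i • n i) fun i => (h0 i _).1 (hn i)]
      refine Nat.card_congr ⟨fun p => ⟨p.1.1.1, fun i => ?_⟩,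
        fun x => ⟨⟨(x.1, n), x.2, hQ⟩, rfl⟩, ?_, fun _ => rfl⟩
      · have h2 := p.1.2.1 i
        rwa [show p.1.1.2 = n from congrArg Subtype.val p.2] at h2
      · rintro ⟨⟨⟨x, n'⟩, h2⟩, h3⟩
        have h4 : n' = n := congrArg Subtype.val h3
        subst h4
        rfl)
  -- Reducing `n` modulo the range of `f` has fibres that are cosets of `(range f) ^ ι`. The two
  -- factors combine through `|ker f| |range f| = |X|`, so the final factor does not depend on `f`.
  have h2 := card_eq_mul_of_fibers
    (α := {n : ι → M // (∀ i, a i • (LinearMap.range f).mkQ (n i) = 0) ∧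
      Q fun i => (LinearMap.range f).mkQ (n i)})
    (β := {ν : ι → M ⧸ LinearMap.range f // (∀ i, a i • ν i = 0) ∧ Q ν})
    (fun n => ⟨fun i => (LinearMap.range f).mkQ (n.1 i), n.2⟩)
    (Nat.card (LinearMap.range f) ^ Fintype.card ι) (by
      rintro ⟨ν, hν, hQ⟩
      have h3 := card_fiber_linearMap_pi (LinearMap.range f).mkQ (y := ν) fun i => by
        rw [Submodule.range_mkQ]; trivial
      rw [Submodule.ker_mkQ] at h3
      rw [← h3]
      refine Nat.card_congr ⟨fun n => ⟨n.1.1, fun i => congrFun (congrArg Subtype.val n.2) i⟩,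
        fun n => ⟨⟨n.1, ?_⟩, Subtype.ext (funext n.2)⟩, fun _ => rfl, fun _ => rfl⟩
      rw [show (fun i => (LinearMap.range f).mkQ (n.1 i)) = ν from funext n.2]
      exact ⟨fun i => by rw [n.2 i, hν i], hQ⟩)
  rw [h1, h2, ← mul_assoc, ← mul_pow]
  congr 2
  rw [Submodule.card_eq_card_quotient_mul_card (LinearMap.ker f),
    Nat.card_congr f.quotKerEquivRange.toEquiv]

/-! ### Counting surjections -/

variable (O) in
/-- The number of surjective homomorphisms. -/
def surjCard (M N : Type*) [AddCommGroup M] [Module O M] [AddCommGroup N] [Module O N] : ℕ :=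
  Nat.card {f : M →ₗ[O] N // Function.Surjective f}

theorem surjCard_congr_left {M M' N : Type*} [AddCommGroup M] [Module O M] [AddCommGroup M']
    [Module O M'] [AddCommGroup N] [Module O N] (e : M ≃ₗ[O] M') :
    surjCard O M N = surjCard O M' N :=
  Nat.card_congr ((e.congrLeft N O).toEquiv.subtypeEquiv fun f => by
    change Function.Surjective f ↔ Function.Surjective (f ∘ e.symm)
    rw [e.symm.surjective.of_comp_iff])

theorem autCard_cls (M : Type u) [AddCommGroup M] [Module O M] [Finite M] :
    autCard (cls O M) = Nat.card (M ≃ₗ[O] M) := by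
  obtain ⟨e⟩ := rep_cls (O := O) M
  exact Nat.card_congr ⟨fun f => (e.symm.trans f).trans e, fun g => (e.trans g).trans e.symm,
    fun f => by ext; simp, fun f => by ext; simp⟩

theorem autCard_pos (c : IsoClass O) : 0 < autCard c := Nat.card_pos

theorem card_linearEquiv {M N : Type u} [AddCommGroup M] [Module O M] [Finite M]
    [AddCommGroup N] [Module O N] [Finite N] (e : M ≃ₗ[O] N) :
    Nat.card (M ≃ₗ[O] N) = autCard (cls O N) := by
  rw [autCard_cls]
  exact Nat.card_congr ⟨fun f => e.symm.trans f, fun g => e.trans g,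
    fun f => by ext; simp, fun f => by ext; simp⟩

/-- A surjection is a kernel together with an isomorphism from the quotient to `N`, and these
isomorphisms form a torsor under `Aut N`. -/
theorem surjCard_eq (M N : Type u) [AddCommGroup M] [Module O M] [Finite M]
    [AddCommGroup N] [Module O N] [Finite N] :
    surjCard O M N =
      autCard (cls O N) * Nat.card {A : Submodule O M // cls O (M ⧸ A) = cls O N} := by
  refine card_eq_mul_of_fibers (fun f : {f : M →ₗ[O] N // Function.Surjective f} =>
    (⟨LinearMap.ker f.1, cls_eq (f.1.quotKerEquivOfSurjective f.2)⟩ :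
      {A : Submodule O M // cls O (M ⧸ A) = cls O N})) _ ?_
  rintro ⟨A, hA⟩
  obtain ⟨e⟩ := cls_eq_iff.1 hA
  rw [← card_linearEquiv e]
  refine Nat.card_congr ⟨fun f => (Submodule.quotEquivOfEq _ _
      (congrArg Subtype.val f.2).symm).trans (f.1.1.quotKerEquivOfSurjective f.1.2),
    fun g => ⟨⟨g.toLinearMap.comp A.mkQ, g.surjective.comp A.mkQ_surjective⟩,
      Subtype.ext ?_⟩, ?_, ?_⟩
  · simp only
    rw [LinearEquiv.ker_comp, Submodule.ker_mkQ]
  · rintro ⟨⟨f, hf⟩, h⟩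
    rfl
  · intro g
    ext x
    obtain ⟨x, rfl⟩ := A.mkQ_surjective x
    rfl

theorem surjCard_of_card_eq {M N : Type u} [AddCommGroup M] [Module O M] [Finite M]
    [AddCommGroup N] [Module O N] [Finite N] (h : Nat.card M = Nat.card N) :
    surjCard O M N =
      open Classical in if cls O M = cls O N then autCard (cls O N) else 0 := by
  have hbot : ∀ A : Submodule O M, cls O (M ⧸ A) = cls O N → A = ⊥ := by
    intro A hA
    obtain ⟨e⟩ := cls_eq_iff.1 hA
    have h1 := Submodule.card_eq_card_quotient_mul_card A
    rw [h, Nat.card_congr e.toEquiv] at h1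
    have h2 : Nat.card A = 1 :=
      Nat.eq_of_mul_eq_mul_right (m := Nat.card N) Nat.card_pos (by rw [one_mul, ← h1])
    exact Submodule.subsingleton_iff_eq_bot.1 (Nat.card_eq_one_iff_unique.1 h2).1
  have hq : cls O (M ⧸ (⊥ : Submodule O M)) = cls O M :=
    cls_eq (Submodule.quotEquivOfEqBot _ rfl)
  rw [surjCard_eq]
  split_ifs with hc
  · have : Nat.card {A : Submodule O M // cls O (M ⧸ A) = cls O N} = 1 := by
      rw [Nat.card_eq_one_iff_unique]
      exact ⟨⟨fun A B => Subtype.ext ((hbot A.1 A.2).trans (hbot B.1 B.2).symm)⟩,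
        ⟨⟨⊥, hq.trans hc⟩⟩⟩
    rw [this, mul_one]
  · have : IsEmpty {A : Submodule O M // cls O (M ⧸ A) = cls O N} :=
      ⟨fun A => hc (by rw [← hq, ← hbot A.1 A.2, A.2])⟩
    rw [Nat.card_of_isEmpty, mul_zero]

/-- Surjections from a quotient of `F` are surjections from `F` killing the kernel. -/
theorem surjCard_quotient (F N : Type*) [AddCommGroup F] [Module O F] [AddCommGroup N]
    [Module O N] (K : Submodule O F) :
    surjCard O (F ⧸ K) N =
      Nat.card {f : F →ₗ[O] N // K ≤ LinearMap.ker f ∧ Function.Surjective f} := by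
  refine Nat.card_congr ⟨fun g => ⟨g.1.comp K.mkQ, ?_, g.2.comp K.mkQ_surjective⟩,
    fun f => ⟨K.liftQ f.1 f.2.1, ?_⟩, ?_, ?_⟩
  · intro x hx
    rw [LinearMap.mem_ker, LinearMap.comp_apply, Submodule.mkQ_apply,
      (Submodule.Quotient.mk_eq_zero K).2 hx, map_zero]
  · intro y
    obtain ⟨x, hx⟩ := f.2.2 y
    exact ⟨K.mkQ x, hx⟩
  · intro g
    refine Subtype.ext (LinearMap.ext fun x => ?_)
    obtain ⟨x, rfl⟩ := K.mkQ_surjective x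
    rfl
  · intro f
    rfl

/-! ### Explicit extensions of a sum of cyclic modules -/

variable {ι : Type} [Fintype ι]

/-- The relations `a i • ε i = x i` on the direct sum of `X` and the free module on `ι`. -/
def relMap {X : Type*} [AddCommGroup X] [Module O X] (a : ι → O) (x : ι → X) :
    (ι → O) →ₗ[O] X × (ι → O) :=
  LinearMap.prod (-Fintype.linearCombination O x)
    (LinearMap.pi fun i => a i • LinearMap.proj i)

/-- The extension of `⨁ O / a i` by `X` with parameters `x`. -/
abbrev ExtMod {X : Type*} [AddCommGroup X] [Module O X] (a : ι → O) (x : ι → X) :=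
  (X × (ι → O)) ⧸ LinearMap.range (relMap a x)

/-- This is the universal property of `ExtMod a x`: a map out of it is a map `f` on `X` with images
`n i` of the basis vectors that satisfy the defining relations. The relations need only be tested on
basis vectors. -/
theorem range_relMap_le_ker {X M : Type*} [AddCommGroup X] [Module O X] [AddCommGroup M]
    [Module O M] (a : ι → O) (x : ι → X) (f : X →ₗ[O] M) (n : ι → M) :
    LinearMap.range (relMap a x) ≤
      LinearMap.ker (LinearMap.coprod f (Fintype.linearCombination O n)) ↔
      ∀ i, f (x i) = a i • n i := by
  classical
  rw [LinearMap.range_le_ker_iff]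
  have h : ∀ i, ((LinearMap.coprod f (Fintype.linearCombination O n)).comp (relMap a x))
      (Pi.single i 1) = a i • n i - f (x i) := by
    intro i
    have h1 : (fun j => (a j • LinearMap.proj (R := O) (φ := fun _ => O) j) (Pi.single i 1)) =
        Pi.single i (a i) := by
      ext j
      by_cases hj : j = i
      · subst hj; simp
      · simp [hj]
    change f (-(Fintype.linearCombination O x (Pi.single i 1))) + Fintype.linearCombination O n
      ((LinearMap.pi fun i => a i • LinearMap.proj (R := O) (φ := fun _ => O) i)
        (Pi.single i 1)) = _
    rw [show (LinearMap.pi fun i => a i • LinearMap.proj (R := O) (φ := fun _ => O) i)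
      (Pi.single i 1) = Pi.single i (a i) from h1, Fintype.linearCombination_apply_single,
      Fintype.linearCombination_apply_single, one_smul, map_neg, neg_add_eq_sub]
  constructor
  · intro h0 i
    have := h i
    rw [h0, LinearMap.zero_apply] at this
    exact (sub_eq_zero.1 this.symm).symm
  · intro h0
    refine LinearMap.pi_ext' fun i => LinearMap.ext_ring ?_
    rw [LinearMap.comp_apply, LinearMap.single_apply, h, h0, sub_self, LinearMap.zero_comp,
      LinearMap.zero_apply]

theorem surjective_coprod_iff {X M : Type*} [AddCommGroup X] [Module O X] [AddCommGroup M]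
    [Module O M] (f : X →ₗ[O] M) (n : ι → M) :
    Function.Surjective (LinearMap.coprod f (Fintype.linearCombination O n)) ↔
      Submodule.span O (Set.range fun i => (LinearMap.range f).mkQ (n i)) = ⊤ := by
  rw [← LinearMap.range_eq_top, LinearMap.range_coprod, Fintype.range_linearCombination,
    show (Set.range fun i => (LinearMap.range f).mkQ (n i)) =
      (LinearMap.range f).mkQ '' Set.range n from Set.range_comp _ _,
    ← Submodule.map_span, ← Submodule.comap_injective_of_surjective
      (Submodule.mkQ_surjective (LinearMap.range f)) |>.eq_iff, Submodule.comap_map_mkQ,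
    Submodule.comap_top]

theorem surjCard_extMod {X M : Type*} [AddCommGroup X] [Module O X] [AddCommGroup M]
    [Module O M] (a : ι → O) (x : ι → X) :
    surjCard O (ExtMod a x) M =
      Nat.card {p : (X →ₗ[O] M) × (ι → M) // (∀ i, p.1 (x i) = a i • p.2 i) ∧
        Submodule.span O (Set.range fun i => (LinearMap.range p.1).mkQ (p.2 i)) = ⊤} := by
  classical
  rw [surjCard_quotient]
  refine (Nat.card_congr (Equiv.subtypeEquiv (((Equiv.refl _).prodCongr
    (Module.piEquiv ι O M).toEquiv).trans (LinearMap.coprodEquiv O).toEquiv) ?_)).symm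
  rintro ⟨f, n⟩
  have h : (((Equiv.refl (X →ₗ[O] M)).prodCongr (Module.piEquiv ι O M).toEquiv).trans
      (LinearMap.coprodEquiv O).toEquiv) (f, n) =
      LinearMap.coprod f (Fintype.linearCombination O n) := by
    refine LinearMap.ext fun z => ?_
    change f z.1 + Module.piEquiv ι O M n z.2 = _
    rw [Module.piEquiv_apply_apply, LinearMap.coprod_apply, Fintype.linearCombination_apply]
  rw [h, range_relMap_le_ker, surjective_coprod_iff]

theorem surjCard_pi_quotient {M : Type*} [AddCommGroup M] [Module O M] (a : ι → O) :
    surjCard O (∀ i, O ⧸ Ideal.span {a i}) M =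
      Nat.card {n : ι → M // (∀ i, a i • n i = 0) ∧ Submodule.span O (Set.range n) = ⊤} := by
  classical
  have e := Submodule.quotientPi (R := O) (Ms := fun _ : ι => O)
    fun i => (Ideal.span {a i} : Ideal O)
  rw [← surjCard_congr_left e, surjCard_quotient]
  refine (Nat.card_congr (Equiv.subtypeEquiv (Module.piEquiv ι O M).toEquiv fun n => ?_)).symm
  have h : (Module.piEquiv ι O M).toEquiv n = Fintype.linearCombination O n := by
    refine LinearMap.ext fun z => ?_
    change Module.piEquiv ι O M n z = _
    rw [Module.piEquiv_apply_apply, Fintype.linearCombination_apply]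
  rw [h, ← LinearMap.range_eq_top, Fintype.range_linearCombination]
  refine and_congr_left fun _ => ⟨fun h x hx => ?_, fun h i => ?_⟩
  · rw [LinearMap.mem_ker, Fintype.linearCombination_apply]
    refine Finset.sum_eq_zero fun i _ => ?_
    obtain ⟨c, hc⟩ := Ideal.mem_span_singleton'.1 (Submodule.mem_pi.1 hx i (Set.mem_univ i))
    rw [← hc, mul_smul, h, smul_zero]
  · have h1 : Pi.single i (a i) ∈
        Submodule.pi Set.univ fun i => (Ideal.span {a i} : Ideal O) := by
      rw [Submodule.mem_pi]
      intro j _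
      by_cases hj : j = i
      · subst hj
        rw [Pi.single_eq_same]
        exact Ideal.mem_span_singleton_self _
      · rw [Pi.single_eq_of_ne hj]
        exact Submodule.zero_mem _
    have h2 := h h1
    rwa [LinearMap.mem_ker, Fintype.linearCombination_apply_single] at h2

theorem card_linearMap_range_eq {X M : Type*} [AddCommGroup X] [Module O X] [AddCommGroup M]
    [Module O M] (N : Submodule O M) :
    Nat.card {f : X →ₗ[O] M // LinearMap.range f = N} = surjCard O X N := by
  refine Nat.card_congr ⟨fun f => ⟨f.1.codRestrict N fun x => f.2.le ⟨x, rfl⟩, ?_⟩,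
    fun g => ⟨N.subtype.comp g.1, ?_⟩, fun _ => rfl, fun _ => rfl⟩
  · rintro ⟨y, hy⟩
    obtain ⟨x, rfl⟩ := f.2.ge hy
    exact ⟨x, rfl⟩
  · rw [LinearMap.range_comp, LinearMap.range_eq_top.2 g.2, Submodule.map_top,
      Submodule.range_subtype]

/-- Surjections from all extensions of `⨁ O / a i` by `X` onto `M`. -/
theorem sum_surjCard_extMod {X M : Type u} [AddCommGroup X] [Module O X] [Finite X]
    [AddCommGroup M] [Module O M] [Finite M] [Fintype (ι → X)] (a : ι → O) :
    ∑ x : ι → X, surjCard O (ExtMod a x) M =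
      Nat.card X ^ Fintype.card ι * ∑ N : Submodule O M,
        surjCard O X N * surjCard O (∀ i, O ⧸ Ideal.span {a i}) (M ⧸ N) := by
  have := Fintype.ofFinite (X →ₗ[O] M)
  simp only [surjCard_extMod]
  rw [← Nat.card_sigma]
  -- Exchange the order of counting: fix `f` and let the extension parameters `x` vary together with
  -- `n`, which is the situation of `card_solutions`.
  have e : (Σ x : ι → X, {p : (X →ₗ[O] M) × (ι → M) // (∀ i, p.1 (x i) = a i • p.2 i) ∧
        Submodule.span O (Set.range fun i => (LinearMap.range p.1).mkQ (p.2 i)) = ⊤}) ≃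
      Σ f : X →ₗ[O] M, {p : (ι → X) × (ι → M) // (∀ i, f (p.1 i) = a i • p.2 i) ∧
        Submodule.span O (Set.range fun i => (LinearMap.range f).mkQ (p.2 i)) = ⊤} :=
    { toFun := fun s => ⟨s.2.1.1, ⟨(s.1, s.2.1.2), s.2.2⟩⟩
      invFun := fun s => ⟨s.2.1.1, ⟨(s.1, s.2.1.2), s.2.2⟩⟩
      left_inv := fun _ => rfl
      right_inv := fun _ => rfl }
  rw [Nat.card_congr e, Nat.card_sigma]
  simp only [card_solutions _ a fun ν => Submodule.span O (Set.range ν) = ⊤]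
  rw [← Finset.mul_sum]
  congr 1
  simp only [← surjCard_pi_quotient]
  -- The count for `f` depends only on its range, so the maps are grouped by `N = range f`.
  rw [← Finset.sum_fiberwise (s := Finset.univ) (g := fun f : X →ₗ[O] M => LinearMap.range f)]
  refine Finset.sum_congr rfl fun N _ => ?_
  rw [Finset.sum_congr rfl (g := fun _ => surjCard O (∀ i, O ⧸ Ideal.span {a i}) (M ⧸ N))
    (fun f hf => by rw [(Finset.mem_filter.1 hf).2]), Finset.sum_const, smul_eq_mul,
    ← card_linearMap_range_eq, Nat.card_eq_fintype_card, Fintype.card_subtype]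

end Counting

end HallWitt

namespace HallWitt

open IsLocalRing

/-! ### The comultiplication is multiplicative -/

section Green

/-! ### Coordinates on the tensor square -/

section Coefficients

variable {k : Type v} [Field k] {O : Type u} [CommRing O] [IsDomain O]
  [IsDiscreteValuationRing O] [Finite (ResidueField O)]

variable (k O) in
/-- The basis of characteristic functions. -/
def hallBasis : Module.Basis (IsoClass O) k (Hall k O) :=
  Module.Basis.ofRepr (LinearEquiv.refl k (IsoClass O →₀ k))

theorem hallBasis_repr (f : Hall k O) (c : IsoClass O) : (hallBasis k O).repr f c = f c := rfl

/-- The coefficient of `1_P ⊗ 1_Q`. -/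
def tcoeff (P Q : IsoClass O) : Hall k O ⊗[k] Hall k O →ₗ[k] k :=
  ((hallBasis k O).tensorProduct (hallBasis k O)).coord (P, Q)

@[simp] theorem tcoeff_tmul (P Q : IsoClass O) (f g : Hall k O) :
    tcoeff P Q (f ⊗ₜ[k] g) = f P * g Q := by
  rw [tcoeff, Module.Basis.coord_apply, Module.Basis.tensorProduct_repr_tmul_apply, hallBasis_repr,
    hallBasis_repr, smul_eq_mul, mul_comm]

theorem tensor_ext {z w : Hall k O ⊗[k] Hall k O} (h : ∀ P Q, tcoeff P Q z = tcoeff P Q w) :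
    z = w :=
  ((hallBasis k O).tensorProduct (hallBasis k O)).ext_elem fun p => h p.1 p.2

theorem comul_ind (c : IsoClass O) : comul k O (ind k O c) =
    ∑ A : Submodule O c.rep,
      ((autCard (cls O A) : k) * (autCard (cls O (c.rep ⧸ A)) : k) / (autCard c : k)) •
        (ind k O (cls O A) ⊗ₜ[k] ind k O (cls O (c.rep ⧸ A))) :=
  (Finsupp.linearCombination_single k _ _).trans (one_smul _ _)

theorem tcoeff_comul_ind (P Q c : IsoClass O) : tcoeff P Q (comul k O (ind k O c)) =
    hallNum P Q c.rep * ((autCard P : k) * autCard Q / autCard c) := by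
  classical
  have h := conv_ind (k := k) P Q c.rep
  rw [comul_ind, map_sum, ← h, conv, Finset.sum_mul]
  refine Finset.sum_congr rfl fun A _ => ?_
  rw [map_smul, tcoeff_tmul, smul_eq_mul]
  simp only [ind_apply]
  by_cases h1 : cls O A = P
  · by_cases h2 : cls O (c.rep ⧸ A) = Q
    · subst h1 h2
      simp
    · rw [if_neg h2, if_neg (Ne.symm h2)]
      simp
  · rw [if_neg h1, if_neg (Ne.symm h1)]
    simp

theorem linearMap_ext_ind {V : Type*} [AddCommMonoid V] [Module k V] {φ ψ : Hall k O →ₗ[k] V}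
    (h : ∀ c, φ (ind k O c) = ψ (ind k O c)) : φ = ψ :=
  (hallBasis k O).ext h

theorem tcoeff_mul
    (X Y : Type u) [AddCommGroup X] [Module O X] [Finite X] [AddCommGroup Y] [Module O Y] [Finite Y]
    (z w : Hall k O ⊗[k] Hall k O) :
    tcoeff (cls O X) (cls O Y) (z * w) = ∑ A : Submodule O X, ∑ B : Submodule O Y,
      tcoeff (cls O A) (cls O B) z * tcoeff (cls O (X ⧸ A)) (cls O (Y ⧸ B)) w := by
  induction z using TensorProduct.induction_on with
  | zero => simp
  | add z z' hz hz' => simp only [add_mul, map_add, hz, hz', Finset.sum_add_distrib]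
  | tmul f g =>
    induction w using TensorProduct.induction_on with
    | zero => simp
    | add w w' hw hw' => simp only [mul_add, map_add, hw, hw', Finset.sum_add_distrib]
    | tmul f' g' =>
      rw [Algebra.TensorProduct.tmul_mul_tmul, tcoeff_tmul, Hall.mul_apply, Hall.mul_apply,
        conv_rep_cls, conv_rep_cls, conv, conv, Finset.sum_mul_sum]
      refine Finset.sum_congr rfl fun A _ => Finset.sum_congr rfl fun B _ => ?_
      rw [tcoeff_tmul, tcoeff_tmul]
      ring

end Coefficients

/-! ### Averaging over extensions -/

variable {k : Type v} [Field k] {O : Type u} [CommRing O] [IsDomain O]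
  [IsDiscreteValuationRing O] [Finite (ResidueField O)]

variable {ι : Type} [Fintype ι] {X : Type u} [AddCommGroup X] [Module O X] [Finite X]

/-- The extension of `⨁ O / π ^ e i` by `X` with parameters `x`. -/
abbrev CycExt (e : ι → ℕ) (x : ι → X) : Type u := ExtMod (fun i => unif O ^ e i) x

/-- The sequence `0 → X → CycExt e x → ∏ Cyc (e i) → 0` is exact. On the left this uses that `O` is
a domain: a relation with zero free part has zero coefficients. -/
theorem card_cycExt (e : ι → ℕ) (x : ι → X) :
    Nat.card (CycExt (O := O) e x) = Nat.card X * Nat.card (∀ i, Cyc O (e i)) := by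
  classical
  set K := LinearMap.range (relMap (fun i => unif O ^ e i) x) with hK
  have hrel : ∀ b : ι → O, relMap (fun i => unif O ^ e i) x b =
      (-Fintype.linearCombination O x b, fun i => unif O ^ e i * b i) := fun _ => rfl
  let p₀ : X × (ι → O) →ₗ[O] ∀ i, Cyc O (e i) :=
    (LinearMap.pi fun i => (Submodule.mkQ (Ideal.span {unif O ^ e i})).comp (LinearMap.proj i)).comp
      (LinearMap.snd O X (ι → O))
  have hp₀ : ∀ y i, p₀ y i = (Ideal.Quotient.mk _ (y.2 i) : Cyc O (e i)) := fun _ _ => rfl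
  have hKp : K ≤ LinearMap.ker p₀ := by
    rintro _ ⟨b, rfl⟩
    rw [LinearMap.mem_ker]
    funext i
    rw [hp₀, hrel]
    exact cyc_mk_eq_zero.2 (Dvd.intro _ rfl)
  let p : CycExt (O := O) e x →ₗ[O] ∀ i, Cyc O (e i) := K.liftQ p₀ hKp
  have hp : Function.Surjective p := by
    intro y
    choose b hb using fun i => Ideal.Quotient.mk_surjective (y i)
    exact ⟨K.mkQ (0, b), funext hb⟩
  let inc : X →ₗ[O] CycExt (O := O) e x := K.mkQ.comp (LinearMap.inl O X (ι → O))
  have hinc : Function.Injective inc := by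
    rw [← LinearMap.ker_eq_bot, LinearMap.ker_eq_bot']
    intro y hy
    obtain ⟨b, hb⟩ := (Submodule.Quotient.mk_eq_zero K).1 hy
    rw [hrel] at hb
    have h2 : b = 0 := by
      funext i
      have := congrFun (congrArg Prod.snd hb) i
      exact (mul_eq_zero.1 this).resolve_left (pow_ne_zero _ (unif_ne_zero O))
    have h1 := congrArg Prod.fst hb
    rw [h2, map_zero, neg_zero] at h1
    exact h1.symm
  have hker : LinearMap.ker p = LinearMap.range inc := by
    ext y
    obtain ⟨⟨y, b⟩, rfl⟩ := K.mkQ_surjective y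
    rw [LinearMap.mem_ker]
    constructor
    · intro h
      have h1 : ∀ i, unif O ^ e i ∣ b i := fun i => cyc_mk_eq_zero.1 (congrFun h i)
      choose c hc using h1
      refine ⟨y + Fintype.linearCombination O x c, ?_⟩
      change K.mkQ (y + Fintype.linearCombination O x c, 0) = K.mkQ (y, b)
      rw [← sub_eq_zero, ← map_sub, Submodule.mkQ_apply, Submodule.Quotient.mk_eq_zero]
      refine ⟨-c, ?_⟩
      rw [hrel]
      ext i
      · simp
      · simp [hc]
    · rintro ⟨z, hz⟩
      rw [← hz]
      funext i
      change (Ideal.Quotient.mk _ (0 : O) : Cyc O (e i)) = 0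
      exact map_zero _
  rw [Submodule.card_eq_card_quotient_mul_card (LinearMap.ker p),
    Nat.card_congr (p.quotKerEquivOfSurjective hp).toEquiv, hker,
    ← Nat.card_congr (LinearEquiv.ofInjective inc hinc).toEquiv]

instance finite_cycExt (e : ι → ℕ) (x : ι → X) : Finite (CycExt (O := O) e x) := by
  refine Nat.finite_of_card_ne_zero ?_
  rw [card_cycExt]
  exact mul_ne_zero Nat.card_pos.ne' Nat.card_pos.ne'

/-- Surjections onto a module of the same cardinality, summed over all submodules. -/
theorem sum_surjCard_mul_surjCard {X Y M : Type u} [AddCommGroup X] [Module O X] [Finite X]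
    [AddCommGroup Y] [Module O Y] [Finite Y] [AddCommGroup M] [Module O M] [Finite M]
    (h : Nat.card M = Nat.card X * Nat.card Y) :
    ∑ N : Submodule O M, surjCard O X N * surjCard O Y (M ⧸ N) =
      hallNum (cls O X) (cls O Y) M * (autCard (cls O X) * autCard (cls O Y)) := by
  classical
  have key : ∀ N : Submodule O M, surjCard O X N * surjCard O Y (M ⧸ N) =
      if cls O N = cls O X ∧ cls O (M ⧸ N) = cls O Y then
        autCard (cls O X) * autCard (cls O Y) else 0 := by
    intro N
    have hMN := Submodule.card_eq_card_quotient_mul_card N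
    by_cases hne : surjCard O X N * surjCard O Y (M ⧸ N) = 0
    · rw [hne]
      split_ifs with hc
      · exfalso
        obtain ⟨e1⟩ := cls_eq_iff.1 hc.1
        obtain ⟨e2⟩ := cls_eq_iff.1 hc.2
        rw [surjCard_of_card_eq (Nat.card_congr e1.symm.toEquiv),
          surjCard_of_card_eq (Nat.card_congr e2.symm.toEquiv), if_pos hc.1.symm,
          if_pos hc.2.symm] at hne
        exact (Nat.mul_pos (autCard_pos _) (autCard_pos _)).ne' hne
      · rfl
    · have h1 := (mul_ne_zero_iff.1 hne).1
      have h2 := (mul_ne_zero_iff.1 hne).2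
      obtain ⟨⟨f, hf⟩⟩ := (Nat.card_ne_zero.1 h1).1
      obtain ⟨⟨g, hg⟩⟩ := (Nat.card_ne_zero.1 h2).1
      -- Surjections give `|N| ≤ |X|` and `|M / N| ≤ |Y|`. The products of the two sides agree, so
      -- both are equalities and the surjections are isomorphisms.
      have l1 := Nat.card_le_card_of_surjective f hf
      have l2 := Nat.card_le_card_of_surjective g hg
      have p1 : 0 < Nat.card N := Nat.card_pos
      have p2 : 0 < Nat.card (M ⧸ N) := Nat.card_pos
      have c1 : Nat.card X = Nat.card N := by
        rw [h] at hMN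
        nlinarith
      have c2 : Nat.card Y = Nat.card (M ⧸ N) := by
        rw [h, c1] at hMN
        exact Nat.eq_of_mul_eq_mul_left p1 hMN
      rw [surjCard_of_card_eq c1, surjCard_of_card_eq c2]
      by_cases hc1 : cls O X = cls O N
      · by_cases hc2 : cls O Y = cls O (M ⧸ N)
        · rw [if_pos hc1, if_pos hc2, if_pos ⟨hc1.symm, hc2.symm⟩, hc1, hc2]
        · rw [if_neg hc2, mul_zero]
          exact (if_neg fun hh => hc2 hh.2.symm).symm
      · rw [if_neg hc1, zero_mul]
        exact (if_neg fun hh => hc1 hh.1.symm).symm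
  rw [Finset.sum_congr rfl fun N _ => key N, ← Finset.sum_filter, Finset.sum_const, smul_eq_mul,
    hallNum, Nat.card_eq_fintype_card, Fintype.card_subtype]

variable [CharZero k]

/-- A form of Riedtmann's formula. Count surjections from all extensions onto `c.rep`: when the
cardinalities match they are isomorphisms, so each parameter `x` giving the class `c` contributes
`|Aut c|`, while `sum_surjCard_extMod` gives the Hall number times automorphism counts. When they do
not match, both sides vanish. -/
theorem tcoeff_comul_ind_eq_average [Fintype (ι → X)] (e : ι → ℕ) (c : IsoClass O) :
    (Nat.card X : k) ^ Fintype.card ι *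
        tcoeff (cls O X) (cls O (∀ i, Cyc O (e i))) (comul k O (ind k O c)) =
      ∑ x : ι → X, ind k O c (cls O (CycExt (O := O) e x)) := by
  classical
  have hc0 : (autCard c : k) ≠ 0 := Nat.cast_ne_zero.2 (autCard_pos c).ne'
  rw [tcoeff_comul_ind]
  by_cases h : Nat.card c.rep = Nat.card X * Nat.card (∀ i, Cyc O (e i))
  · have h1 := sum_surjCard_extMod (X := X) (M := c.rep) fun i => unif O ^ e i
    rw [sum_surjCard_mul_surjCard h] at h1
    have h2 : ∀ x : ι → X, (surjCard O (CycExt (O := O) e x) c.rep : k) =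
        ind k O c (cls O (CycExt (O := O) e x)) * autCard c := by
      intro x
      rw [surjCard_of_card_eq (by rw [card_cycExt, h]), cls_rep, ind_apply]
      by_cases hx : c = cls O (CycExt (O := O) e x)
      · rw [if_pos hx, if_pos hx.symm, one_mul]
      · rw [if_neg hx, if_neg (Ne.symm hx), zero_mul, Nat.cast_zero]
    have h3 := congrArg (Nat.cast : ℕ → k) h1
    push_cast at h3
    rw [Finset.sum_congr rfl fun x _ => h2 x, ← Finset.sum_mul] at h3
    rw [← mul_div_assoc, ← mul_div_assoc, div_eq_iff hc0, h3]
  · have h1 : hallNum (cls O X) (cls O (∀ i, Cyc O (e i))) c.rep = 0 := by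
      by_contra hne
      exact h (by rw [card_of_hallNum_ne_zero hne, card_rep_cls, card_rep_cls])
    rw [h1, Nat.cast_zero, zero_mul, mul_zero]
    refine (Finset.sum_eq_zero fun x _ => ?_).symm
    rw [ind_apply, if_neg]
    rintro rfl
    exact h (by rw [card_rep_cls, card_cycExt])

/-- The comultiplication averages a function over all extensions. -/
theorem tcoeff_comul_eq_average [Fintype (ι → X)] (e : ι → ℕ) (f : Hall k O) :
    (Nat.card X : k) ^ Fintype.card ι *
        tcoeff (cls O X) (cls O (∀ i, Cyc O (e i))) (comul k O f) =
      ∑ x : ι → X, f (cls O (CycExt (O := O) e x)) := by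
  have h : (((Nat.card X : k) ^ Fintype.card ι) •
      (tcoeff (cls O X) (cls O (∀ i, Cyc O (e i)))).comp (comul k O)) =
      ∑ x : ι → X, (hallBasis k O).coord (cls O (CycExt (O := O) e x)) := by
    refine linearMap_ext_ind fun c => ?_
    rw [LinearMap.sum_apply]
    exact tcoeff_comul_ind_eq_average e c
  have h1 := LinearMap.congr_fun h f
  rw [LinearMap.sum_apply] at h1
  exact h1

/-! ### Green's formula for the sum of all classes of given cardinality -/

variable (k O) in
/-- The sum of the classes of cardinality `N`. -/
def allElt (N : ℕ) : Hall k O := ∑ c ∈ (finite_card_eq (O := O) N).toFinset, ind k O c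

theorem hall_sum_apply {α : Type*} (s : Finset α) (f : α → Hall k O) (c : IsoClass O) :
    (∑ i ∈ s, f i) c = ∑ i ∈ s, f i c :=
  map_sum ((hallBasis k O).coord c) f s

theorem allElt_apply (N : ℕ) (c : IsoClass O) :
    allElt k O N c = if Nat.card c.rep = N then 1 else 0 := by
  classical
  rw [allElt, hall_sum_apply]
  simp only [ind_apply, Finset.sum_ite_eq', Set.Finite.mem_toFinset]
  rfl

theorem exists_cls_pi_cyc (Y : IsoClass O) :
    ∃ (d : ℕ) (e : Fin d → ℕ), Y = cls O (∀ i, Cyc O (e i)) := by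
  obtain ⟨d, e, ⟨f⟩⟩ := exists_equiv_pi_cyc (O := O) Y.rep
  exact ⟨d, e, by rw [← cls_rep Y, cls_eq f]⟩

/-- The function depends only on cardinality, which is the same for all extensions of `Y` by `X`, so
averaging does nothing. -/
theorem tcoeff_comul_allElt (N : ℕ) (X Y : IsoClass O) : tcoeff X Y (comul k O (allElt k O N)) =
    if Nat.card X.rep * Nat.card Y.rep = N then 1 else 0 := by
  classical
  obtain ⟨d, e, rfl⟩ := exists_cls_pi_cyc Y
  have := Fintype.ofFinite (Fin d → X.rep)
  have h := tcoeff_comul_eq_average (X := X.rep) e (allElt k O N)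
  simp only [allElt_apply, card_rep_cls, card_cycExt, cls_rep, Finset.sum_const,
    Finset.card_univ] at h
  rw [← Nat.card_eq_fintype_card (α := Fin d → X.rep), Nat.card_fun, Nat.card_eq_fintype_card (α := Fin d),
    nsmul_eq_mul, Nat.cast_pow] at h
  rw [card_rep_cls]
  exact mul_left_cancel₀ (pow_ne_zero _ (Nat.cast_ne_zero.2 Nat.card_pos.ne')) h

/-- The left factor ignores the class of the submodule, so the coefficient counts quotients of `C`
isomorphic to `M`, which are surjections up to `Aut M`. -/
theorem allElt_mul_ind_apply (N : ℕ) (M : IsoClass O) (C : Type u) [AddCommGroup C] [Module O C]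
    [Finite C] : (allElt k O N * ind k O M) (cls O C) * autCard M =
      if Nat.card C = N * Nat.card M.rep then (surjCard O C M.rep : k) else 0 := by
  classical
  have hM : cls O M.rep = M := cls_rep M
  have h1 : (allElt k O N * ind k O M) (cls O C) =
      if Nat.card C = N * Nat.card M.rep then
        (Nat.card {A : Submodule O C // cls O (C ⧸ A) = cls O M.rep} : k) else 0 := by
    rw [Hall.mul_apply, conv_rep_cls, conv, hM,
      Nat.card_eq_fintype_card (α := {A : Submodule O C // cls O (C ⧸ A) = M}),
      Fintype.card_subtype, Finset.card_filter, Nat.cast_sum]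
    split_ifs with h
    · refine Finset.sum_congr rfl fun A _ => ?_
      rw [allElt_apply, ind_apply, card_rep_cls]
      by_cases hA : cls O (C ⧸ A) = M
      · have h2 := Submodule.card_eq_card_quotient_mul_card A
        rw [h, ← card_rep_cls (O := O) (C ⧸ A), hA] at h2
        rw [if_pos hA, if_pos hA.symm, if_pos (Nat.eq_of_mul_eq_mul_right Nat.card_pos h2).symm]
        simp
      · rw [if_neg hA, if_neg (Ne.symm hA)]
        simp
    · refine Finset.sum_eq_zero fun A _ => ?_
      rw [allElt_apply, ind_apply, card_rep_cls]
      by_cases hA : M = cls O (C ⧸ A)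
      · rw [if_neg, zero_mul]
        intro hN
        refine h ?_
        rw [hA, card_rep_cls, ← hN]
        exact Submodule.card_eq_card_quotient_mul_card A
      · rw [if_neg hA, mul_zero]
  rw [h1, surjCard_eq, hM]
  split_ifs
  · push_cast; ring
  · ring

/-- Both sides count triples of a submodule `N` and surjections `X → N`, `Y → M / N`; on the left
they are sorted by the kernels `A` and `B`. -/
theorem sum_hallNum_mul_autCard (X Y M : Type u) [AddCommGroup X] [Module O X] [Finite X]
    [AddCommGroup Y] [Module O Y] [Finite Y] [AddCommGroup M] [Module O M] [Finite M] :
    ∑ A : Submodule O X, ∑ B : Submodule O Y, hallNum (cls O (X ⧸ A)) (cls O (Y ⧸ B)) M *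
        (autCard (cls O (X ⧸ A)) * autCard (cls O (Y ⧸ B))) =
      ∑ N : Submodule O M, surjCard O X N * surjCard O Y (M ⧸ N) := by
  classical
  have h1 : ∀ (A : Submodule O X) (B : Submodule O Y),
      hallNum (cls O (X ⧸ A)) (cls O (Y ⧸ B)) M *
        (autCard (cls O (X ⧸ A)) * autCard (cls O (Y ⧸ B))) =
      ∑ N : Submodule O M, (if cls O (X ⧸ A) = cls O N then autCard (cls O N) else 0) *
        (if cls O (Y ⧸ B) = cls O (M ⧸ N) then autCard (cls O (M ⧸ N)) else 0) := by
    intro A B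
    rw [hallNum, Nat.card_eq_fintype_card, Fintype.card_subtype, Finset.card_filter,
      Finset.sum_mul]
    refine Finset.sum_congr rfl fun N _ => ?_
    by_cases hA : cls O (X ⧸ A) = cls O N
    · by_cases hB : cls O (Y ⧸ B) = cls O (M ⧸ N)
      · rw [if_pos hA, if_pos hB, if_pos ⟨hA.symm, hB.symm⟩, hA, hB, one_mul]
      · rw [if_neg hB, if_neg fun hh => hB hh.2.symm, mul_zero, zero_mul]
    · rw [if_neg hA, if_neg fun hh => hA hh.1.symm, zero_mul, zero_mul]
  have h2 : ∀ (X N : Type u) [AddCommGroup X] [Module O X] [Finite X] [AddCommGroup N]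
      [Module O N] [Finite N], surjCard O X N =
      ∑ A : Submodule O X, if cls O (X ⧸ A) = cls O N then autCard (cls O N) else 0 := by
    intro X N _ _ _ _ _ _
    rw [surjCard_eq, ← Finset.sum_filter, Finset.sum_const, smul_eq_mul, mul_comm,
      Nat.card_eq_fintype_card, Fintype.card_subtype]
  simp only [h1]
  rw [Finset.sum_congr rfl fun A _ => Finset.sum_comm, Finset.sum_comm]
  refine Finset.sum_congr rfl fun N _ => ?_
  rw [h2 X N, h2 Y (M ⧸ N), Finset.sum_mul_sum]

/-- Multiply by `|Aut M|` and `|X| ^ ι`. When the cardinalities fit, the left side counts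
surjections onto `M` from all extensions, and the right side counts pairs of surjections onto `N`
and `M / N`; `sum_surjCard_extMod` equates them. Otherwise both sides are zero. This special case
suffices, because the elements `allElt` generate the algebra. -/
theorem tcoeff_comul_allElt_mul_ind (N : ℕ) (M : IsoClass O) (e : ι → ℕ) :
    tcoeff (cls O X) (cls O (∀ i, Cyc O (e i))) (comul k O (allElt k O N * ind k O M)) =
      tcoeff (cls O X) (cls O (∀ i, Cyc O (e i)))
        (comul k O (allElt k O N) * comul k O (ind k O M)) := by
  classical
  have := Fintype.ofFinite (ι → X)
  have hM0 : (autCard M : k) ≠ 0 := Nat.cast_ne_zero.2 (autCard_pos M).ne'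
  refine mul_right_cancel₀ hM0 ?_
  refine mul_left_cancel₀ (pow_ne_zero (Fintype.card ι)
    (Nat.cast_ne_zero.2 (Nat.card_pos (α := X)).ne' : (Nat.card X : k) ≠ 0)) ?_
  have hL := tcoeff_comul_eq_average (X := X) e (allElt k O N * ind k O M)
  rw [← mul_assoc, hL, Finset.sum_mul]
  simp only [allElt_mul_ind_apply, card_cycExt]
  rw [tcoeff_mul]
  simp only [tcoeff_comul_allElt, tcoeff_comul_ind, card_rep_cls]
  have hterm : ∀ (A : Submodule O X) (B : Submodule O (∀ i, Cyc O (e i))),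
      (if Nat.card A * Nat.card B = N then (1 : k) else 0) *
        (hallNum (cls O (X ⧸ A)) (cls O ((∀ i, Cyc O (e i)) ⧸ B)) M.rep *
          ((autCard (cls O (X ⧸ A)) : k) * autCard (cls O ((∀ i, Cyc O (e i)) ⧸ B)) /
            autCard M)) * autCard M =
      if Nat.card X * Nat.card (∀ i, Cyc O (e i)) = N * Nat.card M.rep then
        ((hallNum (cls O (X ⧸ A)) (cls O ((∀ i, Cyc O (e i)) ⧸ B)) M.rep *
          (autCard (cls O (X ⧸ A)) * autCard (cls O ((∀ i, Cyc O (e i)) ⧸ B))) : ℕ) : k)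
      else 0 := by
    intro A B
    by_cases h0 : hallNum (cls O (X ⧸ A)) (cls O ((∀ i, Cyc O (e i)) ⧸ B)) M.rep = 0
    · rw [h0]; simp
    · have h1 := card_of_hallNum_ne_zero h0
      rw [card_rep_cls, card_rep_cls] at h1
      have h2 := Submodule.card_eq_card_quotient_mul_card A
      have h3 := Submodule.card_eq_card_quotient_mul_card B
      have h4 : Nat.card A * Nat.card B = N ↔
          Nat.card X * Nat.card (∀ i, Cyc O (e i)) = N * Nat.card M.rep := by
        rw [h2, h3, show ∀ a b c d : ℕ, a * b * (c * d) = a * c * (b * d) by intros; ring, ← h1]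
        exact ⟨fun h => by rw [h], fun h => Nat.eq_of_mul_eq_mul_right Nat.card_pos h⟩
      by_cases h5 : Nat.card A * Nat.card B = N
      · rw [if_pos h5, if_pos (h4.1 h5)]
        push_cast
        field_simp
      · rw [if_neg h5, if_neg fun h => h5 (h4.2 h)]
        simp
  rw [Finset.sum_mul]
  simp only [Finset.sum_mul, hterm]
  split_ifs with h
  · have h1 := sum_surjCard_extMod (X := X) (M := M.rep) fun i => unif O ^ e i
    rw [← sum_hallNum_mul_autCard] at h1
    exact_mod_cast h1
  · simp

theorem comul_allElt_mul_ind (N : ℕ) (M : IsoClass O) :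
    comul k O (allElt k O N * ind k O M) =
      comul k O (allElt k O N) * comul k O (ind k O M) := by
  refine tensor_ext fun X Y => ?_
  obtain ⟨d, e, rfl⟩ := exists_cls_pi_cyc Y
  rw [← cls_rep X]
  exact tcoeff_comul_allElt_mul_ind N M e

end Green

end HallWitt

namespace HallWitt

open IsLocalRing

/-! ### Counting subspaces -/

section QBinomial

variable {k : Type v} [Field k]

/-- The product `∏_{t < n} (q ^ (t + 1) - 1)`. -/
def qFactorial (q : k) (n : ℕ) : k := ∏ t ∈ Finset.range n, (q ^ (t + 1) - 1)

theorem qFactorial_succ (q : k) (n : ℕ) :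
    qFactorial q (n + 1) = qFactorial q n * (q ^ (n + 1) - 1) := Finset.prod_range_succ _ _

theorem prod_pow_sub_pow (q : k) {d i : ℕ} (h : i ≤ d) :
    (∏ t ∈ Finset.range i, (q ^ d - q ^ t)) * qFactorial q (d - i) =
      q ^ (i * (i - 1) / 2) * qFactorial q d := by
  rw [← Finset.sum_range_id, ← Finset.prod_pow_eq_pow_sum]
  induction i with
  | zero => simp
  | succ i ih =>
    have ih := ih (by omega)
    obtain ⟨s, rfl⟩ := Nat.exists_eq_add_of_le h
    rw [show i + 1 + s - i = s + 1 by omega, qFactorial_succ] at ih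
    rw [show i + 1 + s - (i + 1) = s by omega, Finset.prod_range_succ, Finset.prod_range_succ,
      mul_right_comm _ (q ^ i), ← ih]
    ring

theorem qFactorial_ne_zero {q : k} (hq : ∀ n, q ^ (n + 1) - 1 ≠ 0) (n : ℕ) :
    qFactorial q n ≠ 0 := Finset.prod_ne_zero_iff.2 fun _ _ => hq _

theorem triangle_succ (m : ℕ) : (m + 1) * (m + 1 - 1) / 2 = m * (m - 1) / 2 + m := by
  rw [← Finset.sum_range_id, ← Finset.sum_range_id, Finset.sum_range_succ]

/-- A closed form for the partial sums makes the induction possible. At `m = e` only the last term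
of the full sum is missing. -/
theorem sum_qBinomial_partial {q : k} (hq : ∀ n, q ^ (n + 1) - 1 ≠ 0) (e m : ℕ) (hm : m ≤ e) :
    ∑ i ∈ Finset.range (m + 1), (-1) ^ i * q ^ (i * (i - 1) / 2) /
        (qFactorial q i * qFactorial q (e + 1 - i)) =
      (-1) ^ m * q ^ (m * (m - 1) / 2) * q ^ m /
        ((q ^ (e + 1) - 1) * qFactorial q m * qFactorial q (e - m)) := by
  induction m with
  | zero =>
    simp [qFactorial_succ, show qFactorial q 0 = 1 from Finset.prod_range_zero _, mul_comm]
  | succ m ih =>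
    obtain ⟨s, rfl⟩ := Nat.exists_eq_add_of_le hm
    rw [Finset.sum_range_succ, ih (by omega), triangle_succ,
      show m + 1 + s - m = s + 1 by omega, show m + 1 + s + 1 - (m + 1) = s + 1 by omega,
      show m + 1 + s - (m + 1) = s by omega, qFactorial_succ, qFactorial_succ]
    have h1 := hq m
    have h2 := hq s
    have h3 := hq (m + 1 + s)
    have h4 := qFactorial_ne_zero hq m
    have h5 := qFactorial_ne_zero hq s
    rw [div_add_div _ _ (by positivity) (by positivity), div_eq_div_iff (by positivity)
      (by positivity)]
    ring

/-- Up to the factor `qFactorial q d`, this is the `q`-binomial expansion of `∏_{j < d} (1 - q ^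
j)`, whose factor at `j = 0` vanishes. -/
theorem sum_qBinomial {q : k} (hq : ∀ n, q ^ (n + 1) - 1 ≠ 0) {d : ℕ} (hd : d ≠ 0) :
    ∑ i ∈ Finset.range (d + 1), (-1) ^ i * q ^ (i * (i - 1) / 2) /
        (qFactorial q i * qFactorial q (d - i)) = 0 := by
  obtain ⟨e, rfl⟩ := Nat.exists_eq_succ_of_ne_zero hd
  rw [Nat.succ_eq_add_one, Finset.sum_range_succ, sum_qBinomial_partial hq e e le_rfl,
    triangle_succ, Nat.sub_self, Nat.sub_self, qFactorial_succ,
    show qFactorial q 0 = 1 from Finset.prod_range_zero _]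
  have h1 := hq e
  have h4 := qFactorial_ne_zero hq e
  field_simp
  ring

end QBinomial

/-! ### Subspaces and Gaussian binomial coefficients -/

section Subspaces

variable {O : Type u} [CommRing O] [IsDomain O] [IsDiscreteValuationRing O]
  [Finite (ResidueField O)]

theorem card_injective (M : Type u) [AddCommGroup M] [Module O M] [Finite M]
    (h : ∀ x : M, unif O • x = 0) {d i : ℕ} (hM : Nat.card M = resCard O ^ d) (hi : i ≤ d) :
    Nat.card {f : (Fin i → ResidueField O) →ₗ[O] M // Function.Injective f} =
      ∏ t ∈ Finset.range i, (resCard O ^ d - resCard O ^ t) := by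
  classical
  letI := residueModule M h
  have := residueModule_isScalarTower M h
  have := Fintype.ofFinite (ResidueField O)
  have := Fintype.ofFinite M
  have hsurj : Function.Surjective (algebraMap O (ResidueField O)) := residue_surjective
  have hd : Module.finrank (ResidueField O) M = d := by
    rw [Module.natCard_eq_pow_finrank (K := ResidueField O) (V := M)] at hM
    exact Nat.pow_right_injective (one_lt_resCard O) hM
  have hc := card_linearIndependent (K := ResidueField O) (V := M) (k := i) (by rw [hd]; exact hi)
  rw [hd, ← Nat.card_eq_fintype_card] at hc
  rw [Finset.prod_range]
  refine Eq.trans ?_ hc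
  refine (Nat.card_congr (Equiv.subtypeEquiv ((Module.piEquiv (Fin i) (ResidueField O) M).toEquiv.trans
    (LinearMap.extendScalarsOfSurjectiveEquiv hsurj).symm.toEquiv) fun s => ?_)).symm
  rw [linearIndependent_iff_injective_fintypeLinearCombination]
  have h1 : ⇑(((Module.piEquiv (Fin i) (ResidueField O) M).toEquiv.trans
    (LinearMap.extendScalarsOfSurjectiveEquiv hsurj).symm.toEquiv) s) =
      Fintype.linearCombination (ResidueField O) s := by
    funext z
    change Module.piEquiv (Fin i) (ResidueField O) M s z = _
    rw [Module.piEquiv_apply_apply, Fintype.linearCombination_apply]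
  rw [h1]

theorem card_injective_eq (M : Type u) [AddCommGroup M] [Module O M] [Finite M] (i : ℕ) :
    Nat.card {f : (Fin i → ResidueField O) →ₗ[O] M // Function.Injective f} =
      autCard (resCls O i) * Nat.card {A : Submodule O M // cls O A = resCls O i} := by
  refine card_eq_mul_of_fibers
    (fun f : {f : (Fin i → ResidueField O) →ₗ[O] M // Function.Injective f} =>
      (⟨LinearMap.range f.1, (cls_eq (LinearEquiv.ofInjective f.1 f.2)).symm⟩ :
        {A : Submodule O M // cls O A = resCls O i})) _ ?_
  rintro ⟨A, hA⟩
  obtain ⟨e⟩ := cls_eq_iff.1 hA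
  have hc : Nat.card ((Fin i → ResidueField O) ≃ₗ[O] A) = autCard (resCls O i) :=
    (card_linearEquiv e.symm).trans (congrArg autCard hA)
  rw [← hc]
  refine Nat.card_congr ⟨fun f => (LinearEquiv.ofInjective f.1.1 f.1.2).trans
      (LinearEquiv.ofEq _ _ (congrArg Subtype.val f.2)),
    fun g => ⟨⟨A.subtype.comp g.toLinearMap, A.injective_subtype.comp g.injective⟩,
      Subtype.ext ?_⟩, fun _ => rfl, fun g => LinearEquiv.ext fun x => Subtype.ext rfl⟩
  simp only
  rw [LinearMap.range_comp, LinearEquiv.range, Submodule.map_top, Submodule.range_subtype]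

theorem autCard_resCls (i : ℕ) :
    autCard (resCls O i) = ∏ t ∈ Finset.range i, (resCard O ^ i - resCard O ^ t) := by
  rw [← card_injective (Fin i → ResidueField O) (unif_smul_residue i) (card_residue_pow i) le_rfl,
    card_injective_eq]
  have : Nat.card {A : Submodule O (Fin i → ResidueField O) // cls O A = resCls O i} = 1 := by
    rw [Nat.card_eq_one_iff_unique]
    have h : ∀ A : Submodule O (Fin i → ResidueField O), cls O A = resCls O i → A = ⊤ := by
      intro A hA
      obtain ⟨e⟩ := cls_eq_iff.1 hA
      refine SetLike.coe_injective (Set.Finite.eq_of_subset_of_card_le (Set.toFinite _)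
        (fun _ _ => trivial) ?_)
      exact ((Nat.card_congr (Submodule.topEquiv (R := O)
        (M := Fin i → ResidueField O)).toEquiv).trans (Nat.card_congr e.toEquiv).symm).le
    exact ⟨⟨fun A B => Subtype.ext ((h A.1 A.2).trans (h B.1 B.2).symm)⟩,
      ⟨⟨⊤, cls_eq Submodule.topEquiv⟩⟩⟩
  rw [this, mul_one]

theorem card_submodule_resCls_soc (M : Type u) [AddCommGroup M] [Module O M] [Finite M] (i : ℕ) :
    Nat.card {A : Submodule O M // cls O A = resCls O i} =
      Nat.card {B : Submodule O (soc O M) // cls O B = resCls O i} := by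
  refine (Nat.card_congr ⟨fun B => ⟨B.1.map (soc O M).subtype, (cls_eq
      (Submodule.equivMapOfInjective _ (Submodule.subtype_injective _) B.1)).symm.trans B.2⟩,
    fun A => ⟨A.1.submoduleOf (soc O M),
      (cls_eq (Submodule.submoduleOfEquivOfLe (le_soc_of_cls A.2).1)).trans A.2⟩,
    fun B => Subtype.ext ?_, fun A => Subtype.ext ?_⟩).symm
  · exact Submodule.comap_map_eq_of_injective (Submodule.subtype_injective _) _
  · exact (Submodule.map_comap_subtype _ _).trans (inf_eq_right.2 (le_soc_of_cls A.2).1)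

variable (k : Type v) [Field k] [CharZero k]

theorem resCard_pow_sub_one_ne_zero (n : ℕ) : (resCard O : k) ^ (n + 1) - 1 ≠ 0 := by
  rw [sub_ne_zero, ← Nat.cast_pow, ← Nat.cast_one (R := k), Nat.cast_injective.ne_iff]
  exact (Nat.one_lt_pow n.succ_ne_zero (one_lt_resCard O)).ne'

theorem cast_prod_pow_sub_pow {d i : ℕ} (h : i ≤ d) :
    ((∏ t ∈ Finset.range i, (resCard O ^ d - resCard O ^ t) : ℕ) : k) =
      (resCard O : k) ^ (i * (i - 1) / 2) * qFactorial (resCard O : k) d /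
        qFactorial (resCard O : k) (d - i) := by
  rw [eq_div_iff (qFactorial_ne_zero (resCard_pow_sub_one_ne_zero (O := O) k) _),
    ← prod_pow_sub_pow _ h, Nat.cast_prod]
  congr 1
  refine Finset.prod_congr rfl fun t ht => ?_
  rw [Nat.cast_sub (Nat.pow_le_pow_right (resCard_pos O)
    ((Finset.mem_range.1 ht).le.trans h)), Nat.cast_pow, Nat.cast_pow]

theorem cast_autCard_resCls (i : ℕ) : (autCard (resCls O i) : k) =
    (resCard O : k) ^ (i * (i - 1) / 2) * qFactorial (resCard O : k) i := by
  rw [autCard_resCls, cast_prod_pow_sub_pow k le_rfl, Nat.sub_self,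
    show qFactorial (resCard O : k) 0 = 1 from Finset.prod_range_zero _, div_one]

/-- The number of `i`-dimensional subspaces is a Gaussian binomial coefficient. -/
theorem cast_card_submodule_resCls (M : Type u) [AddCommGroup M] [Module O M] [Finite M]
    {d i : ℕ} (hM : Nat.card (soc O M) = resCard O ^ d) (hi : i ≤ d) :
    (Nat.card {A : Submodule O M // cls O A = resCls O i} : k) =
      qFactorial (resCard O : k) d /
        (qFactorial (resCard O : k) i * qFactorial (resCard O : k) (d - i)) := by
  have h1 := card_injective_eq (O := O) (soc O M) i
  rw [card_injective (soc O M)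
    (fun x => Subtype.ext ((Submodule.mem_torsionBy_iff _ _).1 x.2)) hM hi,
    ← card_submodule_resCls_soc] at h1
  have h2 := congrArg (Nat.cast : ℕ → k) h1
  rw [cast_prod_pow_sub_pow k hi, Nat.cast_mul, cast_autCard_resCls] at h2
  have h3 := qFactorial_ne_zero (resCard_pow_sub_one_ne_zero (O := O) k) i
  have h4 := qFactorial_ne_zero (resCard_pow_sub_one_ne_zero (O := O) k) (d - i)
  have h5 := pow_ne_zero (i * (i - 1) / 2) (resCard_cast_ne_zero k O)
  refine mul_left_cancel₀ (mul_ne_zero h5 h3) ?_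
  rw [← h2]
  field_simp

theorem card_submodule_resCls_of_lt (M : Type u) [AddCommGroup M] [Module O M] [Finite M]
    {d i : ℕ} (hM : Nat.card (soc O M) = resCard O ^ d) (hi : d < i) :
    Nat.card {A : Submodule O M // cls O A = resCls O i} = 0 := by
  have : IsEmpty {A : Submodule O M // cls O A = resCls O i} := by
    refine ⟨fun A => ?_⟩
    obtain ⟨h1, h2⟩ := le_soc_of_cls A.2
    have h3 : Nat.card A.1 ≤ Nat.card (soc O M) := Nat.card_mono (Set.toFinite _) h1
    rw [h2, hM] at h3
    exact absurd h3 (not_le.2 (Nat.pow_lt_pow_right (one_lt_resCard O) hi))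
  exact Nat.card_of_isEmpty

/-- Submodules isomorphic to `κ ^ i` lie in the socle, which is nonzero. The sum is therefore an
alternating sum of Gaussian binomial coefficients of positive dimension. -/
theorem alternating_sum_subspaces (M : Type u) [AddCommGroup M] [Module O M] [Finite M]
    [Nontrivial M] {n : ℕ} (hM : Nat.card M = resCard O ^ n) :
    ∑ i ∈ Finset.range (n + 1), (-1 : k) ^ i * (resCard O : k) ^ (i * (i - 1) / 2) *
      Nat.card {A : Submodule O M // cls O A = resCls O i} = 0 := by
  obtain ⟨d, hd⟩ := exists_card_eq_pow (O := O) (soc O M)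
  have hd0 : d ≠ 0 := by
    rintro rfl
    rw [pow_zero] at hd
    have := (Nat.card_eq_one_iff_unique.1 hd).1
    exact soc_ne_bot M (Submodule.subsingleton_iff_eq_bot.1 this)
  have hdn : d ≤ n := by
    have h1 : Nat.card (soc O M) ≤ Nat.card M :=
      Nat.card_le_card_of_injective _ Subtype.val_injective
    rw [hd, hM] at h1
    exact (Nat.pow_le_pow_iff_right (one_lt_resCard O)).1 h1
  have h1 : ∑ i ∈ Finset.range (n + 1), (-1 : k) ^ i * (resCard O : k) ^ (i * (i - 1) / 2) *
      Nat.card {A : Submodule O M // cls O A = resCls O i} =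
      ∑ i ∈ Finset.range (d + 1), (-1 : k) ^ i * (resCard O : k) ^ (i * (i - 1) / 2) *
      Nat.card {A : Submodule O M // cls O A = resCls O i} := by
    symm
    refine Finset.sum_subset (Finset.range_mono (by omega)) fun i _ hi => ?_
    rw [card_submodule_resCls_of_lt M hd (by simpa using hi), Nat.cast_zero, mul_zero]
  have h2 := sum_qBinomial (resCard_pow_sub_one_ne_zero (O := O) k) hd0
  rw [h1, ← mul_zero (qFactorial (resCard O : k) d), ← h2, Finset.mul_sum]
  refine Finset.sum_congr rfl fun i hi => ?_
  rw [cast_card_submodule_resCls k M hd (Nat.lt_succ_iff.1 (Finset.mem_range.1 hi))]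
  ring

end Subspaces

/-! ### The comultiplication as an algebra homomorphism -/

section Comultiplication

variable {k : Type v} [Field k] {O : Type u} [CommRing O] [IsDomain O]
  [IsDiscreteValuationRing O] [Finite (ResidueField O)] [CharZero k]

variable (k O) in
theorem allElt_one : allElt k O 1 = 1 := by
  classical
  ext c
  rw [allElt_apply, Hall.one_apply]
  refine if_congr ?_ rfl rfl
  rw [Nat.card_eq_one_iff_unique]
  exact ⟨fun h => h.1, fun h => ⟨h, ⟨0⟩⟩⟩

/-- The analogue of `E(-t) H(t) = 1` for symmetric functions: at a class of length `n` the
coefficient is the alternating sum of `alternating_sum_subspaces`. It expresses each `b_n` through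
the elements `allElt`. -/
theorem sum_bElt_mul_allElt {n : ℕ} (hn : n ≠ 0) :
    ∑ i ∈ Finset.range (n + 1),
      (-1 : k) ^ i • (bElt k O i * allElt k O (resCard O ^ (n - i))) = 0 := by
  classical
  ext c
  rw [hall_sum_apply, Hall.zero_apply]
  have h1 : ∀ i ∈ Finset.range (n + 1),
      ((-1 : k) ^ i • (bElt k O i * allElt k O (resCard O ^ (n - i)))) c =
      if Nat.card c.rep = resCard O ^ n then
        (-1 : k) ^ i * (resCard O : k) ^ (i * (i - 1) / 2) *
          Nat.card {A : Submodule O c.rep // cls O A = resCls O i} else 0 := by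
    intro i hi
    have hin : i ≤ n := Nat.lt_succ_iff.1 (Finset.mem_range.1 hi)
    have hpow : resCard O ^ n = resCard O ^ i * resCard O ^ (n - i) := by
      rw [← pow_add, Nat.add_sub_cancel' hin]
    rw [bElt_eq, smul_mul_assoc, Hall.smul_apply, Hall.smul_apply, ← mul_assoc, Hall.mul_apply,
      conv]
    have h2 : ∀ A : Submodule O c.rep,
        ind k O (resCls O i) (cls O A) * allElt k O (resCard O ^ (n - i)) (cls O (c.rep ⧸ A)) =
        if Nat.card c.rep = resCard O ^ n ∧ cls O A = resCls O i then 1 else 0 := by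
      intro A
      rw [ind_apply, allElt_apply, card_rep_cls]
      by_cases hA : cls O A = resCls O i
      · have h3 := (cls_eq_resCls_iff.1 hA).2
        have h4 := Submodule.card_eq_card_quotient_mul_card A
        rw [h3] at h4
        rw [if_pos hA.symm, one_mul]
        refine if_congr ?_ rfl rfl
        rw [h4, hpow]
        exact ⟨fun h => ⟨by rw [h], hA⟩,
          fun h => Nat.eq_of_mul_eq_mul_left (pow_pos (resCard_pos O) i) h.1⟩
      · rw [if_neg (Ne.symm hA), zero_mul, if_neg fun h => hA h.2]
    rw [Finset.sum_congr rfl fun A _ => h2 A]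
    split_ifs with h
    · congr 1
      simp only [h, true_and]
      rw [Nat.card_eq_fintype_card, Fintype.card_subtype, Finset.sum_boole]
    · simp [h]
  rw [Finset.sum_congr rfl h1]
  split_ifs with h
  · have : Nontrivial c.rep := by
      rw [← Finite.one_lt_card_iff_nontrivial, h]
      exact Nat.one_lt_pow hn (one_lt_resCard O)
    exact alternating_sum_subspaces k c.rep h
  · simp

theorem bElt_mem_adjoin_allElt (n : ℕ) :
    bElt k O n ∈ Algebra.adjoin k (Set.range (allElt k O)) := by
  induction n using Nat.strong_induction_on with
  | _ n ih =>
    rcases eq_or_ne n 0 with rfl | hn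
    · rw [bElt_zero]; exact one_mem _
    · have h := sum_bElt_mul_allElt (k := k) (O := O) hn
      rw [Finset.sum_range_succ, Nat.sub_self, pow_zero, allElt_one, mul_one] at h
      have h1 : (-1 : k) ^ n • bElt k O n ∈ Algebra.adjoin k (Set.range (allElt k O)) := by
        rw [eq_neg_of_add_eq_zero_right h]
        refine neg_mem (sum_mem fun i hi => Subalgebra.smul_mem _ (mul_mem
          (ih i (Finset.mem_range.1 hi)) (Algebra.subset_adjoin ⟨_, rfl⟩)) _)
      have h2 := Subalgebra.smul_mem _ h1 ((-1 : k) ^ n)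
      rwa [smul_smul, ← mul_pow, neg_one_mul, neg_neg, one_pow, one_smul] at h2

variable (k O) in
theorem adjoin_allElt : Algebra.adjoin k (Set.range (allElt k O)) = ⊤ := by
  rw [eq_top_iff, ← adjoin_bElt k O]
  refine Algebra.adjoin_le ?_
  rintro _ ⟨n, rfl⟩
  exact bElt_mem_adjoin_allElt n

variable (k O) in
theorem comul_one : comul k O 1 = 1 := by
  classical
  refine tensor_ext fun P Q => ?_
  rw [← allElt_one, tcoeff_comul_allElt, Algebra.TensorProduct.one_def, tcoeff_tmul, ← allElt_one,
    allElt_apply, allElt_apply]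
  by_cases hP : Nat.card P.rep = 1 <;> by_cases hQ : Nat.card Q.rep = 1 <;> simp [hP, hQ]

theorem comul_allElt_mul (N : ℕ) (g : Hall k O) :
    comul k O (allElt k O N * g) = comul k O (allElt k O N) * comul k O g := by
  have h : (comul k O).comp (LinearMap.mulLeft k (allElt k O N)) =
      (LinearMap.mulLeft k (comul k O (allElt k O N))).comp (comul k O) :=
    linearMap_ext_ind fun c => comul_allElt_mul_ind N c
  exact LinearMap.congr_fun h g

/-- The left factors `f` for which this holds with every `g` form a subalgebra containing the
generators `allElt N`. -/
theorem comul_mul (f g : Hall k O) : comul k O (f * g) = comul k O f * comul k O g := by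
  have hf : f ∈ Algebra.adjoin k (Set.range (allElt k O)) := by rw [adjoin_allElt]; trivial
  induction hf using Algebra.adjoin_induction generalizing g with
  | mem x hx =>
    obtain ⟨N, rfl⟩ := hx
    exact comul_allElt_mul N g
  | algebraMap r =>
    rw [Algebra.algebraMap_eq_smul_one, smul_mul_assoc, one_mul, map_smul, map_smul, comul_one,
      smul_mul_assoc, one_mul]
  | add x y _ _ hx hy => rw [add_mul, map_add, map_add, add_mul, hx, hy]
  | mul x y _ _ hx hy => rw [mul_assoc, hx, hy, hx, mul_assoc]

variable (k O) in
/-- The comultiplication as an algebra homomorphism. -/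
def comulHom : Hall k O →ₐ[k] Hall k O ⊗[k] Hall k O :=
  AlgHom.ofLinearMap (comul k O) (comul_one k O) comul_mul

/-! ### The comultiplication on the generators -/

theorem card_resCls_rep (n : ℕ) : Nat.card (resCls O n).rep = resCard O ^ n := by
  rw [resCls, card_rep_cls, card_residue_pow]

theorem resCls_injective : Function.Injective (resCls O) := by
  intro i j h
  have h1 := card_resCls_rep (O := O) i
  rw [h, card_resCls_rep] at h1
  exact (Nat.pow_right_injective (one_lt_resCard O) h1).symm

theorem hallNum_resCls_eq (n : ℕ) {P Q : IsoClass O} (h : hallNum P Q (resCls O n).rep ≠ 0) :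
    ∃ i ≤ n, P = resCls O i ∧ Q = resCls O (n - i) := by
  obtain ⟨⟨A, hP, hQ⟩⟩ := (Nat.card_ne_zero.1 h).1
  have h0 := cls_eq_resCls_iff.1 (cls_rep (resCls O n))
  obtain ⟨i, hi⟩ := exists_card_eq_pow (O := O) A
  obtain ⟨j, hj⟩ := exists_card_eq_pow (O := O) ((resCls O n).rep ⧸ A)
  have hij : n = i + j := by
    have := Submodule.card_eq_card_quotient_mul_card A
    rw [h0.2, hi, hj, ← pow_add] at this
    exact Nat.pow_right_injective (one_lt_resCard O) this
  refine ⟨i, by omega, ?_, ?_⟩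
  · rw [← hP]
    exact cls_eq_resCls_iff.2 ⟨fun x => Subtype.ext (h0.1 x), hi⟩
  · rw [← hQ, show n - i = j by omega]
    refine cls_eq_resCls_iff.2 ⟨fun x => ?_, hj⟩
    obtain ⟨x, rfl⟩ := A.mkQ_surjective x
    rw [← map_smul, h0.1, map_zero]

theorem hallNum_resCls_resCls {n i : ℕ} (hi : i ≤ n) :
    (hallNum (resCls O i) (resCls O (n - i)) (resCls O n).rep : k) =
      qFactorial (resCard O : k) n /
        (qFactorial (resCard O : k) i * qFactorial (resCard O : k) (n - i)) := by
  have h0 := cls_eq_resCls_iff.1 (cls_rep (resCls O n))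
  have hs : Nat.card (soc O (resCls O n).rep) = resCard O ^ n := by
    rw [← h0.2]
    refine Nat.card_congr (Equiv.subtypeUnivEquiv fun x => ?_)
    exact (Submodule.mem_torsionBy_iff _ _).2 (h0.1 x)
  rw [← cast_card_submodule_resCls k _ hs hi, hallNum]
  congr 1
  refine Nat.card_congr (Equiv.subtypeEquivRight fun A => ⟨fun h => h.1, fun h => ⟨h, ?_⟩⟩)
  refine cls_eq_resCls_iff.2 ⟨fun x => ?_, ?_⟩
  · obtain ⟨x, rfl⟩ := A.mkQ_surjective x
    rw [← map_smul, h0.1, map_zero]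
  · refine card_quotient_eq_iff A (a := resCard O ^ i) ?_ (cls_eq_resCls_iff.1 h).2
    rw [h0.2, ← pow_add, Nat.add_sub_cancel' hi]

/-- Since `|Aut κ^r|` is `q ^ (r (r - 1) / 2)` times a `q`-factorial and the Hall number is a
Gaussian binomial coefficient, the `q`-factorials cancel. The powers of `q` that remain are absorbed
by the normalisation of `b_r`. -/
theorem comul_bElt (n : ℕ) : comul k O (bElt k O n) =
    ∑ i ∈ Finset.range (n + 1), bElt k O i ⊗ₜ[k] bElt k O (n - i) := by
  classical
  refine tensor_ext fun P Q => ?_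
  have hb : ∀ i P, bElt k O i P = if P = resCls O i then (resCard O : k) ^ (i * (i - 1) / 2)
      else 0 := by
    intro i P
    rw [bElt_eq, Hall.smul_apply, ind_apply]
    by_cases h : P = resCls O i
    · rw [if_pos h, if_pos h.symm, mul_one]
    · rw [if_neg h, if_neg (Ne.symm h), mul_zero]
  rw [map_sum, bElt_eq, map_smul, map_smul, tcoeff_comul_ind, smul_eq_mul]
  simp only [tcoeff_tmul, hb]
  by_cases h : ∃ i ≤ n, P = resCls O i ∧ Q = resCls O (n - i)
  · obtain ⟨i, hi, rfl, rfl⟩ := h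
    rw [Finset.sum_eq_single_of_mem i (Finset.mem_range.2 (Nat.lt_succ_of_le hi))
      fun j _ hj => by rw [if_neg fun h => hj (resCls_injective h).symm, zero_mul],
      if_pos rfl, if_pos rfl, hallNum_resCls_resCls hi, cast_autCard_resCls,
      cast_autCard_resCls, cast_autCard_resCls]
    have h1 := qFactorial_ne_zero (resCard_pow_sub_one_ne_zero (O := O) k) i
    have h2 := qFactorial_ne_zero (resCard_pow_sub_one_ne_zero (O := O) k) (n - i)
    have h3 := qFactorial_ne_zero (resCard_pow_sub_one_ne_zero (O := O) k) n
    have h4 := resCard_cast_ne_zero k O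
    field_simp
  · have h0 : hallNum P Q (resCls O n).rep = 0 := by
      by_contra hne
      exact h (hallNum_resCls_eq n hne)
    rw [h0, Nat.cast_zero, zero_mul, mul_zero]
    refine (Finset.sum_eq_zero fun i hi => ?_).symm
    by_cases hP : P = resCls O i
    · rw [if_neg fun hQ => h ⟨i, Nat.lt_succ_iff.1 (Finset.mem_range.1 hi), hP, hQ⟩, mul_zero]
    · rw [if_neg hP, zero_mul]

end Comultiplication

end HallWitt

namespace HallWitt

open IsLocalRing

/-! ### Ghost components -/

section Newton

/-- The ghost components of a sequence, that is the coefficients of the negative of the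
logarithmic derivative of its generating series. -/
def newton {S : Type*} [Ring S] (b : ℕ → S) (n : ℕ) : S :=
  -((n + 1) • b (n + 1)) - ∑ i : Fin n, newton b i * b (n - i)
termination_by n

theorem newton_eq {S : Type*} [Ring S] (b : ℕ → S) (n : ℕ) :
    newton b n = -((n + 1) • b (n + 1)) - ∑ i ∈ Finset.range n, newton b i * b (n - i) := by
  rw [newton, Finset.sum_range]

theorem map_newton {S T F : Type*} [Ring S] [Ring T] [FunLike F S T] [RingHomClass F S T] (φ : F)
    (b : ℕ → S) (n : ℕ) : φ (newton b n) = newton (fun r => φ (b r)) n := by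
  induction n using Nat.strong_induction_on with
  | _ n ih =>
    rw [newton_eq, newton_eq, map_sub, map_neg, map_nsmul, map_sum]
    congr 1
    refine Finset.sum_congr rfl fun i hi => ?_
    rw [map_mul, ih i (Finset.mem_range.1 hi)]

theorem sum_newton_mul {S : Type*} [Ring S] {b : ℕ → S} (hb : b 0 = 1) (n : ℕ) :
    ∑ i ∈ Finset.range (n + 1), newton b i * b (n - i) = -((n + 1) • b (n + 1)) := by
  rw [Finset.sum_range_succ, Nat.sub_self, hb, mul_one, newton_eq b n]
  abel

variable {R : Type*} [CommRing R]

open PowerSeries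

/-- The negative of the logarithmic derivative. -/
def ghost (f : R⟦X⟧) : R⟦X⟧ := PowerSeries.mk (newton fun n => coeff n f)

theorem ghost_mul_self {f : R⟦X⟧} (hf : constantCoeff f = 1) :
    ghost f * f = -derivative R f := by
  ext n
  rw [coeff_mul, Finset.Nat.sum_antidiagonal_eq_sum_range_succ
    (fun i j => coeff i (ghost f) * coeff j f)]
  have h := sum_newton_mul (b := fun n => coeff n f) (by simpa using hf) n
  simp only [ghost, coeff_mk, h, map_neg, coeff_derivative, nsmul_eq_mul]
  push_cast
  ring

theorem isUnit_of_constantCoeff {f : R⟦X⟧} (hf : constantCoeff f = 1) : IsUnit f :=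
  isUnit_iff_constantCoeff.2 (by rw [hf]; exact isUnit_one)

theorem ghost_eq_of_mul {f g : R⟦X⟧} (hf : constantCoeff f = 1) (h : g * f = -derivative R f) :
    ghost f = g :=
  (isUnit_of_constantCoeff hf).mul_right_cancel ((ghost_mul_self hf).trans h.symm)

theorem ghost_mul {f g : R⟦X⟧} (hf : constantCoeff f = 1) (hg : constantCoeff g = 1) :
    ghost (f * g) = ghost f + ghost g := by
  refine ghost_eq_of_mul (by rw [map_mul, hf, hg, one_mul]) ?_
  rw [Derivation.leibniz, smul_eq_mul, smul_eq_mul, neg_add, ← mul_neg, ← mul_neg,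
    ← ghost_mul_self hf, ← ghost_mul_self hg]
  ring

theorem ghost_one : ghost (1 : R⟦X⟧) = 0 :=
  ghost_eq_of_mul (map_one _) (by rw [Derivation.map_one_eq_zero, neg_zero, zero_mul])

theorem constantCoeff_one_sub (a : R) : constantCoeff (1 - C a * X : R⟦X⟧) = 1 := by
  simp

/-- The sign in `newton` is chosen for this formula. The indexing is shifted: the `n`-th ghost
component corresponds to the power sum of degree `n + 1`. -/
theorem ghost_one_sub (a : R) :
    ghost (1 - C a * X : R⟦X⟧) = PowerSeries.mk fun n => a ^ (n + 1) := by
  refine ghost_eq_of_mul (constantCoeff_one_sub a) ?_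
  ext n
  rw [mul_sub, mul_one, map_sub, mul_left_comm, coeff_C_mul, map_neg, 
    coeff_derivative, map_sub, coeff_C_mul]
  cases n with
  | zero => simp
  | succ n =>
    rw [coeff_succ_mul_X, coeff_mk, coeff_mk, coeff_one, coeff_X, if_neg (by omega),
      if_neg (by omega)]
    ring

theorem constantCoeff_prod {ι : Type*} (s : Finset ι) (f : ι → R⟦X⟧)
    (hf : ∀ i, constantCoeff (f i) = 1) : constantCoeff (∏ i ∈ s, f i) = 1 := by
  rw [map_prod]
  exact Finset.prod_eq_one fun i _ => hf i

theorem ghost_prod {ι : Type*} (s : Finset ι) (f : ι → R⟦X⟧)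
    (hf : ∀ i, constantCoeff (f i) = 1) : ghost (∏ i ∈ s, f i) = ∑ i ∈ s, ghost (f i) := by
  classical
  induction s using Finset.induction_on with
  | empty => rw [Finset.prod_empty, Finset.sum_empty, ghost_one]
  | insert a s ha ih =>
    rw [Finset.prod_insert ha, Finset.sum_insert ha, ghost_mul (hf a) (constantCoeff_prod s f hf),
      ih]

theorem nsmul_succ_injective (k : Type*) [Field k] [CharZero k] [Algebra k R] {x y : R} {n : ℕ}
    (h : (n + 1) • x = (n + 1) • y) : x = y := by
  have h1 : ((n + 1 : ℕ) : k) • x = ((n + 1 : ℕ) : k) • y := by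
    rw [Nat.cast_smul_eq_nsmul, Nat.cast_smul_eq_nsmul, h]
  have hn : ((n + 1 : ℕ) : k) ≠ 0 := Nat.cast_ne_zero.2 n.succ_ne_zero
  rw [← inv_smul_smul₀ hn x, h1, inv_smul_smul₀ hn y]

/-- Newton's identity gives `n + 1` times the coefficient of degree `n + 1` in terms of ghost
components and lower coefficients, and `n + 1` is invertible. -/
theorem eq_of_ghost_eq (k : Type*) [Field k] [CharZero k] [Algebra k R] {f g : R⟦X⟧}
    (hf : constantCoeff f = 1) (hg : constantCoeff g = 1) (h : ghost f = ghost g) : f = g := by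
  have hfg : ∀ n, newton (fun n => coeff n f) n = newton (fun n => coeff n g) n := fun n => by
    simpa [ghost] using congrArg (coeff n) h
  have h0f : coeff 0 f = 1 := by simpa using hf
  have h0g : coeff 0 g = 1 := by simpa using hg
  have H : ∀ n, coeff n f = coeff n g := by
    intro n
    induction n using Nat.strong_induction_on with
    | _ n ih =>
      cases n with
      | zero => rw [h0f, h0g]
      | succ n =>
        refine nsmul_succ_injective k (n := n) (neg_injective ?_)
        have e1 := sum_newton_mul (b := fun n => coeff n f) h0f n
        have e2 := sum_newton_mul (b := fun n => coeff n g) h0g n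
        rw [← e1, ← e2]
        exact Finset.sum_congr rfl fun i _ => by rw [hfg, ih (n - i) (by omega)]
  exact PowerSeries.ext H

variable (k : Type*) [Field k] [CharZero k] [Algebra k R]

/-- The sequence with prescribed ghost components. -/
def unghost (c : ℕ → R) : ℕ → R
  | 0 => 1
  | n + 1 => -(((n + 1 : ℕ) : k)⁻¹ • ∑ i : Fin (n + 1), c i * unghost c (n - i))

theorem newton_unghost (c : ℕ → R) (n : ℕ) : newton (unghost k c) n = c n := by
  have h0 : constantCoeff (PowerSeries.mk (unghost k c)) = 1 := by
    rw [← coeff_zero_eq_constantCoeff_apply, coeff_mk, unghost]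
  have h : ghost (PowerSeries.mk (unghost k c)) = PowerSeries.mk c := by
    refine ghost_eq_of_mul h0 ?_
    ext n
    have hn : ((n + 1 : ℕ) : k) ≠ 0 := Nat.cast_ne_zero.2 n.succ_ne_zero
    have h1 : ((n + 1 : ℕ) : R) = algebraMap k R ((n + 1 : ℕ) : k) := by rw [map_natCast]
    rw [coeff_mul, Finset.Nat.sum_antidiagonal_eq_sum_range_succ
      (fun i j => coeff i (PowerSeries.mk c) * coeff j (PowerSeries.mk (unghost k c))), map_neg,
      coeff_derivative, coeff_mk, unghost, ← Nat.cast_succ, Nat.succ_eq_add_one,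
      h1, mul_comm, ← Algebra.smul_def, smul_neg, smul_smul, mul_inv_cancel₀ hn, one_smul, neg_neg,
      Finset.sum_range]
    simp only [coeff_mk]
  simpa [ghost] using congrArg (coeff n) h

end Newton

/-! ### Ghost coordinates on the Hall algebra -/

section GhostElements

variable {k : Type v} [Field k] {O : Type u} [CommRing O] [IsDomain O]
  [IsDiscreteValuationRing O] [Finite (ResidueField O)]

variable (k O) in
/-- The ghost elements of the Hall algebra. -/
def ghElt (n : ℕ) : Hall k O := newton (bElt k O) n

theorem map_ghElt {S : Type*} [Ring S] [Algebra k S] (χ : Hall k O →ₐ[k] S) (n : ℕ) :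
    χ (ghElt k O n) = newton (fun r => χ (bElt k O r)) n :=
  map_newton (S := Hall k O) (T := S) χ (bElt k O) n

theorem coeff_ghost_bSeries {R : Type w} [CommRing R] [Algebra k R] (χ : Pts k O R) (n : ℕ) :
    PowerSeries.coeff n (ghost (bSeries χ).1) = χ (ghElt k O n) := by
  rw [map_ghElt χ n, ghost, PowerSeries.coeff_mk]
  refine congrArg (fun b => newton b n) (funext fun r => ?_)
  exact PowerSeries.coeff_mk r fun r => χ (bElt k O r)

variable [CharZero k]

variable (k O) in
theorem adjoin_ghElt : Algebra.adjoin k (Set.range (ghElt k O)) = ⊤ := by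
  rw [eq_top_iff, ← adjoin_bElt k O]
  refine Algebra.adjoin_le ?_
  rintro _ ⟨n, rfl⟩
  rw [SetLike.mem_coe]
  induction n using Nat.strong_induction_on with
  | _ n ih =>
    cases n with
    | zero => rw [bElt_zero]; exact one_mem _
    | succ n =>
      have h := sum_newton_mul (bElt_zero k O) n
      have h1 : (n + 1) • bElt k O (n + 1) ∈ Algebra.adjoin k (Set.range (ghElt k O)) := by
        rw [← neg_neg ((n + 1) • bElt k O (n + 1)), ← h]
        exact neg_mem (sum_mem fun i _ => mul_mem (Algebra.subset_adjoin ⟨i, rfl⟩)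
          (ih (n - i) (by omega)))
      have hn : ((n + 1 : ℕ) : k) ≠ 0 := Nat.cast_ne_zero.2 n.succ_ne_zero
      have h2 := Subalgebra.smul_mem _ h1 ((n + 1 : ℕ) : k)⁻¹
      rwa [← Nat.cast_smul_eq_nsmul k, smul_smul, inv_mul_cancel₀ hn, one_smul] at h2

theorem hall_algHom_ext_ghost {S : Type*} [Semiring S] [Algebra k S] {f g : Hall k O →ₐ[k] S}
    (h : ∀ n, f (ghElt k O n) = g (ghElt k O n)) : f = g :=
  AlgHom.ext_of_adjoin_eq_top (adjoin_ghElt k O) (by rintro _ ⟨r, rfl⟩; exact h r)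

theorem exists_hall_algHom_ghost {S : Type*} [CommRing S] [Algebra k S] (c : ℕ → S) :
    ∃ f : Hall k O →ₐ[k] S, ∀ n, f (ghElt k O n) = c n := by
  obtain ⟨f, hf⟩ := exists_hall_algHom (k := k) (O := O) fun r => unghost k c (r + 1)
  refine ⟨f, fun n => ?_⟩
  rw [map_ghElt, ← newton_unghost k c n]
  congr 1
  funext r
  cases r with
  | zero => rw [bElt_zero, map_one, unghost]
  | succ r => exact hf r

theorem tensor_mul_comm (z w : Hall k O ⊗[k] Hall k O) : z * w = w * z := by
  induction z using TensorProduct.induction_on with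
  | zero => rw [zero_mul, mul_zero]
  | add z z' hz hz' => rw [add_mul, mul_add, hz, hz']
  | tmul f g =>
    induction w using TensorProduct.induction_on with
    | zero => rw [zero_mul, mul_zero]
    | add w w' hw hw' => rw [add_mul, mul_add, hw, hw']
    | tmul f' g' =>
      rw [Algebra.TensorProduct.tmul_mul_tmul, Algebra.TensorProduct.tmul_mul_tmul,
        hall_mul_comm f, hall_mul_comm g]

variable (k O) in
/-- The tensor square of the Hall algebra as a commutative ring. -/
@[reducible] def tensorCommRing : CommRing (Hall k O ⊗[k] Hall k O) :=
  { (inferInstance : Ring (Hall k O ⊗[k] Hall k O)) with mul_comm := tensor_mul_comm }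

theorem exists_tensor_algHom (c : ℕ → Hall k O ⊗[k] Hall k O) :
    ∃ f : Hall k O →ₐ[k] Hall k O ⊗[k] Hall k O, ∀ r, f (bElt k O (r + 1)) = c r :=
  @exists_hall_algHom k _ O _ _ _ _ _ _ (tensorCommRing k O) _ c

theorem exists_tensor_algHom_ghost (c : ℕ → Hall k O ⊗[k] Hall k O) :
    ∃ f : Hall k O →ₐ[k] Hall k O ⊗[k] Hall k O, ∀ n, f (ghElt k O n) = c n :=
  @exists_hall_algHom_ghost k _ O _ _ _ _ _ _ (tensorCommRing k O) _ c

end GhostElements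

end HallWitt

namespace HallWitt

open IsLocalRing

variable {k : Type v} [Field k] {O : Type u} [CommRing O] [IsDomain O]
  [IsDiscreteValuationRing O] [Finite (ResidueField O)]

/-! ### Cyclic modules -/

section Cyclic

variable (O) in
/-- The submodule of the cyclic module of length `n` generated by the `j`-th power of the
uniformizer. -/
def cycSub (n j : ℕ) : Submodule O (Cyc O n) :=
  Submodule.map (Submodule.mkQ (Ideal.span {unif O ^ n})) (Ideal.span {unif O ^ j})

theorem span_unif_pow_le {n j : ℕ} (h : j ≤ n) :
    Ideal.span {unif O ^ n} ≤ Ideal.span {unif O ^ j} :=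
  Ideal.span_singleton_le_span_singleton.2 (pow_dvd_pow _ h)

theorem nonempty_quotient_cycSub_equiv {n j : ℕ} (h : j ≤ n) :
    Nonempty ((Cyc O n ⧸ cycSub O n j) ≃ₗ[O] Cyc O j) :=
  ⟨Submodule.quotientQuotientEquivQuotient _ _ (span_unif_pow_le h)⟩

theorem nonempty_cycSub_equiv {n j : ℕ} (h : j ≤ n) :
    Nonempty (cycSub O n j ≃ₗ[O] Cyc O (n - j)) := by
  let φ : O →ₗ[O] Cyc O n :=
    (Submodule.mkQ (Ideal.span {unif O ^ n})).comp (LinearMap.mulLeft O (unif O ^ j))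
  have hk : LinearMap.ker φ = Ideal.span {unif O ^ (n - j)} := by
    ext a
    change (Ideal.Quotient.mk _ (unif O ^ j * a) : Cyc O n) = 0 ↔ _
    rw [cyc_mk_eq_zero, Ideal.mem_span_singleton]
    conv_lhs => rw [← Nat.add_sub_cancel' h, pow_add]
    rw [mul_dvd_mul_iff_left (pow_ne_zero _ (unif_ne_zero O))]
  have hr : LinearMap.range φ = cycSub O n j := by
    rw [LinearMap.range_comp, cycSub]
    congr 1
    ext a
    rw [Ideal.mem_span_singleton, LinearMap.mem_range]
    exact exists_congr fun b => eq_comm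
  exact ⟨(LinearEquiv.ofEq _ _ hr.symm).trans
    (φ.quotKerEquivRange.symm.trans (Submodule.quotEquivOfEq _ _ hk))⟩

theorem cls_cyc_injective : Function.Injective fun n => cls O (Cyc O n) := by
  intro m n h
  obtain ⟨e⟩ := cls_eq_iff.1 h
  have := Nat.card_congr e.toEquiv
  rw [card_cyc, card_cyc] at this
  exact Nat.pow_right_injective (one_lt_resCard O) this

theorem exists_eq_cycSub {n : ℕ} (A : Submodule O (Cyc O n)) : ∃ j ≤ n, A = cycSub O n j := by
  let I : Ideal O := A.comap (Submodule.mkQ (Ideal.span {unif O ^ n}))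
  have hn : unif O ^ n ∈ I := by
    change (Ideal.Quotient.mk _ (unif O ^ n) : Cyc O n) ∈ A
    rw [cyc_mk_eq_zero.2 dvd_rfl]
    exact A.zero_mem
  have hI : I ≠ ⊥ := fun h => pow_ne_zero n (unif_ne_zero O) (by simpa [h] using hn)
  obtain ⟨j, hj⟩ := IsDiscreteValuationRing.ideal_eq_span_pow_irreducible hI (irreducible_unif O)
  refine ⟨j, ?_, ?_⟩
  · rw [hj, Ideal.mem_span_singleton] at hn
    exact (pow_dvd_pow_iff (unif_ne_zero O) (irreducible_unif O).not_isUnit).1 hn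
  · rw [cycSub, ← hj, Submodule.map_comap_eq_of_surjective (Submodule.mkQ_surjective _)]

/-- Cyclic modules are uniserial: the chain `cycSub O n j` lists each submodule once, with cyclic
submodule and cyclic quotient. -/
theorem sum_submodule_cyc {M : Type*} [AddCommMonoid M] (n : ℕ)
    (G : IsoClass O → IsoClass O → M) :
    ∑ A : Submodule O (Cyc O n), G (cls O A) (cls O (Cyc O n ⧸ A)) =
      ∑ j ∈ Finset.range (n + 1), G (cls O (Cyc O (n - j))) (cls O (Cyc O j)) := by
  symm
  refine Finset.sum_bij (fun j _ => cycSub O n j) (fun _ _ => Finset.mem_univ _) ?_ ?_ ?_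
  · intro i hi j hj h
    obtain ⟨e⟩ := nonempty_quotient_cycSub_equiv (O := O) (Finset.mem_range_succ_iff.1 hi)
    obtain ⟨f⟩ := nonempty_quotient_cycSub_equiv (O := O) (Finset.mem_range_succ_iff.1 hj)
    refine cls_cyc_injective (O := O) ?_
    exact cls_eq (e.symm.trans ((Submodule.quotEquivOfEq _ _ h).trans f))
  · intro A _
    obtain ⟨j, hj, rfl⟩ := exists_eq_cycSub A
    exact ⟨j, Finset.mem_range_succ_iff.2 hj, rfl⟩
  · intro j hj
    obtain ⟨e⟩ := nonempty_quotient_cycSub_equiv (O := O) (Finset.mem_range_succ_iff.1 hj)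
    obtain ⟨f⟩ := nonempty_cycSub_equiv (O := O) (Finset.mem_range_succ_iff.1 hj)
    rw [cls_eq e, cls_eq f]

theorem card_cycSub {n j : ℕ} (h : j ≤ n) : Nat.card (cycSub O n j) = resCard O ^ (n - j) := by
  obtain ⟨f⟩ := nonempty_cycSub_equiv (O := O) h
  rw [Nat.card_congr f.toEquiv, card_cyc]

theorem span_singleton_cyc_eq_top_iff (n : ℕ) (x : Cyc O (n + 1)) :
    Submodule.span O {x} = ⊤ ↔ x ∉ cycSub O (n + 1) 1 := by
  have h1 : cycSub O (n + 1) 1 ≠ ⊤ := by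
    intro h
    have h2 := card_cycSub (O := O) (show 1 ≤ n + 1 by omega)
    rw [h, Nat.card_congr Submodule.topEquiv.toEquiv, card_cyc] at h2
    have := Nat.pow_right_injective (one_lt_resCard O) h2
    omega
  constructor
  · intro h hx
    exact h1 (top_le_iff.1 (h ▸ (Submodule.span_singleton_le_iff_mem _ _).2 hx))
  · intro hx
    obtain ⟨j, hj, h⟩ := exists_eq_cycSub (Submodule.span O {x})
    cases j with
    | zero =>
      rw [h, cycSub, pow_zero, Ideal.span_singleton_one, Submodule.map_top, Submodule.range_mkQ]
    | succ j =>
      refine absurd ?_ hx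
      have hle : cycSub O (n + 1) (j + 1) ≤ cycSub O (n + 1) 1 :=
        Submodule.map_mono (span_unif_pow_le (by omega))
      exact hle (h ▸ Submodule.mem_span_singleton_self x)

/-- Automorphisms correspond to generators, which are the elements outside the unique maximal
submodule `cycSub O (n + 1) 1`. The additive form avoids truncated subtraction. -/
theorem autCard_cyc (n : ℕ) :
    autCard (cls O (Cyc O (n + 1))) + resCard O ^ n = resCard O ^ (n + 1) := by
  have h1 := surjCard_of_card_eq (O := O) (M := Cyc O (n + 1)) (N := Cyc O (n + 1)) rfl
  rw [if_pos rfl, surjCard_quotient] at h1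
  have h2 : Nat.card {f : O →ₗ[O] Cyc O (n + 1) //
      Ideal.span {unif O ^ (n + 1)} ≤ LinearMap.ker f ∧ Function.Surjective f} =
      Nat.card {x : Cyc O (n + 1) // x ∉ cycSub O (n + 1) 1} := by
    refine Nat.card_congr (Equiv.subtypeEquiv (LinearMap.ringLmapEquivSelf O O _).toEquiv ?_)
    intro f
    have hf : ∀ a, f a = a • f 1 := fun a => by rw [← map_smul, smul_eq_mul, mul_one]
    have hx : ∀ x : Cyc O (n + 1), unif O ^ (n + 1) • x = 0 := by
      intro x
      obtain ⟨a, rfl⟩ := Ideal.Quotient.mk_surjective x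
      change (Ideal.Quotient.mk _ (unif O ^ (n + 1) * a) : Cyc O (n + 1)) = 0
      exact cyc_mk_eq_zero.2 (Dvd.intro _ rfl)
    have hr : LinearMap.range f = Submodule.span O {f 1} := by
      ext y
      rw [Submodule.mem_span_singleton, LinearMap.mem_range]
      exact exists_congr fun a => by rw [hf a]
    change _ ↔ f 1 ∉ _
    rw [← span_singleton_cyc_eq_top_iff, ← hr, LinearMap.range_eq_top, and_iff_right]
    rw [Ideal.span_le, Set.singleton_subset_iff, SetLike.mem_coe, LinearMap.mem_ker, hf, hx]
  have h3 := card_cycSub (O := O) (show 1 ≤ n + 1 by omega)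
  rw [Nat.add_sub_cancel] at h3
  rw [← h1, h2, ← h3, ← card_cyc (O := O) (n + 1), add_comm]
  have := Fintype.ofFinite (Cyc O (n + 1))
  classical
  rw [← Nat.card_sum]
  exact Nat.card_congr (Equiv.sumCompl fun x => x ∈ cycSub O (n + 1) 1)

theorem autCard_cyc_zero : autCard (cls O (Cyc O 0)) = 1 := by
  have hs : Subsingleton (Cyc O 0) := by
    rw [← Finite.card_le_one_iff_subsingleton, card_cyc, pow_zero]
  rw [autCard_cls, Nat.card_eq_one_iff_unique]
  exact ⟨⟨fun e f => LinearEquiv.ext fun x => Subsingleton.elim _ _⟩, ⟨LinearEquiv.refl O _⟩⟩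

end Cyclic

/-! ### The points `1 - α t` -/

section LinePoint

variable (k O) in
/-- Restriction to cyclic modules. -/
def cycPoly (f : Hall k O) : Polynomial k :=
  ∑ n ∈ (Finsupp.comapDomain (fun n => cls O (Cyc O n)) f cls_cyc_injective.injOn).support,
    Polynomial.monomial n (f (cls O (Cyc O n)))

theorem coeff_cycPoly (f : Hall k O) (n : ℕ) :
    (cycPoly k O f).coeff n = f (cls O (Cyc O n)) := by
  rw [cycPoly, Polynomial.finsetSum_coeff]
  simp only [Polynomial.coeff_monomial]
  rw [Finset.sum_ite_eq', ite_eq_left_iff]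
  intro h
  exact (Finsupp.notMem_support_iff.1 h).symm

variable (k O) in
/-- Restriction to cyclic modules as an algebra homomorphism. -/
def cycHom : Hall k O →ₐ[k] Polynomial k :=
  AlgHom.ofLinearMap
    { toFun := cycPoly k O
      map_add' := fun f g => by
        ext n
        rw [Polynomial.coeff_add, coeff_cycPoly, coeff_cycPoly, coeff_cycPoly, Hall.add_apply]
      map_smul' := fun a f => by
        ext n
        rw [Polynomial.coeff_smul, coeff_cycPoly, coeff_cycPoly, Hall.smul_apply]
        rfl }
    (by
      classical
      ext n
      change (cycPoly k O 1).coeff n = _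
      rw [coeff_cycPoly, Hall.one_cls, Polynomial.coeff_one]
      refine if_congr ?_ rfl rfl
      rw [← Finite.card_le_one_iff_subsingleton, card_cyc]
      constructor
      · intro h
        by_contra hn
        exact absurd (Nat.one_lt_pow hn (one_lt_resCard O)) (by omega)
      · rintro rfl
        rw [pow_zero])
    (fun f g => by
      ext n
      change (cycPoly k O (f * g)).coeff n = (cycPoly k O f * cycPoly k O g).coeff n
      -- Submodules and quotients of a cyclic module are cyclic, one pair for each splitting of the
      -- length, so the Hall product restricts to multiplication of polynomials.
      rw [coeff_cycPoly, Hall.mul_apply, conv_rep_cls, conv,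
        sum_submodule_cyc n fun P Q => f P * g Q, mul_comm (cycPoly k O f), Polynomial.coeff_mul,
        Finset.Nat.sum_antidiagonal_eq_sum_range_succ
          (fun i j => (cycPoly k O g).coeff i * (cycPoly k O f).coeff j)]
      refine Finset.sum_congr rfl fun j _ => ?_
      rw [coeff_cycPoly, coeff_cycPoly, mul_comm])

theorem coeff_cycHom (f : Hall k O) (n : ℕ) :
    (cycHom k O f).coeff n = f (cls O (Cyc O n)) := coeff_cycPoly f n

theorem cycHom_ind_cyc (n : ℕ) : cycHom k O (ind k O (cls O (Cyc O n))) = Polynomial.X ^ n := by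
  classical
  ext m
  rw [coeff_cycHom, ind_apply, Polynomial.coeff_X_pow]
  exact if_congr ⟨fun h => cls_cyc_injective h.symm, fun h => by rw [h]⟩ rfl rfl

theorem cycHom_ind_of_ne {c : IsoClass O} (h : ∀ n, c ≠ cls O (Cyc O n)) :
    cycHom k O (ind k O c) = 0 := by
  ext m
  rw [coeff_cycHom, ind_apply, if_neg, Polynomial.coeff_zero]
  exact fun h' => h m h'

variable {R : Type w} [CommRing R] [Algebra k R]

variable (k O) in
/-- The point with series `1 - α t`. -/
def linePt (α : R) : Pts k O R := (Polynomial.aeval (-α)).comp (cycHom k O)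

theorem linePt_ind_cyc (α : R) (n : ℕ) :
    linePt k O α (ind k O (cls O (Cyc O n))) = (-α) ^ n := by
  rw [linePt, AlgHom.comp_apply, cycHom_ind_cyc, map_pow, Polynomial.aeval_X]

theorem linePt_ind_of_ne (α : R) {c : IsoClass O} (h : ∀ n, c ≠ cls O (Cyc O n)) :
    linePt k O α (ind k O c) = 0 := by
  rw [linePt, AlgHom.comp_apply, cycHom_ind_of_ne h, map_zero]

theorem cls_cyc_eq_resCls_iff {n r : ℕ} :
    cls O (Cyc O n) = resCls O r ↔ n = r ∧ r ≤ 1 := by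
  have hc : Nat.card (Cyc O n) = resCard O ^ r ↔ n = r := by
    rw [card_cyc]
    exact (Nat.pow_right_injective (one_lt_resCard O)).eq_iff
  rw [cls_eq_resCls_iff, hc, and_comm]
  refine and_congr_right ?_
  rintro rfl
  constructor
  · intro h
    have h1 : (Ideal.Quotient.mk _ (unif O ^ 1 * 1) : Cyc O n) = 0 := by
      rw [pow_one]
      exact h (Ideal.Quotient.mk _ 1)
    rw [cyc_mk_eq_zero, mul_one] at h1
    exact (pow_dvd_pow_iff (unif_ne_zero O) (irreducible_unif O).not_isUnit).1 h1
  · intro h x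
    obtain ⟨a, rfl⟩ := Ideal.Quotient.mk_surjective x
    change (Ideal.Quotient.mk _ (unif O * a) : Cyc O n) = 0
    rw [cyc_mk_eq_zero]
    exact ((pow_dvd_pow _ h).trans (pow_one _).dvd).mul_right a

theorem linePt_bElt (α : R) (r : ℕ) :
    linePt k O α (bElt k O r) = if r ≤ 1 then (-α) ^ r else 0 := by
  rw [bElt_eq, map_smul]
  split_ifs with h
  · rw [← cls_cyc_eq_resCls_iff.2 ⟨rfl, h⟩, linePt_ind_cyc]
    interval_cases r <;> simp
  · rw [linePt_ind_of_ne, smul_zero]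
    intro n hn
    exact h (cls_cyc_eq_resCls_iff.1 hn.symm).2

theorem bSeries_linePt (α : R) :
    (bSeries (linePt k O α)).1 = 1 - PowerSeries.C α * PowerSeries.X := by
  ext n
  change PowerSeries.coeff n (PowerSeries.mk fun r => linePt k O α (bElt k O r)) = _
  rw [PowerSeries.coeff_mk, linePt_bElt, map_sub, PowerSeries.coeff_C_mul]
  match n with
  | 0 => simp
  | 1 => simp [PowerSeries.coeff_one]
  | n + 2 => simp [PowerSeries.coeff_one, PowerSeries.coeff_X]

end LinePoint

end HallWitt

namespace HallWitt

open IsLocalRing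

variable {k : Type v} [Field k] {O : Type u} [CommRing O] [IsDomain O]
  [IsDiscreteValuationRing O] [Finite (ResidueField O)]

/-! ### Evaluating elements of the tensor square -/

section Pairing

variable {R : Type w} [CommRing R] [Algebra k R]

/-- Evaluation of an element of the tensor square at a pair of points. -/
def pairHom (χ χ' : Pts k O R) : Hall k O ⊗[k] Hall k O →ₐ[k] R :=
  Algebra.TensorProduct.lift χ χ' fun _ _ => Commute.all _ _

theorem pairHom_tmul (χ χ' : Pts k O R) (f g : Hall k O) :
    pairHom χ χ' (f ⊗ₜ[k] g) = χ f * χ' g :=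
  Algebra.TensorProduct.lift_tmul _ _ _ _ _

theorem op_apply (Φ : Hall k O →ₐ[k] Hall k O ⊗[k] Hall k O) (χ χ' : Pts k O R) (f : Hall k O) :
    op Φ χ χ' f = pairHom χ χ' (Φ f) := rfl

theorem coeff_bSeries (χ : Pts k O R) (n : ℕ) :
    PowerSeries.coeff n (bSeries χ).1 = χ (bElt k O n) :=
  PowerSeries.coeff_mk n fun r => χ (bElt k O r)

end Pairing

/-! ### Classes of given length -/

section Length

variable (O) in
/-- The isomorphism classes of length `n`. -/
def lengthCls (n : ℕ) : Finset (IsoClass O) := (finite_card_eq (resCard O ^ n)).toFinset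

theorem mem_lengthCls {n : ℕ} {c : IsoClass O} :
    c ∈ lengthCls O n ↔ Nat.card c.rep = resCard O ^ n :=
  (finite_card_eq (resCard O ^ n)).mem_toFinset

theorem resCard_pow_injective : Function.Injective fun n => resCard O ^ n :=
  Nat.pow_right_injective (one_lt_resCard O)

theorem lengthCls_zero : lengthCls O 0 = {cls O PUnit.{u + 1}} := by
  ext c
  rw [mem_lengthCls, pow_zero, Finset.mem_singleton]
  constructor
  · intro h
    have := Finite.card_le_one_iff_subsingleton.1 h.le
    rw [← cls_rep c]
    exact cls_eq (LinearEquiv.ofSubsingleton (R := O) c.rep PUnit.{u + 1})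
  · rintro rfl
    rw [card_rep_cls, Nat.card_unique]

theorem coeff_Psi (n : ℕ) : PowerSeries.coeff n (Psi k O) =
    ∑ c ∈ lengthCls O n, (autCard c : k) • (ind k O c ⊗ₜ[k] ind k O c) := by
  rw [Psi, PowerSeries.coeff_mk]
  have h : ∀ c : IsoClass O, Module.length O c.rep = n ↔ c ∈ lengthCls O n := fun c =>
    length_eq_iff_card.trans mem_lengthCls.symm
  simp only [h]
  exact finsum_mem_finset_eq_sum _ _

theorem coeff_zero_Psi : PowerSeries.coeff 0 (Psi k O) = 1 := by
  have h : autCard (cls O PUnit.{u + 1}) = 1 := by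
    rw [autCard_cls, Nat.card_eq_one_iff_unique]
    exact ⟨⟨fun e f => LinearEquiv.ext fun x => Subsingleton.elim _ _⟩, ⟨LinearEquiv.refl O _⟩⟩
  rw [coeff_Psi, lengthCls_zero, Finset.sum_singleton, h, Nat.cast_one, one_smul]
  rfl

theorem sum_submodule_eq {V : Type*} [AddCommGroup V] (C : Type u) [AddCommGroup C] [Module O C]
    [Finite C] {n : ℕ} (hC : Nat.card C = resCard O ^ n) (G : IsoClass O → IsoClass O → V) :
    ∑ A : Submodule O C, G (cls O A) (cls O (C ⧸ A)) =
      ∑ i ∈ Finset.range (n + 1), ∑ P ∈ lengthCls O i, ∑ Q ∈ lengthCls O (n - i),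
        hallNum P Q C • G P Q := by
  classical
  have h1 : ∀ P Q, hallNum P Q C • G P Q =
      ∑ A : Submodule O C, if cls O A = P ∧ cls O (C ⧸ A) = Q then G P Q else 0 := by
    intro P Q
    rw [← Finset.sum_filter, Finset.sum_const, hallNum, Nat.card_eq_fintype_card,
      Fintype.card_subtype]
  simp only [h1]
  simp only [Finset.sum_comm (s := lengthCls O _) (t := Finset.univ)]
  rw [Finset.sum_comm]
  refine Finset.sum_congr rfl fun A _ => ?_
  obtain ⟨i, hi⟩ := exists_card_eq_pow (O := O) A
  obtain ⟨j, hj⟩ := exists_card_eq_pow (O := O) (C ⧸ A)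
  have hij : j + i = n := by
    refine resCard_pow_injective (O := O) ?_
    change resCard O ^ (j + i) = resCard O ^ n
    rw [pow_add, ← hi, ← hj, ← hC, Submodule.card_eq_card_quotient_mul_card A,
      mul_comm]
  have hA : ∀ {m}, cls O A ∈ lengthCls O m ↔ i = m := by
    intro m
    rw [mem_lengthCls, card_rep_cls, hi]
    exact (resCard_pow_injective (O := O)).eq_iff
  have hB : ∀ {m}, cls O (C ⧸ A) ∈ lengthCls O m ↔ j = m := by
    intro m
    rw [mem_lengthCls, card_rep_cls, hj]
    exact (resCard_pow_injective (O := O)).eq_iff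
  rw [Finset.sum_eq_single i, Finset.sum_eq_single (cls O A),
    Finset.sum_eq_single (cls O (C ⧸ A)), if_pos ⟨rfl, rfl⟩]
  · exact fun Q _ hQ => if_neg fun h => hQ h.2.symm
  · exact fun h => absurd (hB.2 (by omega)) h
  · exact fun P _ hP => Finset.sum_eq_zero fun Q _ => if_neg fun h => hP h.1.symm
  · exact fun h => absurd (hA.2 rfl) h
  · intro m _ hm
    refine Finset.sum_eq_zero fun P hP => Finset.sum_eq_zero fun Q _ => if_neg fun h => ?_
    rw [← h.1, hA] at hP
    exact hm hP.symm
  · exact fun h => absurd (Finset.mem_range_succ_iff.2 (by omega)) h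

theorem ind_mul_ind [CharZero k] {i j n : ℕ} (hij : i + j = n) {P Q : IsoClass O}
    (hP : P ∈ lengthCls O i) (hQ : Q ∈ lengthCls O j) :
    ind k O P * ind k O Q = ∑ C ∈ lengthCls O n, hallNum P Q C.rep • ind k O C := by
  classical
  ext D
  rw [ind_mul_ind_apply, hall_sum_apply]
  simp only [← Nat.cast_smul_eq_nsmul k, Hall.smul_apply, ind_apply, mul_ite, mul_one, mul_zero]
  rw [Finset.sum_ite_eq', ite_eq_left_iff.2]
  intro h
  rw [eq_comm, Nat.cast_eq_zero]
  by_contra h0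
  rw [mem_lengthCls] at h hP hQ
  exact h (by rw [card_of_hallNum_ne_zero h0, hP, hQ, ← pow_add, hij])

end Length

variable [CharZero k]

/-! ### The comultiplication on points -/

section Add

variable {R : Type w} [CommRing R] [Algebra k R]

theorem op_comulHom_bElt (χ χ' : Pts k O R) (n : ℕ) : op (comulHom k O) χ χ' (bElt k O n) =
    ∑ i ∈ Finset.range (n + 1), χ (bElt k O i) * χ' (bElt k O (n - i)) := by
  rw [op_apply]
  change pairHom χ χ' (comul k O (bElt k O n)) = _
  rw [comul_bElt, map_sum]
  simp only [pairHom_tmul]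

theorem bSeries_op_comulHom (χ χ' : Pts k O R) :
    (bSeries (op (comulHom k O) χ χ')).1 = (bSeries χ).1 * (bSeries χ').1 := by
  ext n
  rw [coeff_bSeries, op_comulHom_bElt, PowerSeries.coeff_mul,
    Finset.Nat.sum_antidiagonal_eq_sum_range_succ
      (fun i j => PowerSeries.coeff i (bSeries χ).1 * PowerSeries.coeff j (bSeries χ').1)]
  simp only [coeff_bSeries]

end Add

/-! ### The pairing defined by `Psi` -/

section PsiPairing

variable (k O) in
theorem exists_psiHom : ∃ U : Hall k O →ₐ[k] Hall k O ⊗[k] Hall k O,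
    ∀ n, U (bElt k O n) = PowerSeries.coeff n (Psi k O) := by
  obtain ⟨U, hU⟩ := exists_tensor_algHom (k := k) (O := O)
    fun n => PowerSeries.coeff (n + 1) (Psi k O)
  refine ⟨U, fun n => ?_⟩
  cases n with
  | zero => rw [bElt_zero, map_one, coeff_zero_Psi]
  | succ n => exact hU n

variable (k O) in
/-- The morphism defined by `Psi`. -/
def psiHom : Hall k O →ₐ[k] Hall k O ⊗[k] Hall k O := (exists_psiHom k O).choose

theorem psiHom_bElt (n : ℕ) : psiHom k O (bElt k O n) = PowerSeries.coeff n (Psi k O) :=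
  (exists_psiHom k O).choose_spec n

variable {R : Type w} [CommRing R] [Algebra k R]

theorem op_psiHom_bElt (χ χ' : Pts k O R) (n : ℕ) : op (psiHom k O) χ χ' (bElt k O n) =
    ∑ c ∈ lengthCls O n, (autCard c : k) • (χ (ind k O c) * χ' (ind k O c)) := by
  rw [op_apply, psiHom_bElt, coeff_Psi, map_sum]
  simp only [map_smul, pairHom_tmul]

theorem op_psiHom_comm (χ χ' : Pts k O R) : op (psiHom k O) χ χ' = op (psiHom k O) χ' χ := by
  refine hall_algHom_ext fun n => ?_
  rw [op_psiHom_bElt, op_psiHom_bElt]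
  exact Finset.sum_congr rfl fun c _ => by rw [mul_comm (χ _)]

/-- The weight `|Aut c|` from `Psi` cancels the denominator of the comultiplication. What remains
are Hall numbers, the structure constants of the product. -/
theorem autCard_smul_op_comulHom_ind {n : ℕ} {c : IsoClass O} (hc : c ∈ lengthCls O n)
    (χ χ' : Pts k O R) : (autCard c : k) • op (comulHom k O) χ χ' (ind k O c) =
      ∑ i ∈ Finset.range (n + 1), ∑ P ∈ lengthCls O i, ∑ Q ∈ lengthCls O (n - i),
        hallNum P Q c.rep • (((autCard P : k) • χ (ind k O P)) *
          ((autCard Q : k) • χ' (ind k O Q))) := by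
  rw [op_apply]
  change (autCard c : k) • pairHom χ χ' (comul k O (ind k O c)) = _
  rw [comul_ind, map_sum, Finset.smul_sum, ← sum_submodule_eq c.rep (mem_lengthCls.1 hc)
    fun P Q => ((autCard P : k) • χ (ind k O P)) * ((autCard Q : k) • χ' (ind k O Q))]
  refine Finset.sum_congr rfl fun A _ => ?_
  rw [map_smul, pairHom_tmul, smul_smul, smul_mul_smul_comm,
    mul_div_cancel₀ _ (Nat.cast_ne_zero.2 (autCard_pos c).ne')]

/-- The comultiplication is dual to the product under the weights `|Aut F|`. Summing Hall numbers
times `1_c` over `c` rebuilds `1_P * 1_Q`, on which `χ''` is multiplicative, and the double sum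
factors. -/
theorem op_psiHom_add_left (χ χ' χ'' : Pts k O R) :
    op (psiHom k O) (op (comulHom k O) χ χ') χ'' =
      op (comulHom k O) (op (psiHom k O) χ χ'') (op (psiHom k O) χ' χ'') := by
  refine hall_algHom_ext fun n => ?_
  rw [op_psiHom_bElt, op_comulHom_bElt]
  have h1 : ∀ c ∈ lengthCls O n,
      (autCard c : k) • (op (comulHom k O) χ χ' (ind k O c) * χ'' (ind k O c)) =
      ∑ i ∈ Finset.range (n + 1), ∑ P ∈ lengthCls O i, ∑ Q ∈ lengthCls O (n - i),
        ((autCard P : k) • χ (ind k O P)) * ((autCard Q : k) • χ' (ind k O Q)) *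
          χ'' (hallNum P Q c.rep • ind k O c) := by
    intro c hc
    rw [← smul_mul_assoc, autCard_smul_op_comulHom_ind hc]
    simp only [Finset.sum_mul, map_nsmul, smul_mul_assoc, mul_smul_comm]
  rw [Finset.sum_congr rfl h1, Finset.sum_comm]
  refine Finset.sum_congr rfl fun i hi => ?_
  rw [Finset.sum_comm, op_psiHom_bElt, op_psiHom_bElt, Finset.sum_mul_sum]
  refine Finset.sum_congr rfl fun P hP => ?_
  rw [Finset.sum_comm]
  refine Finset.sum_congr rfl fun Q hQ => ?_
  rw [← Finset.mul_sum, ← map_sum, ← ind_mul_ind (by grind) hP hQ, map_mul,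
    ← smul_mul_assoc, ← smul_mul_assoc]
  ring

theorem op_psiHom_add_right (χ χ' χ'' : Pts k O R) :
    op (psiHom k O) χ (op (comulHom k O) χ' χ'') =
      op (comulHom k O) (op (psiHom k O) χ χ') (op (psiHom k O) χ χ'') := by
  rw [op_psiHom_comm, op_psiHom_add_left, op_psiHom_comm χ', op_psiHom_comm χ'']

end PsiPairing

end HallWitt

namespace HallWitt

open IsLocalRing

variable {k : Type v} [Field k] {O : Type u} [CommRing O] [IsDomain O]
  [IsDiscreteValuationRing O] [Finite (ResidueField O)] [CharZero k]

/-! ### Points and ghost components -/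

section GhostPoints

variable {R : Type w} [CommRing R] [Algebra k R]

theorem pts_eq_of_bSeries_eq {χ χ' : Pts k O R} (h : (bSeries χ).1 = (bSeries χ').1) : χ = χ' :=
  (bSeries_bijective R).1 (Subtype.ext h)

variable (k O) in
theorem exists_pts_bSeries_eq {f : PowerSeries R} (hf : PowerSeries.constantCoeff f = 1) :
    ∃ χ : Pts k O R, (bSeries χ).1 = f := by
  obtain ⟨χ, hχ⟩ := (bSeries_bijective (k := k) (O := O) R).2 ⟨f, hf⟩
  exact ⟨χ, congrArg Subtype.val hχ⟩

theorem op_comulHom_ghElt (χ χ' : Pts k O R) (n : ℕ) :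
    op (comulHom k O) χ χ' (ghElt k O n) = χ (ghElt k O n) + χ' (ghElt k O n) := by
  rw [← coeff_ghost_bSeries, bSeries_op_comulHom, ghost_mul (bSeries χ).2 (bSeries χ').2, map_add,
    coeff_ghost_bSeries, coeff_ghost_bSeries]

/-- A point is split if its series is a product of linear factors. -/
def IsSplit (χ : Pts k O R) : Prop :=
  ∃ (m : ℕ) (α : Fin m → R),
    (bSeries χ).1 = ∏ i, (1 - PowerSeries.C (α i) * PowerSeries.X)

theorem ghElt_of_bSeries_eq_prod {ι : Type*} [Fintype ι] {α : ι → R} {χ : Pts k O R}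
    (h : (bSeries χ).1 = ∏ i, (1 - PowerSeries.C (α i) * PowerSeries.X)) (n : ℕ) :
    χ (ghElt k O n) = ∑ i, α i ^ (n + 1) := by
  rw [← coeff_ghost_bSeries, h, ghost_prod _ _ fun i => constantCoeff_one_sub (α i), map_sum]
  exact Finset.sum_congr rfl fun i _ => by rw [ghost_one_sub, PowerSeries.coeff_mk]

theorem linePt_ghElt (α : R) (n : ℕ) : linePt k O α (ghElt k O n) = α ^ (n + 1) := by
  rw [← coeff_ghost_bSeries, bSeries_linePt, ghost_one_sub, PowerSeries.coeff_mk]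

/-- The ghost components of `(1 - b t) / (1 - a t)`, stated without inverses over an arbitrary ring.
-/
theorem coeff_ghost_of_mul_eq {f : PowerSeries R} (hf : PowerSeries.constantCoeff f = 1) {a b : R}
    (h : f * (1 - PowerSeries.C a * PowerSeries.X) = 1 - PowerSeries.C b * PowerSeries.X) (n : ℕ) :
    PowerSeries.coeff n (ghost f) = b ^ (n + 1) - a ^ (n + 1) := by
  have h1 := congrArg (PowerSeries.coeff n) (congrArg ghost h)
  rw [ghost_mul hf (constantCoeff_one_sub a), ghost_one_sub, ghost_one_sub, map_add,
    PowerSeries.coeff_mk, PowerSeries.coeff_mk] at h1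
  exact eq_sub_of_add_eq h1

end GhostPoints

/-! ### The Witt multiplication -/

section WittMul

variable (k O) in
-- Power sums of the products `α_i β_j` are products of power sums, which dictates the formula. It
-- defines a morphism because ghost components may be prescribed freely in characteristic `0`.
theorem exists_wittMul : ∃ Φ : Hall k O →ₐ[k] Hall k O ⊗[k] Hall k O,
    ∀ n, Φ (ghElt k O n) = ghElt k O n ⊗ₜ[k] ghElt k O n :=
  exists_tensor_algHom_ghost fun n => ghElt k O n ⊗ₜ[k] ghElt k O n

variable (k O) in
/-- The Witt multiplication. -/
def wittMul : Hall k O →ₐ[k] Hall k O ⊗[k] Hall k O := (exists_wittMul k O).choose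

theorem op_wittMul_ghElt {R : Type w} [CommRing R] [Algebra k R] (χ χ' : Pts k O R) (n : ℕ) :
    op (wittMul k O) χ χ' (ghElt k O n) = χ (ghElt k O n) * χ' (ghElt k O n) := by
  rw [op_apply, wittMul, (exists_wittMul k O).choose_spec, pairHom_tmul]

variable (k O) in
theorem isWittMul_wittMul : IsWittMul (wittMul k O) := by
  intro R _ _ m n α β χ χ' h h'
  have hc : ∀ i j, PowerSeries.constantCoeff
      (1 - PowerSeries.C (α i * β j) * PowerSeries.X : PowerSeries R) = 1 :=
    fun i j => constantCoeff_one_sub _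
  refine eq_of_ghost_eq k (bSeries _).2
    (constantCoeff_prod _ _ fun i => constantCoeff_prod _ _ (hc i)) ?_
  ext l
  rw [coeff_ghost_bSeries, op_wittMul_ghElt, ghElt_of_bSeries_eq_prod h,
    ghElt_of_bSeries_eq_prod h', ghost_prod _ _ fun i => constantCoeff_prod _ _ (hc i), map_sum,
    Finset.sum_mul_sum]
  refine Finset.sum_congr rfl fun i _ => ?_
  rw [ghost_prod _ _ (hc i), map_sum]
  refine Finset.sum_congr rfl fun j _ => ?_
  rw [ghost_one_sub, PowerSeries.coeff_mk, mul_pow]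

end WittMul

/-! ### The point `(1 - t) / (1 - q t)` -/

section Kappa

variable (k O) in
theorem exists_kappaPt : ∃ κ : Pts k O k,
    ∀ n, κ (ghElt k O n) = 1 - (resCard O : k) ^ (n + 1) :=
  exists_hall_algHom_ghost fun n => 1 - (resCard O : k) ^ (n + 1)

variable (k O) in
/-- The point with series `(1 - t) / (1 - q t)`. -/
def kappaPt : Pts k O k := (exists_kappaPt k O).choose

theorem kappaPt_ghElt (n : ℕ) : kappaPt k O (ghElt k O n) = 1 - (resCard O : k) ^ (n + 1) :=
  (exists_kappaPt k O).choose_spec n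

theorem kappaSeries_mul (q : ℕ) :
    kappaSeries q * (1 - PowerSeries.C (q : ℤ) * PowerSeries.X) = 1 - PowerSeries.X := by
  rw [kappaSeries, mul_assoc, mul_comm (PowerSeries.invOfUnit _ _), PowerSeries.mul_invOfUnit,
    mul_one]
  exact constantCoeff_one_sub _

variable (k O) in
theorem bSeries_kappaPt : (bSeries (kappaPt k O)).1 =
    PowerSeries.map (Int.castRingHom k) (kappaSeries (resCard O)) := by
  have h : PowerSeries.map (Int.castRingHom k) (kappaSeries (resCard O)) *
      (1 - PowerSeries.C (resCard O : k) * PowerSeries.X) =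
      1 - PowerSeries.C (1 : k) * PowerSeries.X := by
    have := congrArg (PowerSeries.map (Int.castRingHom k)) (kappaSeries_mul (resCard O))
    simpa using this
  have hc : PowerSeries.constantCoeff
      (PowerSeries.map (Int.castRingHom k) (kappaSeries (resCard O))) = 1 := by
    have := congrArg PowerSeries.constantCoeff h
    rwa [map_mul, constantCoeff_one_sub, constantCoeff_one_sub, mul_one] at this
  refine eq_of_ghost_eq k (bSeries _).2 hc ?_
  ext n
  rw [coeff_ghost_bSeries, kappaPt_ghElt, coeff_ghost_of_mul_eq hc h, one_pow]

end Kappa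

/-! ### The pairing of split points -/

section SplitPairing

variable {R : Type w} [CommRing R] [Algebra k R]

/-- Linear points vanish off cyclic modules, so one class of each length survives, and the two signs
`(-1) ^ n` cancel. -/
theorem op_psiHom_linePt_bElt (α β : R) (n : ℕ) :
    op (psiHom k O) (linePt k O α) (linePt k O β) (bElt k O n) =
      (autCard (cls O (Cyc O n)) : R) * (α * β) ^ n := by
  rw [op_psiHom_bElt, Finset.sum_eq_single (cls O (Cyc O n)), linePt_ind_cyc, linePt_ind_cyc,
    ← mul_pow, neg_mul_neg, Algebra.smul_def, map_natCast]
  · intro c hc hne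
    rw [linePt_ind_of_ne, zero_mul, smul_zero]
    rintro m rfl
    rw [mem_lengthCls, card_rep_cls, card_cyc] at hc
    exact hne (by rw [resCard_pow_injective (O := O) hc])
  · intro h
    exact absurd (mem_lengthCls.2 (by rw [card_rep_cls, card_cyc])) h

/-- The numbers `|Aut (O / π ^ n)|` are `1` for `n = 0` and `q ^ n - q ^ (n - 1)` afterwards, with
generating series `(1 - x) / (1 - q x)`. This is where the point `κ` originates. -/
theorem bSeries_op_psiHom_linePt (α β : R) :
    (bSeries (op (psiHom k O) (linePt k O α) (linePt k O β))).1 *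
      (1 - PowerSeries.C (resCard O * (α * β)) * PowerSeries.X) =
      1 - PowerSeries.C (α * β) * PowerSeries.X := by
  have ha : ∀ n, (autCard (cls O (Cyc O (n + 1))) : R) + (resCard O : R) ^ n =
      (resCard O : R) ^ (n + 1) := fun n => by
    exact_mod_cast congrArg Nat.cast (autCard_cyc (O := O) n)
  ext n
  rw [mul_sub, mul_one, map_sub, mul_left_comm, PowerSeries.coeff_C_mul, map_sub,
    PowerSeries.coeff_C_mul]
  cases n with
  | zero => simp [coeff_bSeries, bElt_zero]
  | succ n =>
    rw [PowerSeries.coeff_succ_mul_X, coeff_bSeries, coeff_bSeries, op_psiHom_linePt_bElt,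
      op_psiHom_linePt_bElt, eq_sub_of_add_eq (ha n), PowerSeries.coeff_one, PowerSeries.coeff_X,
      if_neg (by omega)]
    -- The coefficient of degree one involves length zero, where the automorphism count is `1` and
    -- the formula `q ^ n - q ^ (n - 1)` does not apply.
    cases n with
    | zero =>
      rw [autCard_cyc_zero, if_pos rfl]
      push_cast
      ring
    | succ n =>
      rw [eq_sub_of_add_eq (ha n), if_neg (by omega)]
      ring

/-- Compatibility of the pairing with ghost components at a pair of points. -/
def GhostPairing (χ χ' : Pts k O R) : Prop :=
  ∀ n, op (psiHom k O) χ χ' (ghElt k O n) =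
    (1 - (resCard O : R) ^ (n + 1)) * (χ (ghElt k O n) * χ' (ghElt k O n))

theorem ghostPairing_linePt (α β : R) :
    GhostPairing (k := k) (O := O) (linePt k O α) (linePt k O β) := by
  intro n
  rw [← coeff_ghost_bSeries, coeff_ghost_of_mul_eq (bSeries _).2 (bSeries_op_psiHom_linePt α β),
    linePt_ghElt, linePt_ghElt]
  ring

theorem GhostPairing.comm {χ χ' : Pts k O R} (h : GhostPairing χ χ') : GhostPairing χ' χ := by
  intro n
  rw [op_psiHom_comm, h n, mul_comm (χ _)]

theorem ghostPairing_of_isSplit {χ χ' : Pts k O R} (h : ∀ α, GhostPairing (linePt k O α) χ')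
    (hχ : IsSplit χ) : GhostPairing χ χ' := by
  obtain ⟨m, α, hα⟩ := hχ
  induction m generalizing χ with
  | zero =>
    rw [Fin.prod_univ_zero] at hα
    intro n
    -- The trivial point satisfies `χ ⊞ χ = χ`, so by additivity each ghost component of its pairing
    -- satisfies `x = x + x`.
    have h0 : op (comulHom k O) χ χ = χ :=
      pts_eq_of_bSeries_eq (by rw [bSeries_op_comulHom, hα, mul_one])
    have h1 := op_psiHom_add_left χ χ χ'
    rw [h0] at h1
    have h2 := op_comulHom_ghElt (op (psiHom k O) χ χ') (op (psiHom k O) χ χ') n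
    rw [← h1, left_eq_add] at h2
    rw [h2, ← coeff_ghost_bSeries χ, hα, ghost_one, map_zero, zero_mul, mul_zero]
  | succ m ih =>
    rw [Fin.prod_univ_succ] at hα
    obtain ⟨η, hη⟩ := exists_pts_bSeries_eq k O (constantCoeff_prod Finset.univ
      (fun i : Fin m => 1 - PowerSeries.C (α i.succ) * PowerSeries.X)
      fun i => constantCoeff_one_sub _)
    have hχ : χ = op (comulHom k O) (linePt k O (α 0)) η :=
      pts_eq_of_bSeries_eq (by rw [bSeries_op_comulHom, bSeries_linePt, hη, hα])
    intro n
    rw [hχ, op_psiHom_add_left, op_comulHom_ghElt, op_comulHom_ghElt, h (α 0) n, ih _ hη n]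
    ring

theorem ghostPairing_of_isSplit_of_isSplit {χ χ' : Pts k O R} (hχ : IsSplit χ)
    (hχ' : IsSplit χ') : GhostPairing χ χ' :=
  ghostPairing_of_isSplit (fun α =>
    (ghostPairing_of_isSplit (fun β => ghostPairing_linePt β α) hχ').comm) hχ

end SplitPairing

/-! ### Density of the split points -/

section Density

theorem exists_prod_eq_of_coeff_zero {K : Type*} [Field K] [IsAlgClosed K] (g : Polynomial K)
    (hg : g.coeff 0 = 1) : ∃ (m : ℕ) (α : Fin m → K),
      (g : PowerSeries K) = ∏ i, (1 - PowerSeries.C (α i) * PowerSeries.X) := by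
  induction hd : g.natDegree generalizing g with
  | zero =>
    refine ⟨0, Fin.elim0, ?_⟩
    rw [Polynomial.eq_C_of_natDegree_eq_zero hd, hg, Fin.prod_univ_zero, map_one,
      Polynomial.coe_one]
  | succ d ih =>
    have hg0 : g.degree ≠ 0 := by
      intro h
      rw [Polynomial.natDegree_eq_zero_iff_degree_le_zero.2 h.le] at hd
      omega
    obtain ⟨r, hr⟩ := IsAlgClosed.exists_root g hg0
    have hr0 : r ≠ 0 := by
      rintro rfl
      rw [Polynomial.IsRoot.def, ← Polynomial.coeff_zero_eq_eval_zero, hg] at hr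
      exact one_ne_zero hr
    obtain ⟨h, rfl⟩ := Polynomial.dvd_iff_isRoot.2 hr
    have hh : h ≠ 0 := by
      rintro rfl
      simp at hg
    rw [Polynomial.natDegree_mul (Polynomial.X_sub_C_ne_zero r) hh,
      Polynomial.natDegree_X_sub_C] at hd
    -- The constant term is nonzero, so `r` is invertible and `X - r = -r (1 - r⁻¹ X)`. The scalar
    -- `-r` moves to the cofactor, whose constant term becomes `1`.
    have he : (Polynomial.X - Polynomial.C r) * h =
        (1 - Polynomial.C r⁻¹ * Polynomial.X) * (Polynomial.C (-r) * h) := by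
      have : Polynomial.C r * Polynomial.C r⁻¹ = 1 := by
        rw [← Polynomial.C_mul, mul_inv_cancel₀ hr0, Polynomial.C_1]
      rw [Polynomial.C_neg]
      linear_combination (-Polynomial.X * h) * this
    obtain ⟨m, α, hα⟩ := ih (Polynomial.C (-r) * h)
      (by
        rw [he, Polynomial.mul_coeff_zero] at hg
        simpa using hg)
      (by
        rw [Polynomial.natDegree_C_mul (neg_ne_zero.2 hr0)]
        omega)
    refine ⟨m + 1, Fin.cons r⁻¹ α, ?_⟩
    rw [he, Polynomial.coe_mul, hα, Fin.prod_univ_succ]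
    simp

variable (k O) in
-- A finitely supported sequence gives a polynomial with constant term `1`, which splits into
-- factors `1 - α t` over an algebraically closed field.
theorem exists_isSplit {K : Type w} [Field K] [IsAlgClosed K] [Algebra k K] (x : ℕ → K) (N : ℕ)
    (hx : ∀ i, N ≤ i → x i = 0) :
    ∃ χ : Pts k O K, IsSplit χ ∧ ∀ i, χ (bElt k O (i + 1)) = x i := by
  let g : Polynomial K := 1 + Polynomial.X * ∑ i ∈ Finset.range N, Polynomial.monomial i (x i)
  have hg0 : g.coeff 0 = 1 := by simp [g]
  have hg : ∀ i, g.coeff (i + 1) = x i := by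
    intro i
    simp only [g, Polynomial.coeff_add, Polynomial.coeff_one, Polynomial.coeff_X_mul,
      Polynomial.finsetSum_coeff, Polynomial.coeff_monomial, Finset.sum_ite_eq', Finset.mem_range]
    rw [if_neg (by omega), zero_add, ite_eq_left_iff]
    exact fun h => (hx i (not_lt.1 h)).symm
  obtain ⟨χ, hχ⟩ := exists_pts_bSeries_eq k O (f := (g : PowerSeries K)) (by
    rw [← PowerSeries.coeff_zero_eq_constantCoeff_apply, Polynomial.coeff_coe, hg0])
  obtain ⟨m, α, hα⟩ := exists_prod_eq_of_coeff_zero g hg0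
  refine ⟨χ, ⟨m, α, hχ.trans hα⟩, fun i => ?_⟩
  rw [← coeff_bSeries, hχ, Polynomial.coeff_coe, hg]

theorem pairHom_bElt_ext {R : Type w} [CommRing R] [Algebra k R]
    {φ ψ : Hall k O ⊗[k] Hall k O →ₐ[k] R}
    (h1 : ∀ r, φ (bElt k O (r + 1) ⊗ₜ 1) = ψ (bElt k O (r + 1) ⊗ₜ 1))
    (h2 : ∀ r, φ (1 ⊗ₜ bElt k O (r + 1)) = ψ (1 ⊗ₜ bElt k O (r + 1))) : φ = ψ := by
  refine Algebra.TensorProduct.ext ?_ ?_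
  · refine hall_algHom_ext fun r => ?_
    cases r with
    | zero => rw [bElt_zero, map_one, map_one]
    | succ r => exact h1 r
  · refine hall_algHom_ext fun r => ?_
    cases r with
    | zero => rw [bElt_zero, map_one, map_one]
    | succ r => exact h2 r

/-- The tensor square is a polynomial ring in two sequences of variables. An element involves
finitely many of them, so its value at any `K`-point is its value at a pair of split points. A
polynomial vanishing at all points of an infinite field is zero. -/
theorem eq_zero_of_isSplit {K : Type w} [Field K] [IsAlgClosed K] [Algebra k K]
    {z : Hall k O ⊗[k] Hall k O}
    (hz : ∀ χ χ' : Pts k O K, IsSplit χ → IsSplit χ' → pairHom χ χ' z = 0) : z = 0 := by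
  obtain ⟨η, hη⟩ := exists_hall_algHom (k := k) (O := O)
    fun i => (MvPolynomial.X (Sum.inl i) : MvPolynomial (ℕ ⊕ ℕ) k)
  obtain ⟨η', hη'⟩ := exists_hall_algHom (k := k) (O := O)
    fun i => (MvPolynomial.X (Sum.inr i) : MvPolynomial (ℕ ⊕ ℕ) k)
  have hp : pairHom η η' z = 0 := by
    refine MvPolynomial.map_injective (algebraMap k K) (algebraMap k K).injective ?_
    rw [map_zero]
    refine MvPolynomial.funext fun x => ?_
    rw [map_zero, MvPolynomial.eval_map, ← MvPolynomial.aeval_def]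
    let N := (pairHom η η' z).vars.sup (Sum.elim id id) + 1
    have hN : ∀ i ∈ (pairHom η η' z).vars, Sum.elim id id i < N := fun i hi =>
      Nat.lt_succ_of_le (Finset.le_sup (f := Sum.elim id id) hi)
    obtain ⟨χ, hχ, h1⟩ := exists_isSplit k O (fun i => if i < N then x (Sum.inl i) else 0) N
      fun i hi => if_neg (not_lt.2 hi)
    obtain ⟨χ', hχ', h2⟩ := exists_isSplit k O (fun i => if i < N then x (Sum.inr i) else 0) N
      fun i hi => if_neg (not_lt.2 hi)
    let y : ℕ ⊕ ℕ → K := Sum.elim (fun i => if i < N then x (Sum.inl i) else 0)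
      fun i => if i < N then x (Sum.inr i) else 0
    -- Coordinates from `N` on do not occur in the polynomial, so setting them to zero preserves its
    -- value and makes both points split.
    have hxy : MvPolynomial.aeval x (pairHom η η' z) = MvPolynomial.aeval y (pairHom η η' z) := by
      refine MvPolynomial.hom_congr_vars (f₁ := (MvPolynomial.aeval (R := k) x).toRingHom)
        (f₂ := (MvPolynomial.aeval (R := k) y).toRingHom) (RingHom.ext fun a => by simp)
        (fun i hi _ => ?_) rfl
      change MvPolynomial.aeval x (MvPolynomial.X i) = MvPolynomial.aeval y (MvPolynomial.X i)
      rw [MvPolynomial.aeval_X, MvPolynomial.aeval_X]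
      cases i with
      | inl i => exact (if_pos (hN _ hi)).symm
      | inr i => exact (if_pos (hN _ hi)).symm
    have hy : (MvPolynomial.aeval y).comp (pairHom η η') = pairHom χ χ' := by
      refine pairHom_bElt_ext (fun r => ?_) (fun r => ?_)
      · rw [AlgHom.comp_apply, pairHom_tmul, pairHom_tmul, hη, h1, map_one, map_one, mul_one,
          mul_one, MvPolynomial.aeval_X]
        rfl
      · rw [AlgHom.comp_apply, pairHom_tmul, pairHom_tmul, hη', h2, map_one, map_one, one_mul,
          one_mul, MvPolynomial.aeval_X]
        rfl
    rw [hxy, ← AlgHom.comp_apply, hy, hz χ χ' hχ hχ']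
  letI := tensorCommRing k O
  -- A left inverse of `pairHom η η'`, which transfers the vanishing of the polynomial back to `z`.
  let θ : MvPolynomial (ℕ ⊕ ℕ) k →ₐ[k] Hall k O ⊗[k] Hall k O :=
    MvPolynomial.aeval (Sum.elim (fun i => bElt k O (i + 1) ⊗ₜ 1) fun i => 1 ⊗ₜ bElt k O (i + 1))
  have h : θ.comp (pairHom η η') = AlgHom.id k _ := by
    refine pairHom_bElt_ext (fun r => ?_) (fun r => ?_)
    · rw [AlgHom.comp_apply, pairHom_tmul, hη, map_one, mul_one, MvPolynomial.aeval_X]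
      rfl
    · rw [AlgHom.comp_apply, pairHom_tmul, hη', map_one, one_mul, MvPolynomial.aeval_X]
      rfl
  have := DFunLike.congr_fun h z
  rw [AlgHom.comp_apply, hp, map_zero] at this
  exact this.symm

variable (k) in
theorem algHom_eq_of_isSplit (K : Type w) [Field K] [IsAlgClosed K] [Algebra k K]
    {Φ Φ' : Hall k O →ₐ[k] Hall k O ⊗[k] Hall k O} {f : Hall k O}
    (h : ∀ χ χ' : Pts k O K, IsSplit χ → IsSplit χ' → op Φ χ χ' f = op Φ' χ χ' f) :
    Φ f = Φ' f := by
  refine sub_eq_zero.1 (eq_zero_of_isSplit (K := K) fun χ χ' hχ hχ' => ?_)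
  rw [map_sub, ← op_apply, ← op_apply, h χ χ' hχ hχ', sub_self]

/-- The defining property fixes the product of split points over `AlgebraicClosure k`, a ring in the
universe over which `IsWittMul` quantifies, and density does the rest. -/
theorem eq_wittMul {Φ : Hall k O →ₐ[k] Hall k O ⊗[k] Hall k O} (h : IsWittMul Φ) :
    Φ = wittMul k O := by
  refine AlgHom.ext fun f => algHom_eq_of_isSplit k (AlgebraicClosure k) ?_
  rintro χ χ' ⟨m, α, hα⟩ ⟨n, β, hβ⟩
  refine DFunLike.congr_fun (pts_eq_of_bSeries_eq ?_) f
  rw [h _ m n α β χ χ' hα hβ, isWittMul_wittMul k O _ m n α β χ χ' hα hβ]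

/-- Density lifts the ghost formula from split points to the tensor square. Hence `U` is diagonal in
ghost coordinates over every `R`, with factors equal to the ghost components of `κ`. -/
theorem psiHom_ghElt (n : ℕ) : psiHom k O (ghElt k O n) =
    (1 - (resCard O : k) ^ (n + 1)) • (ghElt k O n ⊗ₜ[k] ghElt k O n) := by
  refine sub_eq_zero.1 (eq_zero_of_isSplit (K := AlgebraicClosure k) fun χ χ' hχ hχ' => ?_)
  rw [map_sub, ← op_apply, ghostPairing_of_isSplit_of_isSplit hχ hχ' n, map_smul, pairHom_tmul,
    Algebra.smul_def, map_sub, map_one, map_pow, map_natCast, sub_self]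

theorem op_psiHom_ghElt {R : Type w} [CommRing R] [Algebra k R] (χ χ' : Pts k O R) (n : ℕ) :
    op (psiHom k O) χ χ' (ghElt k O n) =
      algebraMap k R (1 - (resCard O : k) ^ (n + 1)) * (χ (ghElt k O n) * χ' (ghElt k O n)) := by
  rw [op_apply, psiHom_ghElt, map_smul, pairHom_tmul, Algebra.smul_def]

theorem baseChange_kappaPt_ghElt (R : Type w) [CommRing R] [Algebra k R] (n : ℕ) :
    baseChange R (kappaPt k O) (ghElt k O n) =
      algebraMap k R (1 - (resCard O : k) ^ (n + 1)) := by
  rw [← kappaPt_ghElt]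
  rfl

end Density

end HallWitt

end

theorem mainTheorem11 (k : Type v) [Field k] [CharZero k]
    (O : Type u) [CommRing O] [IsDomain O] [IsDiscreteValuationRing O]
    [Finite (IsLocalRing.ResidueField O)] :
    -- the Hall algebra `A` is commutative, and `χ ↦ B_χ` identifies `W(R)` with `1 + tR[[t]]`
    (∀ x y : Hall k O, x * y = y * x) ∧
    (∀ (R : Type w) [CommRing R] [Algebra k R],
      Function.Bijective (bSeries : Pts k O R → OneAdd R)) ∧
    ∃ add mul U : Hall k O →ₐ[k] Hall k O ⊗[k] Hall k O, ∃ κ : Pts k O k,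
      -- `add` is the group law `⊞`, given by the Hall comultiplication
      add.toLinearMap = comul k O ∧
      (∀ (R : Type w) [CommRing R] [Algebra k R] (χ χ' : Pts k O R),
        (bSeries (op add χ χ')).1 = (bSeries χ).1 * (bSeries χ').1) ∧
      -- `mul` is the Witt multiplication `⊠`
      IsWittMul mul ∧ (∀ mul', IsWittMul mul' → mul' = mul) ∧
      -- (a) `Ψ` defines a unique morphism `U : W × W → W`, which is a bihomomorphism
      (∀ n, U (bElt k O n) = PowerSeries.coeff n (Psi k O)) ∧
      (∀ U' : Hall k O →ₐ[k] Hall k O ⊗[k] Hall k O,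
        (∀ n, U' (bElt k O n) = PowerSeries.coeff n (Psi k O)) → U' = U) ∧
      (∀ (R : Type w) [CommRing R] [Algebra k R] (χ χ' χ'' : Pts k O R),
        op U (op add χ χ') χ'' = op add (op U χ χ'') (op U χ' χ'') ∧
        op U χ (op add χ' χ'') = op add (op U χ χ') (op U χ χ'')) ∧
      -- (b) `U` is `W`-bilinear, and it is given by the point `κ`
      (∀ (R : Type w) [CommRing R] [Algebra k R] (χ χ' χ'' : Pts k O R),
        op U (op mul χ χ') χ'' = op mul χ (op U χ' χ'') ∧
        op U χ' (op mul χ χ'') = op mul χ (op U χ' χ'')) ∧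
      (∀ (R : Type w) [CommRing R] [Algebra k R] (χ χ' : Pts k O R),
        op U χ χ' = op mul (op mul χ χ') (baseChange R κ)) ∧
      -- (c) the series of `κ`
      (bSeries κ).1 = PowerSeries.map (Int.castRingHom k) (kappaSeries (resCard O)) := by
  refine ⟨hall_mul_comm, fun R _ _ => bSeries_bijective R, comulHom k O, wittMul k O, psiHom k O,
    kappaPt k O, rfl, fun R _ _ => bSeries_op_comulHom, isWittMul_wittMul k O,
    fun _ => eq_wittMul, psiHom_bElt, fun U' hU' => hall_algHom_ext fun n => ?_,
    fun R _ _ χ χ' χ'' => ⟨op_psiHom_add_left χ χ' χ'', op_psiHom_add_right χ χ' χ''⟩,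
    fun R _ _ χ χ' χ'' => ⟨hall_algHom_ext_ghost fun n => ?_, hall_algHom_ext_ghost fun n => ?_⟩,
    fun R _ _ χ χ' => hall_algHom_ext_ghost fun n => ?_, bSeries_kappaPt k O⟩
  · rw [hU', psiHom_bElt]
  -- On ghost elements `⊠` is the product and `U` is the product scaled by `1 - q ^ (n + 1)`, so
  -- both bilinearity identities and the formula with `κ` hold by commutativity and associativity in
  -- `R`.
  · rw [op_psiHom_ghElt, op_wittMul_ghElt, op_wittMul_ghElt, op_psiHom_ghElt]
    ring
  · rw [op_psiHom_ghElt, op_wittMul_ghElt, op_wittMul_ghElt, op_psiHom_ghElt]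
    ring
  · rw [op_psiHom_ghElt, op_wittMul_ghElt, op_wittMul_ghElt, baseChange_kappaPt_ghElt, mul_comm]
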